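/- Let $\alpha\in[0,1)$ and $k\in\mathbb Z$, and put $$S_{\alpha,k}=-\frac{\mathrm d^2}{\mathrm dx^2}+k^2|x|^{2\alpha}+\frac{\alpha(2+\alpha)}{4x^2}.$$ Let $A_\alpha^\pm(k)$ be the operator in $L^2(\mathbb R^\pm)$ with domain $C^\infty_c(\mathbb R^\pm)$ acting as $S_{\alpha,k}$, and let $A_\alpha(k)=A_\alpha^-(k)\oplus A_\alpha^+(k)$ in $L^2(\mathbb R^-)\oplus L^2(\mathbb R^+)\cong L^2(\mathbb R)$, with domain $C^\infty_c(\mathbb R^-)\boxplus C^\infty_c(\mathbb R^+)$, adjoint $A_\alpha(k)^*$ and operator closure $\overline{A_\alpha(k)}$. Write $g^\pm$ for the restriction of $g$ to $\mathbb R^\pm$. Let $P\in C^\infty_c(\mathbb R)$ be a cut-off with $P(0)=1$ and $P'(0)=0$ (for instance $P=1$ on $|x|<1$ and $P=0$ on $|x|>2$). (1) For every $g\in\mathcal D(A_\alpha(k)^*)$ there exist a unique $\varphi\in\mathcal D(\overline{A_\alpha(k)})$ and unique coefficients $g_0^\pm,g_1^\pm\in\mathbb C$ such that, on $\mathbb R^-$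 and on $\mathbb R^+$, $$g^\pm(x)=\varphi^\pm(x)+g_0^\pm|x|^{-\alpha/2}P(x)+g_1^\pm|x|^{1+\alpha/2}P(x).$$ The functions $g$ and $\varphi$ have continuous representatives on $\mathbb R^\pm$, with which the identity holds for all $x\ne0$. If $k\neq0$, then $\varphi^\pm\in H^2_0(\mathbb R^\pm)$. (2) The coefficients are those of the short-distance asymptotics of $g$: with the continuous representatives, $$g_0^\pm=\lim_{x\to0^\pm}|x|^{\alpha/2}g^\pm(x),\qquad g_1^\pm=\lim_{x\to0^\pm}|x|^{-(1+\alpha/2)}\big(g^\pm(x)-g_0^\pm|x|^{-\alpha/2}\big),$$ and $g^\pm(x)=g_0^\pm|x|^{-\alpha/2}+g_1^\pm|x|^{1+\alpha/2}+o(|x|^{3/2})$ as $x\to0^\pm$. (3) Consequently, with $g_0^\pm,g_1^\pm$ the coefficients of the representation in (1), the self-adjoint extensions of $A_\alpha(k)$ are classified as follows. Every self-adjoint extension $B$ acts as $Bg=S_{\alpha,k}g^-\oplus S_{\alpha,k}g^+$ (weak derivatives). The restrictions of $A_\alpha(k)^*$ to the vectors $g\in\mathcal D(A_\alpha(k)^*)$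 satisfying one of the following conditions are self-adjoint extensions of $A_\alpha(k)$: - Friedrichs: $g_0^-=g_0^+=0$. This is the Friedrichs extension of $A_\alpha(k)$, and it is the direct sum of the Friedrichs extensions of $A_\alpha^-(k)$ and $A_\alpha^+(k)$. - Family $\mathrm{I_R}$: $g_0^-=0$, $g_1^+=\gamma g_0^+$, with $\gamma\in\mathbb R$. - Family $\mathrm{I_L}$: $g_0^+=0$, $g_1^-=\gamma g_0^-$, with $\gamma\in\mathbb R$. - Family $\mathrm{II}_a$, $a\in\mathbb C$: $g_0^+=a\,g_0^-$, $g_1^-+\overline a\,g_1^+=\gamma g_0^-$, with $\gamma\in\mathbb R$. - Family $\mathrm{III}$: $g_1^-=\gamma_1g_0^-+\zeta g_0^+$, $g_1^+=\overline\zeta g_0^-+\gamma_4g_0^+$, $\zeta=\gamma_2+\mathrm i\gamma_3$, with $(\gamma_1,\gamma_2,\gamma_3,\gamma_4)\in\mathbb R^4$. The Friedrichs extension and the families $\mathrm{I_R}$, $\mathrm{I_L}$, $\mathrm{II}_a$ ($a\in\mathbb C\setminus\{0\}$) and $\mathrm{III}$ are mutually disjoint and exhaust the self-adjoint extensions of $A_\alpha(k)$.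 -/

import Mathlib

open MeasureTheory Filter Topology Asymptotics
open scoped ContDiff ENNReal LinearPMap InnerProductSpace

namespace GrushinFibre

noncomputable section

/-- The two sides of the singularity `x = 0`. -/
inductive Side
  | minus
  | plus
  deriving DecidableEq

instance : Fintype Side where
  elems := {Side.minus, Side.plus}
  complete := by intro s; cases s <;> simp

/-- The open half-lines `ℝ⁻ = (-∞, 0)` and `ℝ⁺ = (0, ∞)`. -/
def halfLine : Side → Set ℝ
  | Side.minus => Set.Iio 0
  | Side.plus => Set.Ioi 0

theorem isOpen_halfLine (s : Side) : IsOpen (halfLine s) := by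
  cases s
  · exact isOpen_Iio
  · exact isOpen_Ioi

/-- Lebesgue measure on the half-line `ℝ^±`. -/
abbrev sideMeasure (s : Side) : Measure ℝ := (volume : Measure ℝ).restrict (halfLine s)

/-- `L²(ℝ^±, dx)`, complex valued. -/
abbrev HalfSpace (s : Side) : Type := Lp ℂ 2 (sideMeasure s)

/-- The bilateral fibre `L²(ℝ⁻, dx) ⊕ L²(ℝ⁺, dx) ≅ L²(ℝ, dx)` (Hilbert direct sum). -/
abbrev FibreSpace : Type := PiLp 2 HalfSpace

/-- `f ∈ C_c^∞(ℝ^±)`. -/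
def IsTest (s : Side) (f : ℝ → ℂ) : Prop :=
  ContDiff ℝ ∞ f ∧ HasCompactSupport f ∧ tsupport f ⊆ halfLine s

/-- The potential `k² |x|^{2α} + α (2 + α) / (4 x²)`. -/
def potential (α : ℝ) (k : ℤ) (x : ℝ) : ℝ :=
  (k : ℝ) ^ 2 * |x| ^ (2 * α) + α * (2 + α) / (4 * x ^ 2)

/-- The differential expression `S_{α,k} f = - f'' + (k² |x|^{2α} + α (2 + α) / (4 x²)) f`
(classical derivatives). -/
def diffExpr (α : ℝ) (k : ℤ) (f : ℝ → ℂ) (x : ℝ) : ℂ :=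
  -(deriv (deriv f) x) + (potential α k x : ℂ) * f x

theorem IsTest.zero (s : Side) : IsTest s 0 :=
  ⟨contDiff_const, HasCompactSupport.zero, by simp [tsupport, Function.support_zero]⟩

theorem IsTest.add {s : Side} {f g : ℝ → ℂ} (hf : IsTest s f) (hg : IsTest s g) :
    IsTest s (f + g) :=
  ⟨hf.1.add hg.1, hf.2.1.add hg.2.1,
    (tsupport_add f g).trans (Set.union_subset hf.2.2 hg.2.2)⟩

theorem IsTest.smul {s : Side} {f : ℝ → ℂ} (c : ℂ) (hf : IsTest s f) : IsTest s (c • f) :=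
  ⟨contDiff_const.smul hf.1, hf.2.1.smul_left (f := fun _ => c),
    (tsupport_smul_subset_right (fun _ => c) f).trans hf.2.2⟩

theorem IsTest.differentiable {s : Side} {f : ℝ → ℂ} (hf : IsTest s f) : Differentiable ℝ f :=
  hf.1.differentiable (by simp)

theorem IsTest.differentiable_deriv {s : Side} {f : ℝ → ℂ} (hf : IsTest s f) :
    Differentiable ℝ (deriv f) :=
  ((contDiff_infty_iff_deriv.1 hf.1).2).differentiable (by simp)

theorem diffExpr_add {s : Side} (α : ℝ) (k : ℤ) {f g : ℝ → ℂ} (hf : IsTest s f)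
    (hg : IsTest s g) : diffExpr α k (f + g) = diffExpr α k f + diffExpr α k g := by
  have h1 : deriv (f + g) = deriv f + deriv g := by
    funext x; exact deriv_add (hf.differentiable x) (hg.differentiable x)
  funext x
  simp only [diffExpr, h1, Pi.add_apply]
  rw [deriv_add (hf.differentiable_deriv x) (hg.differentiable_deriv x)]
  ring

theorem diffExpr_smul {s : Side} (α : ℝ) (k : ℤ) {f : ℝ → ℂ} (c : ℂ) (hf : IsTest s f) :
    diffExpr α k (c • f) = c • diffExpr α k f := by
  have h1 : deriv (c • f) = c • deriv f := by
    funext x; exact deriv_const_smul c (hf.differentiable x)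
  funext x
  simp only [diffExpr, h1, Pi.smul_apply, smul_eq_mul]
  rw [deriv_const_smul c (hf.differentiable_deriv x)]
  simp only [smul_eq_mul]
  ring

/-- The graph `{(f, S_{α,k} f) : f ∈ C_c^∞(ℝ^±)}` in `L²(ℝ^±) × L²(ℝ^±)`. -/
def minimalGraph (α : ℝ) (k : ℤ) (s : Side) : Submodule ℂ (HalfSpace s × HalfSpace s) where
  carrier := {p | ∃ f, IsTest s f ∧ p.1 =ᵐ[sideMeasure s] f ∧
    p.2 =ᵐ[sideMeasure s] diffExpr α k f}
  zero_mem' := by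
    refine ⟨0, IsTest.zero s, Lp.coeFn_zero _ _ _, ?_⟩
    have h : diffExpr α k (0 : ℝ → ℂ) = 0 := by
      simpa using diffExpr_smul (s := s) α k 0 (IsTest.zero s)
    rw [h]
    exact Lp.coeFn_zero _ _ _
  add_mem' := by
    rintro p q ⟨f, hf, hf1, hf2⟩ ⟨g, hg, hg1, hg2⟩
    refine ⟨f + g, hf.add hg, (Lp.coeFn_add _ _).trans (hf1.add hg1), ?_⟩
    rw [diffExpr_add α k hf hg]
    exact (Lp.coeFn_add _ _).trans (hf2.add hg2)
  smul_mem' := by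
    rintro c p ⟨f, hf, hf1, hf2⟩
    refine ⟨c • f, hf.smul c, (Lp.coeFn_smul _ _).trans (hf1.const_smul c), ?_⟩
    rw [diffExpr_smul α k c hf]
    exact (Lp.coeFn_smul _ _).trans (hf2.const_smul c)

/-- The half-line operator `A_α^±(k)`: it acts as `S_{α,k}` on the domain `C_c^∞(ℝ^±)`. -/
def halfOp (α : ℝ) (k : ℤ) (s : Side) : HalfSpace s →ₗ.[ℂ] HalfSpace s :=
  (minimalGraph α k s).toLinearPMap

/-- `minimalGraph` is the graph of an operator, so `halfOp` has exactly that graph. -/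
theorem halfOp_graph (α : ℝ) (k : ℤ) (s : Side) :
    (halfOp α k s).graph = minimalGraph α k s := by
  apply Submodule.toLinearPMap_graph_eq
  rintro ⟨u, v⟩ ⟨f, hf, hf1, hf2⟩ hu
  simp only at hf1 hf2 hu ⊢
  have h0 : f =ᵐ[sideMeasure s] (0 : ℝ → ℂ) := by
    rw [hu] at hf1
    exact hf1.symm.trans (Lp.coeFn_zero _ _ _)
  have hon : Set.EqOn f 0 (halfLine s) :=
    Measure.eqOn_open_of_ae_eq h0 (isOpen_halfLine s)
      hf.1.continuous.continuousOn continuousOn_const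
  have hz : f = 0 := by
    funext x
    by_cases hx : x ∈ halfLine s
    · exact hon hx
    · exact image_eq_zero_of_notMem_tsupport fun h => hx (hf.2.2 h)
  have hS : diffExpr α k f = 0 := by
    rw [hz]
    simpa using diffExpr_smul (s := s) α k 0 (IsTest.zero s)
  rw [hS] at hf2
  exact Lp.ext (hf2.trans (Lp.coeFn_zero _ _ _).symm)

/-- The direct sum `B⁻ ⊕ B⁺` of two operators, with domain `D(B⁻) ⊞ D(B⁺)`. -/
def directSum (B : ∀ s, HalfSpace s →ₗ.[ℂ] HalfSpace s) : FibreSpace →ₗ.[ℂ] FibreSpace where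
  domain :=
    { carrier := {g | ∀ s, g s ∈ (B s).domain}
      zero_mem' := fun s => (B s).domain.zero_mem
      add_mem' := fun hf hg s => (B s).domain.add_mem (hf s) (hg s)
      smul_mem' := fun c _ hf s => (B s).domain.smul_mem c (hf s) }
  toFun :=
    { toFun := fun g => WithLp.toLp 2 fun s => B s ⟨(g : FibreSpace) s, g.2 s⟩
      map_add' := fun f g => by
        ext1 s
        exact (B s).map_add ⟨(f : FibreSpace) s, f.2 s⟩ ⟨(g : FibreSpace) s, g.2 s⟩
      map_smul' := fun c f => by
        ext1 s
        exact (B s).map_smul c ⟨(f : FibreSpace) s, f.2 s⟩ }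

/-- The bilateral-fibre operator `A_α(k) = A_α^-(k) ⊕ A_α^+(k)`. -/
def fibreOp (α : ℝ) (k : ℤ) : FibreSpace →ₗ.[ℂ] FibreSpace := directSum (halfOp α k)

/-- `v = S_{α,k} u` on `ℝ^±` in the sense of weak derivatives. -/
def IsWeakDiffExpr (α : ℝ) (k : ℤ) (s : Side) (u v : HalfSpace s) : Prop :=
  ∀ f, IsTest s f → ∫ x in halfLine s, v x * f x = ∫ x in halfLine s, u x * diffExpr α k f x

/-- `u ∈ H²₀(ℝ^±)`, the closure of `C_c^∞(ℝ^±)` in the norm of `H²(ℝ^±)`: the functions `fₙ`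
converge to `u` in `L²` and their first and second derivatives converge in `L²`. -/
def MemH20 (s : Side) (u : HalfSpace s) : Prop :=
  ∃ (f : ℕ → ℝ → ℂ) (v w : HalfSpace s), (∀ n, IsTest s (f n)) ∧
    Tendsto (fun n => eLpNorm (fun x => f n x - u x) 2 (sideMeasure s)) atTop (𝓝 0) ∧
    Tendsto (fun n => eLpNorm (fun x => deriv (f n) x - v x) 2 (sideMeasure s)) atTop (𝓝 0) ∧
    Tendsto (fun n => eLpNorm (fun x => deriv (deriv (f n)) x - w x) 2 (sideMeasure s))
      atTop (𝓝 0)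

section Friedrichs

variable {H : Type*} [NormedAddCommGroup H] [InnerProductSpace ℂ H]

/-- `u` belongs to the form domain of the densely defined non-negative symmetric operator `A`,
the completion of `D(A)` in the norm `(⟨u, A u⟩ + ‖u‖²)^{1/2}`: some sequence in `D(A)` converges
to `u` and is Cauchy for that norm. -/
def MemFormDomain (A : H →ₗ.[ℂ] H) (u : H) : Prop :=
  ∃ f : ℕ → A.domain, Tendsto (fun n => (f n : H)) atTop (𝓝 u) ∧
    Tendsto (fun p : ℕ × ℕ => ⟪((f p.1 - f p.2 : A.domain) : H), A (f p.1 - f p.2)⟫_ℂ)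
      (atTop ×ˢ atTop) (𝓝 0)

/-- `B` is the Friedrichs extension of `A`: the restriction of `A†` to the vectors of `D(A†)` that
lie in the form domain of `A`. -/
def IsFriedrichsExtension [CompleteSpace H] (A B : H →ₗ.[ℂ] H) : Prop :=
  B ≤ A† ∧ ∀ u, u ∈ B.domain ↔ u ∈ A†.domain ∧ MemFormDomain A u

end Friedrichs

/-- The coefficients `(g₀, g₁) = ((g₀⁻, g₀⁺), (g₁⁻, g₁⁺))`. -/
abbrev Coeffs : Type := (Side → ℂ) × (Side → ℂ)

/-- The function `g₀ |x|^{-α/2} P(x) + g₁ |x|^{1+α/2} P(x)`, for scalars `g₀`, `g₁`. -/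
def singularPart (α : ℝ) (P : ℝ → ℂ) (g₀ g₁ : ℂ) (x : ℝ) : ℂ :=
  g₀ * ((|x| ^ (-(α / 2)) : ℝ) : ℂ) * P x + g₁ * ((|x| ^ (1 + α / 2) : ℝ) : ℂ) * P x

/-- `g = φ + g₀ |x|^{-α/2} P + g₁ |x|^{1+α/2} P` in `L²(ℝ⁻) ⊕ L²(ℝ⁺)`, with `φ` in the domain of
the closure of `A_α(k)`. -/
def IsDecomposition (α : ℝ) (k : ℤ) (P : ℝ → ℂ) (g φ : FibreSpace) (c : Coeffs) : Prop :=
  φ ∈ (fibreOp α k).closure.domain ∧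
    ∀ s, ∀ᵐ x ∂(sideMeasure s), g s x = φ s x + singularPart α P (c.1 s) (c.2 s) x

/-- `G` is a continuous representative of `u` on `ℝ^±`. -/
def IsContinuousRep (s : Side) (G : ℝ → ℂ) (u : HalfSpace s) : Prop :=
  ContinuousOn G (halfLine s) ∧ u =ᵐ[sideMeasure s] G

/-- As `x → 0^±`, the numbers `g₀`, `g₁` are the limits of `|x|^{α/2} G(x)` and of
`|x|^{-(1+α/2)} (G(x) - g₀ |x|^{-α/2})`, and
`G(x) = g₀ |x|^{-α/2} + g₁ |x|^{1+α/2} + o(|x|^{3/2})`. -/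
def HasShortRange (α : ℝ) (s : Side) (G : ℝ → ℂ) (g₀ g₁ : ℂ) : Prop :=
  Tendsto (fun x : ℝ => ((|x| ^ (α / 2) : ℝ) : ℂ) * G x) (𝓝[halfLine s] 0) (𝓝 g₀) ∧
  Tendsto (fun x : ℝ => ((|x| ^ (-(1 + α / 2)) : ℝ) : ℂ) *
    (G x - g₀ * ((|x| ^ (-(α / 2)) : ℝ) : ℂ))) (𝓝[halfLine s] 0) (𝓝 g₁) ∧
  (fun x : ℝ => G x - (g₀ * ((|x| ^ (-(α / 2)) : ℝ) : ℂ) + g₁ * ((|x| ^ (1 + α / 2) : ℝ) : ℂ)))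
    =o[𝓝[halfLine s] 0] fun x : ℝ => |x| ^ (3 / 2 : ℝ)

/-- The vectors that admit a decomposition whose coefficients lie in the subspace `L`. -/
def boundarySpace (α : ℝ) (k : ℤ) (P : ℝ → ℂ) (L : Submodule ℂ Coeffs) :
    Submodule ℂ FibreSpace where
  carrier := {g | ∃ φ, ∃ c ∈ L, IsDecomposition α k P g φ c}
  zero_mem' := by
    refine ⟨0, 0, L.zero_mem, Submodule.zero_mem _, fun s => ?_⟩
    filter_upwards with x
    simp [singularPart]
  add_mem' := by
    rintro g h ⟨φ, c, hc, hφ, hg⟩ ⟨ψ, d, hd, hψ, hh⟩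
    refine ⟨φ + ψ, c + d, L.add_mem hc hd, Submodule.add_mem _ hφ hψ, fun s => ?_⟩
    filter_upwards [hg s, hh s, Lp.coeFn_add (g s) (h s), Lp.coeFn_add (φ s) (ψ s)]
      with x h1 h2 h3 h4
    simp only [PiLp.add_apply, h3, h4, Pi.add_apply, h1, h2, singularPart, Prod.fst_add,
      Prod.snd_add]
    ring
  smul_mem' := by
    rintro a g ⟨φ, c, hc, hφ, hg⟩
    refine ⟨a • φ, a • c, L.smul_mem a hc, Submodule.smul_mem _ a hφ, fun s => ?_⟩
    filter_upwards [hg s, Lp.coeFn_smul a (g s), Lp.coeFn_smul a (φ s)] with x h1 h3 h4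
    simp only [PiLp.smul_apply, h3, h4, Pi.smul_apply, h1, singularPart, Prod.smul_fst,
      Prod.smul_snd, smul_eq_mul]
    ring

/-- The restriction of `A_α(k)†` to the vectors `g ∈ D(A_α(k)†)` whose coefficients `(g₀, g₁)`
satisfy the linear boundary condition `L`. -/
def extensionOp (α : ℝ) (k : ℤ) (P : ℝ → ℂ) (L : Submodule ℂ Coeffs) :
    FibreSpace →ₗ.[ℂ] FibreSpace :=
  (fibreOp α k)†.domRestrict (boundarySpace α k P L)

/-- `g₀⁻ = 0 = g₀⁺`. -/
def condF : Submodule ℂ Coeffs where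
  carrier := {c | c.1 Side.minus = 0 ∧ c.1 Side.plus = 0}
  zero_mem' := by simp
  add_mem' := by
    rintro c d ⟨h1, h2⟩ ⟨h3, h4⟩
    simp [h1, h2, h3, h4]
  smul_mem' := by
    rintro a c ⟨h1, h2⟩
    simp [h1, h2]

/-- `g₀⁻ = 0` and `g₁⁺ = γ g₀⁺`. -/
def condIR (γ : ℝ) : Submodule ℂ Coeffs where
  carrier := {c | c.1 Side.minus = 0 ∧ c.2 Side.plus = γ * c.1 Side.plus}
  zero_mem' := by simp
  add_mem' := by
    rintro c d ⟨h1, h2⟩ ⟨h3, h4⟩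
    simp [h1, h2, h3, h4, mul_add]
  smul_mem' := by
    rintro a c ⟨h1, h2⟩
    simp [h1, h2, mul_left_comm]

/-- `g₀⁺ = 0` and `g₁⁻ = γ g₀⁻`. -/
def condIL (γ : ℝ) : Submodule ℂ Coeffs where
  carrier := {c | c.1 Side.plus = 0 ∧ c.2 Side.minus = γ * c.1 Side.minus}
  zero_mem' := by simp
  add_mem' := by
    rintro c d ⟨h1, h2⟩ ⟨h3, h4⟩
    simp [h1, h2, h3, h4, mul_add]
  smul_mem' := by
    rintro a c ⟨h1, h2⟩
    simp [h1, h2, mul_left_comm]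

/-- `g₀⁺ = a g₀⁻` and `g₁⁻ + conj(a) g₁⁺ = γ g₀⁻`. -/
def condII (a : ℂ) (γ : ℝ) : Submodule ℂ Coeffs where
  carrier := {c | c.1 Side.plus = a * c.1 Side.minus ∧
    c.2 Side.minus + (starRingEnd ℂ) a * c.2 Side.plus = γ * c.1 Side.minus}
  zero_mem' := by simp
  add_mem' := by
    rintro c d ⟨h1, h2⟩ ⟨h3, h4⟩
    simp only [Set.mem_ofPred_eq, Prod.fst_add, Prod.snd_add, Pi.add_apply]
    exact ⟨by rw [h1, h3]; ring, by linear_combination h2 + h4⟩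
  smul_mem' := by
    rintro b c ⟨h1, h2⟩
    simp only [Set.mem_ofPred_eq, Prod.smul_fst, Prod.smul_snd, Pi.smul_apply, smul_eq_mul]
    exact ⟨by rw [h1]; ring, by linear_combination b * h2⟩

/-- `g₁⁻ = γ₁ g₀⁻ + ζ g₀⁺` and `g₁⁺ = conj(ζ) g₀⁻ + γ₄ g₀⁺`, where `ζ = γ₂ + i γ₃`. -/
def condIII (γ₁ γ₂ γ₃ γ₄ : ℝ) : Submodule ℂ Coeffs where
  carrier := {c |
    c.2 Side.minus = γ₁ * c.1 Side.minus + (γ₂ + Complex.I * γ₃) * c.1 Side.plus ∧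
    c.2 Side.plus = (starRingEnd ℂ) (γ₂ + Complex.I * γ₃) * c.1 Side.minus
      + γ₄ * c.1 Side.plus}
  zero_mem' := by simp
  add_mem' := by
    rintro c d ⟨h1, h2⟩ ⟨h3, h4⟩
    simp only [Set.mem_ofPred_eq, Prod.fst_add, Prod.snd_add, Pi.add_apply]
    exact ⟨by linear_combination h1 + h3, by linear_combination h2 + h4⟩
  smul_mem' := by
    rintro b c ⟨h1, h2⟩
    simp only [Set.mem_ofPred_eq, Prod.smul_fst, Prod.smul_snd, Pi.smul_apply, smul_eq_mul]
    exact ⟨by linear_combination b * h1, by linear_combination b * h2⟩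

/-- The labels of the sub-families of extensions: Friedrichs, `I_R`, `I_L`, `II_a`, `III`. -/
inductive FamilyLabel
  | friedrichs
  | IR
  | IL
  | II (a : ℂ)
  | III

/-- The sub-families of extensions of `A_α(k)`, as sets of operators. -/
def family (α : ℝ) (k : ℤ) (P : ℝ → ℂ) : FamilyLabel → Set (FibreSpace →ₗ.[ℂ] FibreSpace)
  | .friedrichs => {extensionOp α k P condF}
  | .IR => {B | ∃ γ : ℝ, B = extensionOp α k P (condIR γ)}
  | .IL => {B | ∃ γ : ℝ, B = extensionOp α k P (condIL γ)}
  | .II a => {B | ∃ γ : ℝ, B = extensionOp α k P (condII a γ)}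
  | .III => {B | ∃ γ₁ γ₂ γ₃ γ₄ : ℝ, B = extensionOp α k P (condIII γ₁ γ₂ γ₃ γ₄)}

end

end GrushinFibre

namespace GrushinFibre

noncomputable section

/-! The whole theorem is governed by the behaviour at the origin. The numbers -α/2 and 1 + α/2 are
the roots of m(m - 1) = α(2 + α)/4, so w₀ = |x|^{-α/2} and w₁ = |x|^{1+α/2} solve the homogeneous
equation with k = 0. For α < 1 both are square integrable near 0 (limit-circle case), while no
boundary value survives at infinity (limit-point case). Each half-line therefore contributes two
boundary values, the coefficients of w₀ and w₁. All analysis is done on (0, ∞) and carried to the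
other side by reflection.

The adjoint is the maximal operator, that is, the operator of weak solutions
(`mem_halfOp_adjoint_graph`). If S_{α,k} g = h weakly with g, h in L², the term k²|x|^{2α} g is
moved to the right-hand side. Variation of parameters from the origin yields a particular solution
of size o(x^{3/2}), and a du Bois-Reymond argument shows that what remains is C₀ w₀ + C₁ w₁
(`WeakPair.exists_isRegularRep`). Green's formula then has the single boundary term (1 + α)(C₁ conj
D₀ - C₀ conj D₁), where 1 + α is the Wronskian of w₀ and w₁ (`green_formula`). This form is
non-degenerate, so the closure of the minimal operator consists of the maximal vectors with C₀ = C₁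
= 0 (`mem_topologicalClosure_minimalGraph`). The decomposition of g follows by subtracting the
cut-off singular functions that have the same coefficients as g (`isDecomposition_iff`).

On the two sides together the boundary form lives on a four-dimensional space, and maximal isotropic
subspaces give self-adjoint extensions (`IsLagrangian.isSelfAdjoint`). An isotropic subspace is
sorted by its projection to (g₀⁻, g₀⁺): onto the plane it gives the graph of a Hermitian matrix
(III), onto a line it gives I_R, I_L or II_a according to the direction, and onto 0 it gives
Friedrichs (`exists_le_of_isotropic`). A self-adjoint operator has no proper self-adjoint extension,
so containment in a condition is enough. The same projection, which does not see the real
parameters, separates the families.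

Two facts need separate estimates. That the closure lies in H²₀ rests on a Rellich-type inequality
whose constant is positive exactly because α(2 + α)/4 < 3/4 (`exists_real_second_order_bound`). That
g₀ = 0 describes the Friedrichs extension rests on the bound |u| ≤ |x|^{1/2} near 0 for form-domain
vectors in one direction, and on cutting off w₁ at the origin with small energy in the other
(`memFormDomain_iff`). -/

/-! ### Primitives of locally integrable functions on (0, ∞). -/

/-- Integration by parts for primitives of integrable functions, real-valued case. -/
theorem integral_mul_of_primitive_real {F f G g : ℝ → ℝ} {a b : ℝ}
    (hf : IntervalIntegrable f volume a b) (hg : IntervalIntegrable g volume a b)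
    (hF : ∀ x ∈ Set.uIcc a b, F x = F a + ∫ t in a..x, f t)
    (hG : ∀ x ∈ Set.uIcc a b, G x = G a + ∫ t in a..x, g t) :
    ∫ x in a..b, (f x * G x + F x * g x) = F b * G b - F a * G a := by
  -- `F` and `G` are prescribed only between `a` and `b`. The primitives `F'`, `G'` agree with them
  -- there and are absolutely continuous, so the product rule for absolutely continuous functions
  -- applies.
  set F' : ℝ → ℝ := fun x => F a + ∫ t in a..x, f t
  set G' : ℝ → ℝ := fun x => G a + ∫ t in a..x, g t
  have hc : ∀ c : ℝ, AbsolutelyContinuousOnInterval (fun _ => c) a b := fun c =>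
    (contDiff_const (n := 1)).contDiffOn.absolutelyContinuousOnInterval
  have hF' : AbsolutelyContinuousOnInterval F' a b :=
    (hc _).add (hf.absolutelyContinuousOnInterval_intervalIntegral (by simp))
  have hG' : AbsolutelyContinuousOnInterval G' a b :=
    (hc _).add (hg.absolutelyContinuousOnInterval_intervalIntegral (by simp))
  have h := hF'.integral_deriv_mul_eq_sub hG'
  rw [hF b (by simp), hG b (by simp)]
  have e1 : F' a = F a := by simp [F']
  have e2 : G' a = G a := by simp [G']
  rw [e1, e2] at h
  rw [← h]
  apply intervalIntegral.integral_congr_ae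
  filter_upwards [hf.ae_hasDerivAt_integral, hg.ae_hasDerivAt_integral] with x h1 h2 hx
  have hx' := Set.uIoc_subset_uIcc hx
  have d1 : deriv F' x = f x := ((h1 hx' a (by simp)).const_add (F a)).deriv
  have d2 : deriv G' x = g x := ((h2 hx' a (by simp)).const_add (G a)).deriv
  rw [d1, d2, hF x hx', hG x hx']

/-- `F` is a primitive on `(0, ∞)` of the locally integrable function `f`. -/
structure IsPrimitive (F f : ℝ → ℂ) : Prop where
  intervalIntegrable : ∀ a b, 0 < a → 0 < b → IntervalIntegrable f volume a b
  integral_eq : ∀ a b, 0 < a → 0 < b → ∫ x in a..b, f x = F b - F a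

theorem uIcc_subset_Ioi {a b : ℝ} (ha : 0 < a) (hb : 0 < b) : Set.uIcc a b ⊆ Set.Ioi 0 := by
  intro x hx
  exact lt_of_lt_of_le (lt_min ha hb) hx.1

namespace IsPrimitive

variable {F f G g : ℝ → ℂ}

theorem eq_add (hF : IsPrimitive F f) {a x : ℝ} (ha : 0 < a) (hx : 0 < x) :
    F x = F a + ∫ t in a..x, f t := by
  rw [hF.integral_eq a x ha hx]; ring

theorem continuousOn (hF : IsPrimitive F f) : ContinuousOn F (Set.Ioi 0) := by
  intro x hx
  have hx0 : (0 : ℝ) < x := hx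
  have hI : IntervalIntegrable f volume (x / 2) (x + 1) :=
    hF.intervalIntegrable _ _ (by linarith) (by linarith)
  have hc := intervalIntegral.continuousOn_primitive_interval' hI
    (a := x / 2) Set.left_mem_uIcc
  have hmem : Set.uIcc (x / 2) (x + 1) ∈ 𝓝 x := by
    rw [Set.uIcc_of_le (by linarith)]
    exact Icc_mem_nhds (by linarith) (by linarith)
  have h2 : ContinuousAt (fun y => F (x / 2) + ∫ t in (x / 2)..y, f t) x :=
    continuousAt_const.add (hc.continuousAt hmem)
  refine (h2.congr ?_).continuousWithinAt
  filter_upwards [Ioi_mem_nhds hx0] with y hy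
  exact (hF.eq_add (by linarith) hy).symm

theorem congr (hF : IsPrimitive F f) (h1 : ∀ x, 0 < x → F x = G x)
    (h2 : ∀ᵐ x ∂(volume.restrict (Set.Ioi (0 : ℝ))), f x = g x) : IsPrimitive G g := by
  have h3 : ∀ a b : ℝ, 0 < a → 0 < b → ∀ᵐ x ∂volume, x ∈ Set.uIoc a b → f x = g x := by
    intro a b ha hb
    rw [ae_restrict_iff' measurableSet_Ioi] at h2
    filter_upwards [h2] with x hx hxm
    exact hx (uIcc_subset_Ioi ha hb (Set.uIoc_subset_uIcc hxm))
  refine ⟨fun a b ha hb => ?_, fun a b ha hb => ?_⟩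
  · refine (hF.intervalIntegrable a b ha hb).congr_ae ?_
    rw [EventuallyEq, ae_restrict_iff' measurableSet_uIoc]
    exact h3 a b ha hb
  · rw [← h1 a ha, ← h1 b hb, ← hF.integral_eq a b ha hb]
    refine intervalIntegral.integral_congr_ae ?_
    filter_upwards [h3 a b ha hb] with x hx hm
    exact (hx hm).symm

theorem add (hF : IsPrimitive F f) (hG : IsPrimitive G g) :
    IsPrimitive (fun x => F x + G x) (fun x => f x + g x) :=
  ⟨fun a b ha hb => (hF.intervalIntegrable a b ha hb).add (hG.intervalIntegrable a b ha hb),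
    fun a b ha hb => by
      rw [intervalIntegral.integral_add (hF.intervalIntegrable a b ha hb)
        (hG.intervalIntegrable a b ha hb), hF.integral_eq a b ha hb, hG.integral_eq a b ha hb]
      ring⟩

theorem const_mul (c : ℂ) (hF : IsPrimitive F f) :
    IsPrimitive (fun x => c * F x) (fun x => c * f x) :=
  ⟨fun a b ha hb => (hF.intervalIntegrable a b ha hb).const_mul c,
    fun a b ha hb => by
      rw [intervalIntegral.integral_const_mul, hF.integral_eq a b ha hb]
      ring⟩

theorem sub (hF : IsPrimitive F f) (hG : IsPrimitive G g) :
    IsPrimitive (fun x => F x - G x) (fun x => f x - g x) :=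
  ((hF.add (hG.const_mul (-1))).congr (fun x _ => by ring) (ae_of_all _ fun x => by ring))

theorem conj (hF : IsPrimitive F f) :
    IsPrimitive (fun x => (starRingEnd ℂ) (F x)) (fun x => (starRingEnd ℂ) (f x)) := by
  refine ⟨fun a b ha hb => ?_, fun a b ha hb => ?_⟩
  · rw [intervalIntegrable_iff]
    have h := intervalIntegrable_iff.1 (hF.intervalIntegrable a b ha hb)
    exact (Complex.conjLIE.toContinuousLinearEquiv.toContinuousLinearMap).integrable_comp h
  · have h := (Complex.conjLIE.toContinuousLinearEquiv.toContinuousLinearMap).intervalIntegral_comp_comm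
      (hF.intervalIntegrable a b ha hb)
    rw [← map_sub, ← hF.integral_eq a b ha hb]
    exact h

theorem re_intervalIntegrable (hF : IsPrimitive F f) {a b : ℝ} (ha : 0 < a) (hb : 0 < b) :
    IntervalIntegrable (fun x => (f x).re) volume a b := by
  rw [intervalIntegrable_iff]
  exact Complex.reCLM.integrable_comp (intervalIntegrable_iff.1 (hF.intervalIntegrable a b ha hb))

theorem im_intervalIntegrable (hF : IsPrimitive F f) {a b : ℝ} (ha : 0 < a) (hb : 0 < b) :
    IntervalIntegrable (fun x => (f x).im) volume a b := by
  rw [intervalIntegrable_iff]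
  exact Complex.imCLM.integrable_comp (intervalIntegrable_iff.1 (hF.intervalIntegrable a b ha hb))

theorem re_integral (hF : IsPrimitive F f) {a b : ℝ} (ha : 0 < a) (hb : 0 < b) :
    ∫ x in a..b, (f x).re = (F b).re - (F a).re := by
  have h := Complex.reCLM.intervalIntegral_comp_comm (hF.intervalIntegrable a b ha hb)
  rw [hF.integral_eq a b ha hb] at h
  simpa using h

theorem im_integral (hF : IsPrimitive F f) {a b : ℝ} (ha : 0 < a) (hb : 0 < b) :
    ∫ x in a..b, (f x).im = (F b).im - (F a).im := by
  have h := Complex.imCLM.intervalIntegral_comp_comm (hF.intervalIntegrable a b ha hb)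
  rw [hF.integral_eq a b ha hb] at h
  simpa using h

theorem mul (hF : IsPrimitive F f) (hG : IsPrimitive G g) :
    IsPrimitive (fun x => F x * G x) (fun x => f x * G x + F x * g x) := by
  have hint : ∀ a b, 0 < a → 0 < b →
      IntervalIntegrable (fun x => f x * G x + F x * g x) volume a b := fun a b ha hb =>
    ((hF.intervalIntegrable a b ha hb).mul_continuousOn
      (hG.continuousOn.mono (uIcc_subset_Ioi ha hb))).add
    ((hG.intervalIntegrable a b ha hb).continuousOn_mul
      (hF.continuousOn.mono (uIcc_subset_Ioi ha hb)))
  refine ⟨hint, fun a b ha hb => ?_⟩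
  have cF := hF.continuousOn.mono (uIcc_subset_Ioi ha hb)
  have cG := hG.continuousOn.mono (uIcc_subset_Ioi ha hb)
  have cFr := Complex.continuous_re.comp_continuousOn cF
  have cFi := Complex.continuous_im.comp_continuousOn cF
  have cGr := Complex.continuous_re.comp_continuousOn cG
  have cGi := Complex.continuous_im.comp_continuousOn cG
  have fr := hF.re_intervalIntegrable ha hb
  have fi := hF.im_intervalIntegrable ha hb
  have gr := hG.re_intervalIntegrable ha hb
  have gi := hG.im_intervalIntegrable ha hb
  have pos : ∀ x ∈ Set.uIcc a b, 0 < x := fun x hx => uIcc_subset_Ioi ha hb hx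
  have Fr : ∀ x ∈ Set.uIcc a b, (F x).re = (F a).re + ∫ t in a..x, (f t).re := fun x hx => by
    rw [hF.re_integral ha (pos x hx)]; ring
  have Fi : ∀ x ∈ Set.uIcc a b, (F x).im = (F a).im + ∫ t in a..x, (f t).im := fun x hx => by
    rw [hF.im_integral ha (pos x hx)]; ring
  have Gr : ∀ x ∈ Set.uIcc a b, (G x).re = (G a).re + ∫ t in a..x, (g t).re := fun x hx => by
    rw [hG.re_integral ha (pos x hx)]; ring
  have Gi : ∀ x ∈ Set.uIcc a b, (G x).im = (G a).im + ∫ t in a..x, (g t).im := fun x hx => by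
    rw [hG.im_integral ha (pos x hx)]; ring
  -- The complex product rule is assembled from four real ones: `rr - ii` is the real part and `ri +
  -- ir` the imaginary part.
  have rr := integral_mul_of_primitive_real fr gr Fr Gr
  have ri := integral_mul_of_primitive_real fr gi Fr Gi
  have ir := integral_mul_of_primitive_real fi gr Fi Gr
  have ii := integral_mul_of_primitive_real fi gi Fi Gi
  have hI := hint a b ha hb
  have i_rr := (fr.mul_continuousOn cGr).add (gr.continuousOn_mul cFr)
  have i_ri := (fr.mul_continuousOn cGi).add (gi.continuousOn_mul cFr)
  have i_ir := (fi.mul_continuousOn cGr).add (gr.continuousOn_mul cFi)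
  have i_ii := (fi.mul_continuousOn cGi).add (gi.continuousOn_mul cFi)
  apply Complex.ext
  · have h := Complex.reCLM.intervalIntegral_comp_comm hI
    have h2 := intervalIntegral.integral_sub i_rr i_ii
    simp only [Function.comp_apply] at h2
    rw [rr, ii] at h2
    rw [Complex.reCLM_apply] at h
    rw [← h]
    simp only [Complex.reCLM_apply, Complex.add_re, Complex.mul_re, Complex.sub_re]
    calc _ = _ := intervalIntegral.integral_congr fun x _ => by ring
      _ = _ := h2
      _ = _ := by ring
  · have h := Complex.imCLM.intervalIntegral_comp_comm hI
    have h2 := intervalIntegral.integral_add i_ri i_ir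
    simp only [Function.comp_apply] at h2
    rw [ri, ir] at h2
    rw [Complex.imCLM_apply] at h
    rw [← h]
    simp only [Complex.imCLM_apply, Complex.add_im, Complex.mul_im, Complex.sub_im]
    calc _ = _ := intervalIntegral.integral_congr fun x _ => by ring
      _ = _ := h2
      _ = _ := by ring

theorem of_hasDerivAt (h : ∀ x, 0 < x → HasDerivAt F (f x) x) (hf : ContinuousOn f (Set.Ioi 0)) :
    IsPrimitive F f := by
  have hi : ∀ a b, 0 < a → 0 < b → IntervalIntegrable f volume a b := fun a b ha hb =>
    (hf.mono (uIcc_subset_Ioi ha hb)).intervalIntegrable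
  exact ⟨hi, fun a b ha hb => intervalIntegral.integral_eq_sub_of_hasDerivAt
    (fun x hx => h x (uIcc_subset_Ioi ha hb hx)) (hi a b ha hb)⟩

/-- A primitive that vanishes near `0` and near `∞`, with density vanishing there as well. -/
theorem integral_Ioi_eq_zero (hF : IsPrimitive F f) {a b : ℝ} (ha : 0 < a) (hab : a ≤ b)
    (hFa : F a = 0) (hFb : F b = 0) (hf : ∀ x, x ∉ Set.Ioc a b → f x = 0) :
    ∫ x in Set.Ioi 0, f x = 0 := by
  have h := hF.integral_eq a b ha (ha.trans_le hab)
  rw [hFa, hFb, sub_zero, intervalIntegral.integral_of_le hab] at h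
  rw [← h]
  refine setIntegral_eq_of_subset_of_forall_sdiff_eq_zero measurableSet_Ioi
    (fun x hx => ha.trans hx.1) (fun x hx => hf x hx.2)

/-- The integral is split at 1, and each half is a limit of integrals over compact intervals.
Green's formula needs this because neither end of (0, ∞) carries a value of the primitive, only a
limit. -/
theorem integral_Ioi (hF : IsPrimitive F f) (hf : IntegrableOn f (Set.Ioi 0)) {l m : ℂ}
    (h0 : Tendsto F (𝓝[>] 0) (𝓝 l)) (hi : Tendsto F atTop (𝓝 m)) :
    ∫ x in Set.Ioi 0, f x = m - l := by
  have e1 : Tendsto (fun b : ℝ => ∫ x in (1 : ℝ)..b, f x) atTop (𝓝 (∫ x in Set.Ioi 1, f x)) :=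
    intervalIntegral_tendsto_integral_Ioi 1 (hf.mono_set (Set.Ioi_subset_Ioi zero_le_one)) tendsto_id
  have e2 : Tendsto (fun b : ℝ => ∫ x in (1 : ℝ)..b, f x) atTop (𝓝 (m - F 1)) := by
    refine (hi.sub_const (F 1)).congr' ?_
    filter_upwards [eventually_gt_atTop 0] with b hb
    exact (hF.integral_eq 1 b one_pos hb).symm
  have h1 := tendsto_nhds_unique e1 e2
  have hf01 : IntegrableOn f (Set.Ioc 0 1) := hf.mono_set Set.Ioc_subset_Ioi_self
  have hI01 : IntervalIntegrable f volume 0 1 :=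
    (intervalIntegrable_iff_integrableOn_Ioc_of_le zero_le_one).2 hf01
  have e3 : Tendsto (fun a : ℝ => ∫ x in (1 : ℝ)..a, f x) (𝓝[>] 0) (𝓝 (∫ x in (1 : ℝ)..0, f x)) := by
    have hc := intervalIntegral.continuousOn_primitive_interval' hI01
      (a := (1 : ℝ)) Set.right_mem_uIcc
    have := hc 0 Set.left_mem_uIcc
    refine this.mono_left ?_
    rw [Set.uIcc_of_le zero_le_one]
    rw [← nhdsWithin_Ioo_eq_nhdsGT (zero_lt_one' ℝ)]
    exact nhdsWithin_mono _ Set.Ioo_subset_Icc_self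
  have e4 : Tendsto (fun a : ℝ => ∫ x in (1 : ℝ)..a, f x) (𝓝[>] 0) (𝓝 (l - F 1)) := by
    refine (h0.sub_const (F 1)).congr' ?_
    filter_upwards [self_mem_nhdsWithin] with b hb
    exact (hF.integral_eq 1 b one_pos hb).symm
  have h2 := tendsto_nhds_unique e3 e4
  rw [intervalIntegral.integral_symm, intervalIntegral.integral_of_le zero_le_one] at h2
  rw [← Set.Ioc_union_Ioi_eq_Ioi (zero_le_one' ℝ),
    setIntegral_union Set.Ioc_disjoint_Ioi_same measurableSet_Ioi hf01
      (hf.mono_set (Set.Ioi_subset_Ioi zero_le_one)), h1]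
  linear_combination -h2

end IsPrimitive

/-! ### Real powers of `|x|` with complex values -/

/-- The function `|x|^m`, complex valued. -/
def absPow (m : ℝ) (x : ℝ) : ℂ := ((|x| ^ m : ℝ) : ℂ)

theorem absPow_mul {x : ℝ} (hx : 0 < x) (m n : ℝ) :
    absPow m x * absPow n x = absPow (m + n) x := by
  simp only [absPow, abs_of_pos hx, ← Complex.ofReal_mul, ← Real.rpow_add hx]

theorem absPow_zero {x : ℝ} : absPow 0 x = 1 := by
  simp [absPow]

theorem norm_absPow {x : ℝ} (hx : 0 < x) (m : ℝ) : ‖absPow m x‖ = x ^ m := by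
  rw [absPow, abs_of_pos hx, Complex.norm_real, Real.norm_of_nonneg (Real.rpow_nonneg hx.le m)]

theorem hasDerivAt_absPow {x : ℝ} (hx : 0 < x) (m : ℝ) :
    HasDerivAt (absPow m) (m * absPow (m - 1) x) x := by
  have h := (Real.hasDerivAt_rpow_const (x := x) (p := m) (Or.inl hx.ne')).ofReal_comp
  have h2 : HasDerivAt (absPow m) (((m * x ^ (m - 1) : ℝ)) : ℂ) x := by
    refine h.congr_of_eventuallyEq ?_
    filter_upwards [Ioi_mem_nhds hx] with y hy
    simp [absPow, abs_of_pos (show (0 : ℝ) < y from hy)]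
  convert h2 using 1
  simp [absPow, abs_of_pos hx]

theorem contDiffAt_absPow {x : ℝ} (hx : 0 < x) (m : ℝ) : ContDiffAt ℝ ∞ (absPow m) x := by
  have h : ContDiffAt ℝ ∞ (fun y : ℝ => ((y ^ m : ℝ) : ℂ)) x :=
    Complex.ofRealCLM.contDiff.contDiffAt.comp x
      (Real.contDiffAt_rpow_const_of_ne (p := m) hx.ne')
  refine h.congr_of_eventuallyEq ?_
  filter_upwards [Ioi_mem_nhds hx] with y hy
  simp [absPow, abs_of_pos (show (0 : ℝ) < y from hy)]

theorem continuousOn_absPow (m : ℝ) : ContinuousOn (absPow m) (Set.Ioi 0) := fun _ hx =>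
  (contDiffAt_absPow hx m).continuousAt.continuousWithinAt

theorem measurable_absPow (m : ℝ) : Measurable (absPow m) := by
  unfold absPow; fun_prop

/-! ### Test functions on the positive half-line -/

theorem IsTest.deriv {s : Side} {f : ℝ → ℂ} (hf : IsTest s f) : IsTest s (deriv f) :=
  ⟨(contDiff_infty_iff_deriv.1 hf.1).2, hf.2.1.deriv,
    (tsupport_deriv_subset (f := f)).trans hf.2.2⟩

theorem IsTest.hasDerivAt {s : Side} {f : ℝ → ℂ} (hf : IsTest s f) (x : ℝ) :
    HasDerivAt f (_root_.deriv f x) x := (hf.differentiable x).hasDerivAt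

theorem IsTest.continuous {s : Side} {f : ℝ → ℂ} (hf : IsTest s f) : Continuous f :=
  hf.1.continuous

theorem IsTest.isPrimitive {s : Side} {f : ℝ → ℂ} (hf : IsTest s f) :
    IsPrimitive f (_root_.deriv f) :=
  .of_hasDerivAt (fun x _ => hf.hasDerivAt x) hf.deriv.continuous.continuousOn

theorem exists_Ioo_of_isCompact {K : Set ℝ} (hK : IsCompact K) (h : K ⊆ Set.Ioi 0) :
    ∃ a b, 0 < a ∧ a < b ∧ K ⊆ Set.Ioo a b := by
  rcases K.eq_empty_or_nonempty with rfl | hne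
  · exact ⟨1, 2, by norm_num, by norm_num, Set.empty_subset _⟩
  · obtain ⟨m, hm, hm'⟩ := hK.exists_isLeast hne
    obtain ⟨M, hM, hM'⟩ := hK.exists_isGreatest hne
    have h0 : (0 : ℝ) < m := h hm
    have h1 : m ≤ M := hm' hM
    exact ⟨m / 2, M + 1, by linarith, by linarith, fun x hx => ⟨by linarith [hm' hx], by
      linarith [hM' hx]⟩⟩

theorem IsTest.exists_Ioo {f : ℝ → ℂ} (hf : IsTest .plus f) :
    ∃ a b, 0 < a ∧ a < b ∧ tsupport f ⊆ Set.Ioo a b :=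
  exists_Ioo_of_isCompact hf.2.1 hf.2.2

theorem eq_zero_of_tsupport_subset {f : ℝ → ℂ} {S : Set ℝ} (h : tsupport f ⊆ S) {x : ℝ}
    (hx : x ∉ S) : f x = 0 := image_eq_zero_of_notMem_tsupport fun hm => hx (h hm)

theorem deriv_eq_zero_of_tsupport_subset {f : ℝ → ℂ} {S : Set ℝ} (h : tsupport f ⊆ S) {x : ℝ}
    (hx : x ∉ S) : deriv f x = 0 :=
  eq_zero_of_tsupport_subset ((tsupport_deriv_subset (f := f)).trans h) hx

theorem deriv_deriv_eq_zero_of_tsupport_subset {f : ℝ → ℂ} {S : Set ℝ} (h : tsupport f ⊆ S)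
    {x : ℝ} (hx : x ∉ S) : deriv (deriv f) x = 0 :=
  deriv_eq_zero_of_tsupport_subset ((tsupport_deriv_subset (f := f)).trans h) hx

theorem isTest_of_Icc {f : ℝ → ℂ} {a b : ℝ} (ha : 0 < a) (hf : ∀ x, 0 < x → ContDiffAt ℝ ∞ f x)
    (h0 : ∀ x, x ∉ Set.Icc a b → f x = 0) : IsTest .plus f := by
  have hs : tsupport f ⊆ Set.Icc a b :=
    closure_minimal (fun x hx => by_contra fun h => hx (h0 x h)) isClosed_Icc
  refine ⟨contMDiff_iff_contDiff.1 <| contMDiff_of_tsupport fun x hx => (hf x (ha.trans_le (hs hx).1)).contMDiffAt,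
    HasCompactSupport.of_support_subset_isCompact isCompact_Icc (subset_closure.trans hs),
    hs.trans fun x hx => ha.trans_le hx.1⟩

theorem IsTest.mul_left {f w : ℝ → ℂ} (hf : IsTest .plus f)
    (hw : ∀ x, 0 < x → ContDiffAt ℝ ∞ w x) : IsTest .plus (fun x => w x * f x) := by
  obtain ⟨a, b, ha, -, hs⟩ := hf.exists_Ioo
  refine isTest_of_Icc (a := a) (b := b) ha (fun x hx => (hw x hx).mul hf.1.contDiffAt)
    fun x hx => ?_
  rw [eq_zero_of_tsupport_subset hs fun h => hx (Set.Ioo_subset_Icc_self h), mul_zero]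

theorem integrableOn_mul_of_support {δ f : ℝ → ℂ} {a b : ℝ} (ha : 0 < a) (hab : a ≤ b)
    (hδ : IntervalIntegrable δ volume a b) (hf : ContinuousOn f (Set.Ioi 0))
    (h0 : ∀ x, x ∉ Set.Ioc a b → f x = 0) : IntegrableOn (fun x => δ x * f x) (Set.Ioi 0) := by
  have h1 := hδ.mul_continuousOn (hf.mono (uIcc_subset_Ioi ha (ha.trans_le hab)))
  rw [intervalIntegrable_iff_integrableOn_Ioc_of_le hab] at h1
  exact h1.of_forall_sdiff_eq_zero measurableSet_Ioi fun x hx => by rw [h0 x hx.2, mul_zero]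

theorem deriv_deriv_eq {F F' F'' : ℝ → ℂ} (h1 : ∀ x, 0 < x → HasDerivAt F (F' x) x)
    (h2 : ∀ x, 0 < x → HasDerivAt F' (F'' x) x) {x : ℝ} (hx : 0 < x) :
    deriv (deriv F) x = F'' x := by
  have e : deriv F =ᶠ[𝓝 x] F' := by
    filter_upwards [Ioi_mem_nhds hx] with y hy
    exact (h1 y hy).deriv
  rw [e.deriv_eq]
  exact (h2 x hx).deriv

/-! ### Homogeneous solutions and smooth cut-offs -/

/-- `|x|^{-α/2}`. -/
abbrev sol₀ (α : ℝ) : ℝ → ℂ := absPow (-(α / 2))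

/-- `|x|^{1+α/2}`. -/
abbrev sol₁ (α : ℝ) : ℝ → ℂ := absPow (1 + α / 2)

/-- A smooth function equal to `0` for `t x ≤ 1` and to `1` for `t x ≥ 2`. -/
def cutoff (t x : ℝ) : ℂ := (Real.smoothTransition (t * x - 1) : ℝ)

theorem contDiff_cutoff (t : ℝ) : ContDiff ℝ ∞ (cutoff t) := by
  have h : ContDiff ℝ ∞ (fun x : ℝ => Real.smoothTransition (t * x - 1)) :=
    Real.smoothTransition.contDiff.comp (by fun_prop)
  exact Complex.ofRealCLM.contDiff.comp h

theorem cutoff_eq_zero {t x : ℝ} (h : t * x ≤ 1) : cutoff t x = 0 := by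
  simp [cutoff, Real.smoothTransition.zero_of_nonpos (show t * x - 1 ≤ 0 by linarith)]

theorem cutoff_eq_one {t x : ℝ} (h : 2 ≤ t * x) : cutoff t x = 1 := by
  simp [cutoff, Real.smoothTransition.one_of_one_le (show 1 ≤ t * x - 1 by linarith)]

theorem norm_cutoff_le_one (t x : ℝ) : ‖cutoff t x‖ ≤ 1 := by
  rw [cutoff, Complex.norm_real, Real.norm_of_nonneg (Real.smoothTransition.nonneg _)]
  exact Real.smoothTransition.le_one _

/-- The two exponents add up to 1, so all powers of x cancel in the Wronskian. Its value 1 + α ≠ 0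
is the divisor in variation of parameters and the factor of the boundary form. -/
theorem wronskian_sol (α : ℝ) {x : ℝ} (hx : 0 < x) :
    sol₀ α x * ((1 + α / 2 : ℝ) * absPow (1 + α / 2 - 1) x) -
      ((-(α / 2) : ℝ) * absPow (-(α / 2) - 1) x) * sol₁ α x = 1 + α := by
  have e1 : sol₀ α x * absPow (1 + α / 2 - 1) x = 1 := by
    rw [absPow_mul hx, show -(α / 2) + (1 + α / 2 - 1) = 0 by ring, absPow_zero]
  have e2 : absPow (-(α / 2) - 1) x * sol₁ α x = 1 := by
    rw [absPow_mul hx, show -(α / 2) - 1 + (1 + α / 2) = 0 by ring, absPow_zero]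
  push_cast
  linear_combination (1 + α / 2 : ℂ) * e1 + (α / 2 : ℂ) * e2

/-- The coefficient of the inverse-square potential. -/
theorem sol_deriv_deriv (α : ℝ) {x : ℝ} (hx : 0 < x) (m : ℝ) (hm : m * (m - 1) = α * (2 + α) / 4) :
    (m : ℂ) * ((m - 1 : ℝ) * absPow (m - 1 - 1) x) = (potential α 0 x : ℝ) * absPow m x := by
  have e : absPow m x = absPow (m - 1 - 1) x * absPow 2 x := by
    rw [absPow_mul hx]; congr 1; ring
  have e2 : absPow 2 x = ((x ^ 2 : ℝ) : ℂ) := by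
    simp [absPow, abs_of_pos hx]
  have e3 : (potential α 0 x : ℝ) * x ^ 2 = m * (m - 1) := by
    rw [hm]; simp only [potential]; field_simp; simp
  rw [e, e2]
  have e4 : ((potential α 0 x : ℝ) : ℂ) * ((x ^ 2 : ℝ) : ℂ) = m * ((m - 1 : ℝ) : ℂ) := by
    exact_mod_cast e3
  linear_combination -(absPow (m - 1 - 1) x) * e4

/-! ### A du Bois-Reymond lemma for the inverse-square operator -/

theorem hasDerivAt_integral_test {s : Side} {ψ : ℝ → ℂ} (hψ : IsTest s ψ) (x : ℝ) :
    HasDerivAt (fun y => ∫ t in (0 : ℝ)..y, ψ t) (ψ x) x :=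
  intervalIntegral.integral_hasDerivAt_right (hψ.continuous.intervalIntegrable _ _)
    (hψ.continuous.stronglyMeasurableAtFilter _ _) hψ.continuous.continuousAt

/-- `(∫ ψ) η - ∫₀ ψ` is a test function, for a smooth step `η`. -/
theorem isTest_cutoff_sub_integral {ψ : ℝ → ℂ} (hψ : IsTest .plus ψ) :
    IsTest .plus (fun x => (∫ t in Set.Ioi 0, ψ t) * cutoff 1 x - ∫ t in (0 : ℝ)..x, ψ t) := by
  obtain ⟨a, b, ha, hab, hs⟩ := hψ.exists_Ioo
  have hd : ContDiff ℝ ∞ (fun y => ∫ t in (0 : ℝ)..y, ψ t) := by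
    rw [contDiff_infty_iff_deriv]
    refine ⟨fun x => (hasDerivAt_integral_test hψ x).differentiableAt, ?_⟩
    rw [show deriv (fun y => ∫ t in (0 : ℝ)..y, ψ t) = ψ from
      funext fun x => (hasDerivAt_integral_test hψ x).deriv]
    exact hψ.1
  refine isTest_of_Icc (a := min a 1) (b := max b 2) (lt_min ha one_pos)
    (fun x _ => ((contDiff_const.mul (contDiff_cutoff 1)).sub hd).contDiffAt) fun x hx => ?_
  rw [Set.mem_Icc, not_and_or, not_le, not_le] at hx
  rcases hx with hx | hx
  · have h1 : x < a := hx.trans_le (min_le_left _ _)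
    have h2 : x < 1 := hx.trans_le (min_le_right _ _)
    rw [cutoff_eq_zero (by linarith), mul_zero, zero_sub, neg_eq_zero]
    rw [intervalIntegral.integral_congr (g := fun _ => 0), intervalIntegral.integral_zero]
    intro t ht
    refine eq_zero_of_tsupport_subset hs fun hm => ?_
    have := ht.2.trans (max_le ha.le h1.le)
    exact absurd hm.1 (not_lt.2 this)
  · have h1 : b < x := (le_max_left _ _).trans_lt hx
    have h2 : 2 < x := (le_max_right _ _).trans_lt hx
    rw [cutoff_eq_one (by linarith), mul_one, sub_eq_zero,
      intervalIntegral.integral_of_le (by linarith)]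
    refine setIntegral_eq_of_subset_of_forall_sdiff_eq_zero measurableSet_Ioi
      Set.Ioc_subset_Ioi_self fun t ht => eq_zero_of_tsupport_subset hs fun hm => ht.2 ⟨ht.1, ?_⟩
    linarith [hm.2]

theorem diffExpr_eq {α : ℝ} {k : ℤ} {F F' F'' : ℝ → ℂ} (h1 : ∀ x, 0 < x → HasDerivAt F (F' x) x)
    (h2 : ∀ x, 0 < x → HasDerivAt F' (F'' x) x) {x : ℝ} (hx : 0 < x) :
    diffExpr α k F x = -(F'' x) + (potential α k x : ℂ) * F x := by
  rw [diffExpr, deriv_deriv_eq h1 h2 hx]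

theorem hasDerivAt_sol_mul {m : ℝ} {B B' : ℝ → ℂ} (h : ∀ x, HasDerivAt B (B' x) x) {x : ℝ}
    (hx : 0 < x) : HasDerivAt (fun y => absPow m y * B y)
      (m * absPow (m - 1) x * B x + absPow m x * B' x) x :=
  (hasDerivAt_absPow hx m).mul (h x)

/-- Reduction of order: since |x|^m solves the homogeneous equation, no undifferentiated B remains.
-/
theorem diffExpr_zero_sol_mul (α : ℝ) {m : ℝ} (hm : m * (m - 1) = α * (2 + α) / 4)
    {B B' B'' : ℝ → ℂ} (h : ∀ x, HasDerivAt B (B' x) x) (h' : ∀ x, HasDerivAt B' (B'' x) x)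
    {x : ℝ} (hx : 0 < x) : diffExpr α 0 (fun y => absPow m y * B y) x =
      -(2 * (m * absPow (m - 1) x) * B' x + absPow m x * B'' x) := by
  rw [diffExpr_eq (fun y hy => hasDerivAt_sol_mul h hy)
    (F'' := fun x => m * ((m - 1 : ℝ) * absPow (m - 1 - 1) x) * B x +
      2 * (m * absPow (m - 1) x) * B' x + absPow m x * B'' x) ?_ hx]
  · rw [sol_deriv_deriv α hx m hm]; ring
  · intro y hy
    have e1 := (((hasDerivAt_absPow hy (m - 1)).const_mul (m : ℂ)).mul (h y)).add
      ((hasDerivAt_absPow hy m).mul (h' y))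
    refine e1.congr_deriv ?_
    ring

theorem contDiff.hasDerivAt_deriv {f : ℝ → ℂ} (hf : ContDiff ℝ ∞ f) (x : ℝ) :
    HasDerivAt f (deriv f x) x ∧ HasDerivAt (deriv f) (deriv (deriv f) x) x :=
  ⟨(hf.differentiable (by simp) x).hasDerivAt,
    (((contDiff_infty_iff_deriv.1 hf).2).differentiable (by simp) x).hasDerivAt⟩

/-- This and the next identity say that both exponents satisfy the indicial equation. -/
theorem exponent_sol₀ (α : ℝ) : -(α / 2) * (-(α / 2) - 1) = α * (2 + α) / 4 := by ring

theorem exponent_sol₁ (α : ℝ) : (1 + α / 2) * (1 + α / 2 - 1) = α * (2 + α) / 4 := by ring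

/-- The commutator term `2 w' η' + w η''` for `w = |x|^m` and the step `η = cutoff 1`. -/
def cutoffComm (m x : ℝ) : ℂ :=
  2 * (m * absPow (m - 1) x) * deriv (cutoff 1) x + absPow m x * deriv (deriv (cutoff 1)) x

theorem deriv_cutoff_one_eq_zero {x : ℝ} (hx : x ∉ Set.Icc (1 : ℝ) 2) :
    deriv (cutoff 1) x = 0 ∧ deriv (deriv (cutoff 1)) x = 0 := by
  have key : ∃ c : ℂ, cutoff 1 =ᶠ[𝓝 x] fun _ => c := by
    rw [Set.mem_Icc, not_and_or, not_le, not_le] at hx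
    rcases hx with hx | hx
    · exact ⟨0, by filter_upwards [Iio_mem_nhds hx] with y hy using
        cutoff_eq_zero (by linarith [show y < 1 from hy])⟩
    · exact ⟨1, by filter_upwards [Ioi_mem_nhds hx] with y hy using
        cutoff_eq_one (by linarith [show 2 < y from hy])⟩
  obtain ⟨c, hc⟩ := key
  constructor
  · rw [hc.deriv_eq]; simp
  · rw [hc.deriv.deriv_eq]; simp

theorem integrableOn_mul_cutoffComm {δ : ℝ → ℂ}
    (hδ : ∀ a b, 0 < a → 0 < b → IntervalIntegrable δ volume a b) (m : ℝ) :
    IntegrableOn (fun x => δ x * cutoffComm m x) (Set.Ioi 0) := by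
  have hη := contDiff_cutoff 1
  have c1 : Continuous (deriv (cutoff 1)) := (contDiff_infty_iff_deriv.1 hη).2.continuous
  have c2 : Continuous (deriv (deriv (cutoff 1))) :=
    (contDiff_infty_iff_deriv.1 (contDiff_infty_iff_deriv.1 hη).2).2.continuous
  refine integrableOn_mul_of_support (a := 1 / 2) (b := 2) (by norm_num) (by norm_num)
    (hδ _ _ (by norm_num) (by norm_num)) ?_ fun x hx => ?_
  · exact ((continuousOn_const.mul (continuousOn_const.mul (continuousOn_absPow _))).mul
      c1.continuousOn).add ((continuousOn_absPow _).mul c2.continuousOn)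
  · have := deriv_cutoff_one_eq_zero (x := x) fun h => hx ⟨by linarith [h.1], h.2⟩
    simp [cutoffComm, this.1, this.2]

theorem IsTest.diffExpr_continuousOn {f : ℝ → ℂ} (hf : IsTest .plus f) (α : ℝ) (k : ℤ) :
    ContinuousOn (diffExpr α k f) (Set.Ioi 0) := by
  refine hf.deriv.deriv.continuous.neg.continuousOn.add (ContinuousOn.mul ?_
    hf.continuous.continuousOn)
  refine Complex.continuous_ofReal.comp_continuousOn ?_
  unfold potential
  refine ContinuousOn.add (continuousOn_const.mul ?_) (continuousOn_const.div (by fun_prop) ?_)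
  · exact continuous_abs.continuousOn.rpow_const fun x hx => Or.inl (abs_pos.2 (ne_of_gt hx)).ne'
  · intro x hx
    have : (0 : ℝ) < x := hx
    positivity

theorem diffExpr_eq_zero_of_tsupport_subset {f : ℝ → ℂ} {S : Set ℝ} (h : tsupport f ⊆ S) {x : ℝ}
    (hx : x ∉ S) (α : ℝ) (k : ℤ) : diffExpr α k f x = 0 := by
  rw [diffExpr, deriv_deriv_eq_zero_of_tsupport_subset h hx, eq_zero_of_tsupport_subset h hx]
  simp

theorem IsTest.integrableOn_mul {f w δ : ℝ → ℂ} (hf : IsTest .plus f)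
    (hδ : ∀ a b, 0 < a → 0 < b → IntervalIntegrable δ volume a b)
    (hw : ContinuousOn w (Set.Ioi 0)) (h0 : ∀ x, x ∉ tsupport f → w x = 0) :
    IntegrableOn (fun x => δ x * w x) (Set.Ioi 0) := by
  obtain ⟨a, b, ha, hab, hs⟩ := hf.exists_Ioo
  exact integrableOn_mul_of_support ha hab.le (hδ a b ha (ha.trans hab)) hw
    fun x hx => h0 x fun h => hx (Set.Ioo_subset_Ioc_self (hs h))

/-- A locally integrable distributional solution of the homogeneous equation is classical. -/
theorem ae_eq_sol_of_integral_eq_zero {α : ℝ} (hα : 0 ≤ α) {δ : ℝ → ℂ}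
    (hδ : ∀ a b, 0 < a → 0 < b → IntervalIntegrable δ volume a b)
    (h : ∀ f, IsTest .plus f → ∫ x in Set.Ioi 0, δ x * diffExpr α 0 f x = 0) :
    ∃ C₀ C₁ : ℂ, ∀ᵐ x ∂(volume.restrict (Set.Ioi (0 : ℝ))),
      δ x = C₀ * sol₀ α x + C₁ * sol₁ α x := by
  have hα1 : (1 + α : ℂ) ≠ 0 := by
    have : (1 + α : ℝ) ≠ 0 := by positivity
    exact_mod_cast this
  set I : ℝ → ℂ := fun m => ∫ x in Set.Ioi 0, δ x * cutoffComm m x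
  -- The values are forced by the identity `E` below: it expresses (1 + α) ∫ δ ψ as m₀ I(1 + α/2) -
  -- m₁ I(-α/2), where m₀ and m₁ are the moments of ψ against w₀ and w₁.
  set C₀ : ℂ := I (1 + α / 2) / (1 + α)
  set C₁ : ℂ := -I (-(α / 2)) / (1 + α)
  refine ⟨C₀, C₁, ?_⟩
  have hsol : ∀ m a b : ℝ, 0 < a → 0 < b → IntervalIntegrable (absPow m) volume a b :=
    fun m a b ha hb => ((continuousOn_absPow m).mono (uIcc_subset_Ioi ha hb)).intervalIntegrable
  have hγ : ∀ a b, 0 < a → 0 < b →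
      IntervalIntegrable (fun x => δ x - (C₀ * sol₀ α x + C₁ * sol₁ α x)) volume a b :=
    fun a b ha hb => (hδ a b ha hb).sub
      (((hsol _ a b ha hb).const_mul _).add ((hsol _ a b ha hb).const_mul _))
  have key : ∀ ψ, IsTest .plus ψ →
      ∫ x in Set.Ioi 0, (δ x - (C₀ * sol₀ α x + C₁ * sol₁ α x)) * ψ x = 0 := by
    intro ψ hψ
    have hη := contDiff_cutoff 1
    have h0 : IsTest .plus (fun x => sol₀ α x * ψ x) :=
      hψ.mul_left fun x hx => contDiffAt_absPow hx _
    have h1 : IsTest .plus (fun x => sol₁ α x * ψ x) :=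
      hψ.mul_left fun x hx => contDiffAt_absPow hx _
    set m₀ : ℂ := ∫ x in Set.Ioi 0, sol₀ α x * ψ x
    set m₁ : ℂ := ∫ x in Set.Ioi 0, sol₁ α x * ψ x
    have hB : ∀ m : ℝ, ∀ x : ℝ, HasDerivAt (fun x => (∫ t in Set.Ioi 0, absPow m t * ψ t) * cutoff 1 x -
        ∫ t in (0 : ℝ)..x, absPow m t * ψ t)
        ((∫ t in Set.Ioi 0, absPow m t * ψ t) * deriv (cutoff 1) x - absPow m x * ψ x) x := by
      intro m x
      exact ((contDiff.hasDerivAt_deriv hη x).1.const_mul _).sub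
        (hasDerivAt_integral_test (hψ.mul_left fun x hx => contDiffAt_absPow hx m) x)
    have hB' : ∀ m : ℝ, ∀ x : ℝ, HasDerivAt (fun x =>
        ((∫ t in Set.Ioi 0, absPow m t * ψ t) * deriv (cutoff 1) x - absPow m x * ψ x))
        ((∫ t in Set.Ioi 0, absPow m t * ψ t) * deriv (deriv (cutoff 1)) x -
          deriv (fun y => absPow m y * ψ y) x) x := by
      intro m x
      exact ((contDiff.hasDerivAt_deriv hη x).2.const_mul _).sub
        ((hψ.mul_left fun x hx => contDiffAt_absPow hx m).hasDerivAt x)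
    -- Take `t0` = w₀ (m₁ η - ∫₀ w₁ ψ) and `t1` = w₁ (m₀ η - ∫₀ w₀ ψ) with the smooth step η. In
    -- S(t1) - S(t0) the terms with ψ' cancel and those with ψ add up to the Wronskian, so the
    -- difference is (1 + α) ψ plus commutators of η weighted by the moments of ψ. The step η makes
    -- both functions compactly supported for every ψ.
    have t0 := (isTest_cutoff_sub_integral h1).mul_left (w := sol₀ α)
      fun x hx => contDiffAt_absPow hx _
    have t1 := (isTest_cutoff_sub_integral h0).mul_left (w := sol₁ α)
      fun x hx => contDiffAt_absPow hx _
    have e0 := h _ t0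
    have e1 := h _ t1
    have hdψ : ∀ m x, 0 < x → deriv (fun y => absPow m y * ψ y) x =
        m * absPow (m - 1) x * ψ x + absPow m x * deriv ψ x := fun m x hx =>
      (hasDerivAt_sol_mul (fun y => hψ.hasDerivAt y) hx).deriv
    have i0 := t0.integrableOn_mul hδ (t0.diffExpr_continuousOn α 0)
      fun x hx => diffExpr_eq_zero_of_tsupport_subset subset_rfl hx α 0
    have i1 := t1.integrableOn_mul hδ (t1.diffExpr_continuousOn α 0)
      fun x hx => diffExpr_eq_zero_of_tsupport_subset subset_rfl hx α 0
    have iψ := hψ.integrableOn_mul hδ hψ.continuous.continuousOn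
      fun x hx => image_eq_zero_of_notMem_tsupport hx
    have j0 := integrableOn_mul_cutoffComm hδ (-(α / 2))
    have j1 := integrableOn_mul_cutoffComm hδ (1 + α / 2)
    have s0 : IntegrableOn (fun x => sol₀ α x * ψ x) (Set.Ioi 0) :=
      (h0.continuous.integrable_of_hasCompactSupport h0.2.1).integrableOn
    have s1 : IntegrableOn (fun x => sol₁ α x * ψ x) (Set.Ioi 0) :=
      (h1.continuous.integrable_of_hasCompactSupport h1.2.1).integrableOn
    have E : ∫ x in Set.Ioi 0, ((1 + α) * (δ x * ψ x) - m₀ * (δ x * cutoffComm (1 + α / 2) x) +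
        m₁ * (δ x * cutoffComm (-(α / 2)) x)) = 0 := by
      rw [← sub_eq_zero.2 (e1.trans e0.symm), ← integral_sub i1 i0]
      refine setIntegral_congr_fun measurableSet_Ioi fun x hx => ?_
      have hx0 : (0 : ℝ) < x := hx
      rw [diffExpr_zero_sol_mul α (exponent_sol₀ α) (hB (1 + α / 2)) (hB' (1 + α / 2)) hx0,
        diffExpr_zero_sol_mul α (exponent_sol₁ α) (hB (-(α / 2))) (hB' (-(α / 2))) hx0,
        hdψ _ x hx0, hdψ _ x hx0]
      have W := wronskian_sol α hx0
      simp only [cutoffComm]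
      linear_combination -(δ x * ψ x) * W
    rw [integral_add (f := fun x => (1 + (α : ℂ)) * (δ x * ψ x) -
      m₀ * (δ x * cutoffComm (1 + α / 2) x)) ((iψ.const_mul _).sub (j1.const_mul _)) (j0.const_mul _),
      integral_sub (iψ.const_mul _) (j1.const_mul _), integral_const_mul, integral_const_mul,
      integral_const_mul] at E
    have split : ∫ x in Set.Ioi 0, (δ x - (C₀ * sol₀ α x + C₁ * sol₁ α x)) * ψ x =
        (∫ x in Set.Ioi 0, δ x * ψ x) - (C₀ * m₀ + C₁ * m₁) := by
      rw [← integral_const_mul, ← integral_const_mul,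
        ← integral_add (s0.const_mul _) (s1.const_mul _),
        ← integral_sub (g := fun x => C₀ * (sol₀ α x * ψ x) + C₁ * (sol₁ α x * ψ x)) iψ
          ((s0.const_mul _).add (s1.const_mul _))]
      refine integral_congr_ae (ae_of_all _ fun x => ?_)
      ring
    rw [split]
    have : (1 + α : ℂ) * ((∫ x in Set.Ioi 0, δ x * ψ x) - (C₀ * m₀ + C₁ * m₁)) = 0 := by
      have a0 : (1 + α : ℂ) * C₀ = I (1 + α / 2) := mul_div_cancel₀ _ hα1
      have a1 : (1 + α : ℂ) * C₁ = -I (-(α / 2)) := mul_div_cancel₀ _ hα1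
      linear_combination E - m₀ * a0 - m₁ * a1
    exact (mul_eq_zero.1 this).resolve_left hα1
  -- By `key` the difference annihilates every test function, so it vanishes almost everywhere.
  have hloc : LocallyIntegrableOn (fun x => δ x - (C₀ * sol₀ α x + C₁ * sol₁ α x))
      (Set.Ioi 0) volume := by
    rw [locallyIntegrableOn_iff isOpen_Ioi.isLocallyClosed]
    intro K hK hKc
    obtain ⟨a, b, ha, hab, hs⟩ := exists_Ioo_of_isCompact hKc hK
    have := hγ a b ha (ha.trans hab)
    rw [intervalIntegrable_iff_integrableOn_Ioc_of_le hab.le] at this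
    exact this.mono_set (hs.trans Set.Ioo_subset_Ioc_self)
  have hz := isOpen_Ioi.ae_eq_zero_of_integral_contDiff_smul_eq_zero hloc fun g hg hgc hgs => by
    have ht : IsTest .plus (fun x => (g x : ℂ)) := by
      refine ⟨Complex.ofRealCLM.contDiff.comp hg,
        hgc.comp_left (g := fun r : ℝ => (r : ℂ)) Complex.ofReal_zero, ?_⟩
      refine (closure_mono fun x hx => ?_).trans hgs
      intro h0
      exact hx (by simp [h0])
    rw [← key _ ht, ← setIntegral_eq_integral_of_forall_compl_eq_zero (s := Set.Ioi (0 : ℝ))]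
    · refine integral_congr_ae (ae_of_all _ fun x => ?_)
      simp only [Complex.real_smul]
      ring
    · intro x hx
      rw [image_eq_zero_of_notMem_tsupport fun h => hx (hgs h), zero_smul]
  rw [ae_restrict_iff' measurableSet_Ioi]
  filter_upwards [hz] with x hx hm
  exact sub_eq_zero.1 (hx hm)

/-! ### Distributional solutions: representation and asymptotics at the origin -/

theorem integrableOn_rpow_Ioc {m x : ℝ} (hm : -1 < m) (hx : 0 < x) :
    IntegrableOn (fun t : ℝ => t ^ m) (Set.Ioc 0 x) :=
  (intervalIntegrable_iff_integrableOn_Ioc_of_le hx.le).1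
    (intervalIntegral.intervalIntegrable_rpow' hm)

/-- This is where the limit-circle condition enters: the exponent -α/2 exceeds -1/2 exactly when α <
1. -/
theorem memLp_absPow {m x : ℝ} (hm : -(1 / 2) < m) (hx : 0 < x) :
    MemLp (absPow m) 2 (volume.restrict (Set.Ioc 0 x)) := by
  rw [memLp_two_iff_integrable_sq_norm (measurable_absPow m).aestronglyMeasurable]
  refine (integrableOn_rpow_Ioc (m := 2 * m) (by linarith) hx).congr ?_
  filter_upwards [ae_restrict_mem measurableSet_Ioc] with t ht
  rw [norm_absPow ht.1, ← Real.rpow_natCast, ← Real.rpow_mul ht.1.le, mul_comm]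
  norm_num

theorem intervalIntegrable_absPow_mul {m x : ℝ} (hm : -(1 / 2) < m) (hx : 0 < x) {r : ℝ → ℂ}
    (hr : MemLp r 2 (volume.restrict (Set.Ioc 0 x))) :
    IntervalIntegrable (fun t => absPow m t * r t) volume 0 x :=
  (intervalIntegrable_iff_integrableOn_Ioc_of_le hx.le).2 ((memLp_absPow hm hx).integrable_mul hr)

/-- Cauchy–Schwarz on (0, x], with ∫₀ˣ t^{2m} dt = x^{2m+1}/(2m + 1). -/
theorem norm_integral_absPow_mul_le {m x : ℝ} (hm : -(1 / 2) < m) (hx : 0 < x) {r : ℝ → ℂ}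
    (hr : MemLp r 2 (volume.restrict (Set.Ioc 0 x))) :
    ‖∫ t in (0 : ℝ)..x, absPow m t * r t‖ ≤
      (1 / (2 * m + 1)) ^ (1 / 2 : ℝ) * x ^ (m + 1 / 2) *
        (∫ t in (0 : ℝ)..x, ‖r t‖ ^ 2) ^ (1 / 2 : ℝ) := by
  have h2m : 0 < 2 * m + 1 := by linarith
  have h1 := integral_mul_norm_le_Lp_mul_Lq (μ := volume.restrict (Set.Ioc 0 x))
    Real.HolderConjugate.two_two (f := absPow m) (g := r)
    (by rw [ENNReal.ofReal_ofNat]; exact memLp_absPow hm hx) (by rwa [ENNReal.ofReal_ofNat])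
  have h2 : ∫ t in Set.Ioc 0 x, ‖absPow m t‖ ^ (2 : ℝ) = 1 / (2 * m + 1) * x ^ (2 * m + 1) := by
    rw [setIntegral_congr_fun measurableSet_Ioc (g := fun t : ℝ => t ^ (2 * m)),
      ← intervalIntegral.integral_of_le hx.le, integral_rpow (Or.inl (by linarith)),
      Real.zero_rpow h2m.ne']
    · ring
    · intro t ht
      simp only
      rw [norm_absPow ht.1, ← Real.rpow_mul ht.1.le, mul_comm]
  have h3 : (1 / (2 * m + 1) * x ^ (2 * m + 1)) ^ (1 / 2 : ℝ) =
      (1 / (2 * m + 1)) ^ (1 / 2 : ℝ) * x ^ (m + 1 / 2) := by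
    rw [Real.mul_rpow (by positivity) (by positivity), ← Real.rpow_mul hx.le]
    congr 2; ring
  rw [h2, h3] at h1
  rw [intervalIntegral.integral_of_le hx.le, intervalIntegral.integral_of_le hx.le]
  refine (norm_integral_le_integral_norm _).trans ?_
  simp only [norm_mul]
  simpa only [Real.rpow_two] using h1

/-- The L² norm of r over (0, x] tends to 0 with x, which improves the Cauchy–Schwarz bound from O
to o. The error o(|x|^{3/2}) of the theorem originates here. -/
theorem isLittleO_integral_absPow_mul {m : ℝ} (hm : -(1 / 2) < m) {r : ℝ → ℂ}
    (hr : MemLp r 2 (volume.restrict (Set.Ioc 0 1))) :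
    (fun x : ℝ => ∫ t in (0 : ℝ)..x, absPow m t * r t) =o[𝓝[>] 0] fun x : ℝ => x ^ (m + 1 / 2) := by
  have hi : IntervalIntegrable (fun t => ‖r t‖ ^ 2) volume 0 1 :=
    (intervalIntegrable_iff_integrableOn_Ioc_of_le zero_le_one).2 hr.integrable_norm_pow'
  have hE : Tendsto (fun x : ℝ => (∫ t in (0 : ℝ)..x, ‖r t‖ ^ 2) ^ (1 / 2 : ℝ)) (𝓝[>] 0) (𝓝 0) := by
    have hc := intervalIntegral.continuousOn_primitive_interval' hi
      (a := (0 : ℝ)) Set.left_mem_uIcc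
    have h1 := hc 0 Set.left_mem_uIcc
    rw [ContinuousWithinAt, intervalIntegral.integral_same] at h1
    have h2 : Tendsto (fun x : ℝ => ∫ t in (0 : ℝ)..x, ‖r t‖ ^ 2) (𝓝[>] 0) (𝓝 0) := by
      refine h1.mono_left ?_
      rw [Set.uIcc_of_le zero_le_one, ← nhdsWithin_Ioo_eq_nhdsGT (zero_lt_one' ℝ)]
      exact nhdsWithin_mono _ Set.Ioo_subset_Icc_self
    have h3 := h2.rpow_const (p := (1 / 2 : ℝ)) (Or.inr (by norm_num))
    rwa [Real.zero_rpow (by norm_num)] at h3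
  have hO : (fun x : ℝ => ∫ t in (0 : ℝ)..x, absPow m t * r t) =O[𝓝[>] 0]
      fun x : ℝ => x ^ (m + 1 / 2) * (∫ t in (0 : ℝ)..x, ‖r t‖ ^ 2) ^ (1 / 2 : ℝ) := by
    refine IsBigO.of_bound ((1 / (2 * m + 1)) ^ (1 / 2 : ℝ)) ?_
    filter_upwards [Ioo_mem_nhdsGT (zero_lt_one' ℝ)] with x hx
    refine (norm_integral_absPow_mul_le hm hx.1
      (hr.mono_measure (Measure.restrict_mono (Set.Ioc_subset_Ioc_right hx.2.le) le_rfl))).trans ?_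
    rw [mul_assoc]
    refine mul_le_mul_of_nonneg_left (Real.le_norm_self _) ?_
    have : 0 < 2 * m + 1 := by linarith
    positivity
  refine hO.trans_isLittleO ?_
  have h4 := (isLittleO_one_iff ℝ).2 hE
  simpa using (isBigO_refl (fun x : ℝ => x ^ (m + 1 / 2)) (𝓝[>] 0)).mul_isLittleO h4

theorem isBigO_absPow (m : ℝ) : absPow m =O[𝓝[>] 0] fun x : ℝ => x ^ m := by
  refine IsBigO.of_bound 1 ?_
  filter_upwards [self_mem_nhdsWithin] with x hx
  rw [norm_absPow hx, one_mul]
  exact Real.le_norm_self _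

theorem IsLittleO.absPow_mul {F : ℝ → ℂ} {n : ℝ} (hF : F =o[𝓝[>] 0] fun x : ℝ => x ^ n) (m : ℝ)
    {l : ℝ} (hl : m + n = l) : (fun x => absPow m x * F x) =o[𝓝[>] 0] fun x : ℝ => x ^ l := by
  refine ((isBigO_absPow m).mul_isLittleO hF).congr' EventuallyEq.rfl ?_
  filter_upwards [self_mem_nhdsWithin] with x hx
  rw [← Real.rpow_add hx, hl]

theorem isPrimitive_integral {r : ℝ → ℂ}
    (hr : ∀ x : ℝ, 0 < x → IntervalIntegrable r volume 0 x) :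
    IsPrimitive (fun x => ∫ t in (0 : ℝ)..x, r t) r :=
  ⟨fun a b ha hb => (hr a ha).symm.trans (hr b hb), fun a b ha hb => by
    rw [← intervalIntegral.integral_interval_sub_left (hr b hb) (hr a ha)]⟩

theorem isPrimitive_absPow (m : ℝ) :
    IsPrimitive (absPow m) (fun x => m * absPow (m - 1) x) :=
  .of_hasDerivAt (fun _ hx => hasDerivAt_absPow hx m)
    (continuousOn_const.mul (continuousOn_absPow _))

theorem isPrimitive_absPow' {α m : ℝ} (hm : m * (m - 1) = α * (2 + α) / 4) :
    IsPrimitive (fun x => m * absPow (m - 1) x)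
      (fun x => (potential α 0 x : ℝ) * absPow m x) := by
  refine ((isPrimitive_absPow (m - 1)).const_mul (m : ℂ)).congr (fun x _ => rfl) ?_
  filter_upwards [ae_restrict_mem measurableSet_Ioi] with x hx
  exact sol_deriv_deriv α hx m hm

/-- Variation of parameters from the origin for the inverse-square operator. -/
theorem exists_particular_solution {α : ℝ} (hα₀ : 0 ≤ α) (hα₁ : α < 1) {r : ℝ → ℂ}
    (hr : ∀ x : ℝ, 0 < x → MemLp r 2 (volume.restrict (Set.Ioc 0 x))) :
    ∃ p p' : ℝ → ℂ, IsPrimitive p p' ∧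
      IsPrimitive p' (fun x => (potential α 0 x : ℝ) * p x + r x) ∧
      p =o[𝓝[>] 0] (fun x : ℝ => x ^ (3 / 2 : ℝ)) ∧
      p' =o[𝓝[>] 0] (fun x : ℝ => x ^ (1 / 2 : ℝ)) := by
  have hα1 : (1 + α : ℂ) ≠ 0 := by
    have : (1 + α : ℝ) ≠ 0 := by positivity
    exact_mod_cast this
  have hm0 : -(1 / 2) < -(α / 2) := by linarith
  have hm1 : -(1 / 2) < 1 + α / 2 := by linarith
  set κ : ℂ := (1 + α : ℂ)⁻¹ with hκ
  set a : ℝ → ℂ := fun x => ∫ t in (0 : ℝ)..x, sol₀ α t * r t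
  set b : ℝ → ℂ := fun x => ∫ t in (0 : ℝ)..x, sol₁ α t * r t
  have ha : IsPrimitive a (fun x => sol₀ α x * r x) :=
    isPrimitive_integral fun x hx => intervalIntegrable_absPow_mul hm0 hx (hr x hx)
  have hb : IsPrimitive b (fun x => sol₁ α x * r x) :=
    isPrimitive_integral fun x hx => intervalIntegrable_absPow_mul hm1 hx (hr x hx)
  have oa : a =o[𝓝[>] 0] fun x : ℝ => x ^ (-(α / 2) + 1 / 2) :=
    isLittleO_integral_absPow_mul hm0 (hr 1 one_pos)
  have ob : b =o[𝓝[>] 0] fun x : ℝ => x ^ (1 + α / 2 + 1 / 2) :=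
    isLittleO_integral_absPow_mul hm1 (hr 1 one_pos)
  -- The solution is p = (w₁ a - w₀ b)/(1 + α), with a = ∫₀ w₀ r and b = ∫₀ w₁ r. In p' the two
  -- terms containing r cancel; in p'' they give r times the normalised Wronskian. Both products in
  -- p have order (1 + α/2) + (1/2 - α/2) = -α/2 + (3/2 + α/2) = 3/2.
  refine ⟨fun x => κ * (sol₁ α x * a x - sol₀ α x * b x),
    fun x => κ * ((1 + α / 2 : ℝ) * absPow (1 + α / 2 - 1) x * a x -
      (-(α / 2) : ℝ) * absPow (-(α / 2) - 1) x * b x), ?_, ?_, ?_, ?_⟩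
  · refine ((((isPrimitive_absPow (1 + α / 2)).mul ha).sub
      ((isPrimitive_absPow (-(α / 2))).mul hb)).const_mul κ).congr (fun x _ => rfl)
      (ae_of_all _ fun x => ?_)
    ring
  · refine ((((isPrimitive_absPow' (exponent_sol₁ α)).mul ha).sub
      ((isPrimitive_absPow' (exponent_sol₀ α)).mul hb)).const_mul κ).congr (fun x _ => rfl) ?_
    filter_upwards [ae_restrict_mem measurableSet_Ioi] with x hx
    have W := wronskian_sol α hx
    have hk : κ * (1 + α) = 1 := inv_mul_cancel₀ hα1
    linear_combination (κ * r x) * W + r x * hk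
  · exact ((IsLittleO.absPow_mul oa _ (by ring)).sub
      (IsLittleO.absPow_mul ob _ (by ring))).const_mul_left κ
  · have e1 := (IsLittleO.absPow_mul oa (1 + α / 2 - 1) (l := 1 / 2) (by ring)).const_mul_left
      ((1 + α / 2 : ℝ) : ℂ)
    have e2 := (IsLittleO.absPow_mul ob (-(α / 2) - 1) (l := 1 / 2) (by ring)).const_mul_left
      ((-(α / 2) : ℝ) : ℂ)
    simp only [← mul_assoc] at e1 e2
    exact (e1.sub e2).const_mul_left κ

/-- Integration by parts twice against a test function. -/
theorem IsPrimitive.integral_test_eq_zero {p p' q f : ℝ → ℂ} (hp : IsPrimitive p p')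
    (hp' : IsPrimitive p' q) (hf : IsTest .plus f) :
    ∫ x in Set.Ioi 0, (q x * f x - p x * deriv (deriv f) x) = 0 := by
  obtain ⟨a, b, ha, hab, hs⟩ := hf.exists_Ioo
  have h := (hp'.mul hf.isPrimitive).sub (hp.mul hf.deriv.isPrimitive)
  have h2 := h.congr (g := fun x => q x * f x - p x * deriv (deriv f) x) (fun x _ => rfl)
    (ae_of_all _ fun x => by ring)
  have hz : ∀ x, x ∉ Set.Ioo a b → f x = 0 ∧ deriv f x = 0 ∧ deriv (deriv f) x = 0 :=
    fun x hx => ⟨eq_zero_of_tsupport_subset hs hx, deriv_eq_zero_of_tsupport_subset hs hx,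
      deriv_deriv_eq_zero_of_tsupport_subset hs hx⟩
  refine h2.integral_Ioi_eq_zero ha hab.le ?_ ?_ fun x hx => ?_
  · have := hz a (by simp)
    rw [this.1, this.2.1]; ring
  · have := hz b (by simp)
    rw [this.1, this.2.1]; ring
  · have := hz x fun h => hx (Set.Ioo_subset_Ioc_self h)
    rw [this.1, this.2.2]; ring

/-- Square-integrable functions `g`, `h` with `S_{α,k} g = h` weakly on `(0, ∞)`. -/
structure WeakPair (α : ℝ) (k : ℤ) (g h : ℝ → ℂ) : Prop where
  memLp : MemLp g 2 (volume.restrict (Set.Ioi 0))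
  memLp' : MemLp h 2 (volume.restrict (Set.Ioi 0))
  integral_eq : ∀ f, IsTest .plus f →
    ∫ x in Set.Ioi 0, h x * f x = ∫ x in Set.Ioi 0, g x * diffExpr α k f x

/-- `G` is a continuously differentiable representative of a weak solution of `S_{α,k} g = h`, with
derivative `G'` and with coefficients `C₀`, `C₁` at the origin. -/
structure IsRegularRep (α : ℝ) (k : ℤ) (g h G G' : ℝ → ℂ) (C₀ C₁ : ℂ) : Prop where
  ae_eq : g =ᵐ[volume.restrict (Set.Ioi 0)] G
  primitive : IsPrimitive G G'
  primitive' : IsPrimitive G' (fun x => (potential α k x : ℝ) * G x - h x)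
  asymptotics : (fun x => G x - (C₀ * sol₀ α x + C₁ * sol₁ α x)) =o[𝓝[>] 0]
    fun x : ℝ => x ^ (3 / 2 : ℝ)
  asymptotics' : (fun x => G' x - (C₀ * ((-(α / 2) : ℝ) * absPow (-(α / 2) - 1) x) +
    C₁ * ((1 + α / 2 : ℝ) * absPow (1 + α / 2 - 1) x))) =o[𝓝[>] 0] fun x : ℝ => x ^ (1 / 2 : ℝ)

theorem potential_eq_add (α : ℝ) (k : ℤ) (x : ℝ) :
    potential α k x = k ^ 2 * |x| ^ (2 * α) + potential α 0 x := by
  simp [potential]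

theorem diffExpr_eq_add (α : ℝ) (k : ℤ) (f : ℝ → ℂ) (x : ℝ) :
    diffExpr α k f x = diffExpr α 0 f x + k ^ 2 * absPow (2 * α) x * f x := by
  simp only [diffExpr, potential_eq_add α k, absPow]
  push_cast
  ring

theorem norm_absPow_le_of_Ioc {m x b : ℝ} (hm : 0 ≤ m) (hx : x ∈ Set.Ioc 0 b) :
    ‖absPow m x‖ ≤ b ^ m := by
  rw [norm_absPow hx.1]
  exact Real.rpow_le_rpow hx.1.le hx.2 hm

theorem memLp_absPow_mul {g : ℝ → ℂ} {m b : ℝ} (hm : 0 ≤ m)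
    (hg : MemLp g 2 (volume.restrict (Set.Ioc 0 b))) :
    MemLp (fun x => absPow m x * g x) 2 (volume.restrict (Set.Ioc 0 b)) := by
  refine hg.of_le_mul (c := b ^ m)
    ((measurable_absPow m).aestronglyMeasurable.mul hg.aestronglyMeasurable) ?_
  filter_upwards [ae_restrict_mem measurableSet_Ioc] with x hx
  rw [norm_mul]
  exact mul_le_mul_of_nonneg_right (norm_absPow_le_of_Ioc hm hx) (norm_nonneg _)

theorem MemLp.intervalIntegrable_of_Ioi {g : ℝ → ℂ}
    (hg : MemLp g 2 (volume.restrict (Set.Ioi 0))) (a b : ℝ) (ha : 0 < a) (hb : 0 < b) :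
    IntervalIntegrable g volume a b := by
  rw [intervalIntegrable_iff]
  have h : MemLp g 2 (volume.restrict (Set.uIoc a b)) := hg.mono_measure
    (Measure.restrict_mono (Set.uIoc_subset_uIcc.trans (uIcc_subset_Ioi ha hb)) le_rfl)
  have : IsFiniteMeasure (volume.restrict (Set.uIoc a b)) := by
    rw [Set.uIoc]; infer_instance
  exact h.integrable (by norm_num)

/-- Since 2α ≥ 0, the term k²|x|^{2α} g is square integrable near 0 and can join h on the right-hand
side. What is left is the inverse-square equation: subtracting a particular solution gives a
distributional solution of the homogeneous equation, hence a combination of w₀ and w₁. -/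
theorem WeakPair.exists_isRegularRep {α : ℝ} (hα₀ : 0 ≤ α) (hα₁ : α < 1) {k : ℤ} {g h : ℝ → ℂ}
    (H : WeakPair α k g h) : ∃ (G G' : ℝ → ℂ) (C₀ C₁ : ℂ), IsRegularRep α k g h G G' C₀ C₁ := by
  set r : ℝ → ℂ := fun x => k ^ 2 * (absPow (2 * α) x * g x) - h x with hrdef
  have hmono : ∀ {u : ℝ → ℂ} (x : ℝ), MemLp u 2 (volume.restrict (Set.Ioi 0)) →
      MemLp u 2 (volume.restrict (Set.Ioc 0 x)) := fun x hu =>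
    hu.mono_measure (Measure.restrict_mono Set.Ioc_subset_Ioi_self le_rfl)
  have hr : ∀ x : ℝ, 0 < x → MemLp r 2 (volume.restrict (Set.Ioc 0 x)) := fun x hx =>
    ((memLp_absPow_mul (by linarith) (hmono x H.memLp)).const_mul _).sub (hmono x H.memLp')
  obtain ⟨p, p', hp, hp', op, op'⟩ := exists_particular_solution hα₀ hα₁ hr
  have ig := MemLp.intervalIntegrable_of_Ioi H.memLp
  have ih := MemLp.intervalIntegrable_of_Ioi H.memLp'
  have ip : ∀ a b, 0 < a → 0 < b → IntervalIntegrable p volume a b := fun a b ha hb =>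
    (hp.continuousOn.mono (uIcc_subset_Ioi ha hb)).intervalIntegrable
  have ir : ∀ a b, 0 < a → 0 < b → IntervalIntegrable r volume a b := fun a b ha hb =>
    (((ig a b ha hb).continuousOn_mul
      ((continuousOn_absPow _).mono (uIcc_subset_Ioi ha hb))).const_mul _).sub (ih a b ha hb)
  obtain ⟨C₀, C₁, hC⟩ := ae_eq_sol_of_integral_eq_zero hα₀ (δ := fun x => g x - p x)
    (fun a b ha hb => (ig a b ha hb).sub (ip a b ha hb)) fun f hf => by
      have z : ∀ x, x ∉ tsupport f → f x = 0 := fun x hx => image_eq_zero_of_notMem_tsupport hx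
      have zD : ∀ k x, x ∉ tsupport f → diffExpr α k f x = 0 :=
        fun k x hx => diffExpr_eq_zero_of_tsupport_subset subset_rfl hx α k
      have Ig0 := hf.integrableOn_mul ig (hf.diffExpr_continuousOn α 0) (zD 0)
      have Ig := hf.integrableOn_mul ig (hf.diffExpr_continuousOn α k) (zD k)
      have Ip0 := hf.integrableOn_mul ip (hf.diffExpr_continuousOn α 0) (zD 0)
      have Ih := hf.integrableOn_mul ih hf.continuous.continuousOn z
      have Ir := hf.integrableOn_mul ir hf.continuous.continuousOn z
      have E1 : ∫ x in Set.Ioi 0, g x * diffExpr α 0 f x = -∫ x in Set.Ioi 0, r x * f x := by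
        rw [eq_neg_iff_add_eq_zero, ← integral_add Ig0 Ir,
          ← sub_eq_zero.2 (H.integral_eq f hf).symm, ← integral_sub Ig Ih]
        refine integral_congr_ae (ae_of_all _ fun x => ?_)
        simp only [hrdef, diffExpr_eq_add α k]
        ring
      have E2 : ∫ x in Set.Ioi 0, p x * diffExpr α 0 f x = -∫ x in Set.Ioi 0, r x * f x := by
        rw [eq_neg_iff_add_eq_zero, ← integral_add Ip0 Ir, ← hp.integral_test_eq_zero hp' hf]
        refine integral_congr_ae (ae_of_all _ fun x => ?_)
        simp only [diffExpr]
        ring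
      rw [← sub_eq_zero.2 (E1.trans E2.symm), ← integral_sub Ig0 Ip0]
      refine integral_congr_ae (ae_of_all _ fun x => ?_)
      ring
  set G : ℝ → ℂ := fun x => C₀ * sol₀ α x + C₁ * sol₁ α x + p x with hG
  have hgG : g =ᵐ[volume.restrict (Set.Ioi 0)] G := by
    filter_upwards [hC] with x hx
    rw [hG]
    linear_combination hx
  refine ⟨G, fun x => C₀ * ((-(α / 2) : ℝ) * absPow (-(α / 2) - 1) x) +
    C₁ * ((1 + α / 2 : ℝ) * absPow (1 + α / 2 - 1) x) + p' x, C₀, C₁, hgG, ?_, ?_, ?_, ?_⟩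
  · exact (((isPrimitive_absPow _).const_mul C₀).add ((isPrimitive_absPow _).const_mul C₁)).add hp
  · refine ((((isPrimitive_absPow' (exponent_sol₀ α)).const_mul C₀).add
      ((isPrimitive_absPow' (exponent_sol₁ α)).const_mul C₁)).add hp').congr (fun x _ => rfl) ?_
    filter_upwards [hgG] with x hx
    simp only [hrdef, hx, potential_eq_add α k, hG, absPow]
    push_cast
    ring
  · refine op.congr (fun x => ?_) fun x => rfl
    simp only [hG]; ring
  · refine op'.congr (fun x => ?_) fun x => rfl
    ring

/-! ### Uniqueness of the asymptotic coefficients -/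

theorem isBigO_rpow_rpow {a b : ℝ} (h : b ≤ a) :
    (fun x : ℝ => x ^ a) =O[𝓝[>] 0] fun x : ℝ => x ^ b := by
  refine IsBigO.of_bound 1 ?_
  filter_upwards [Ioo_mem_nhdsGT (zero_lt_one' ℝ)] with x hx
  rw [Real.norm_of_nonneg (Real.rpow_nonneg hx.1.le _),
    Real.norm_of_nonneg (Real.rpow_nonneg hx.1.le _), one_mul]
  exact Real.rpow_le_rpow_of_exponent_ge hx.1 hx.2.le h

theorem tendsto_zero_of_isLittleO_rpow {F : ℝ → ℂ} {n : ℝ} (hn : 0 ≤ n)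
    (hF : F =o[𝓝[>] 0] fun x : ℝ => x ^ n) : Tendsto F (𝓝[>] 0) (𝓝 0) := by
  have h := hF.trans_isBigO (isBigO_rpow_rpow hn)
  simp only [Real.rpow_zero] at h
  exact (isLittleO_one_iff ℝ).1 h

theorem tendsto_absPow_zero {m : ℝ} (hm : 0 < m) : Tendsto (absPow m) (𝓝[>] 0) (𝓝 0) := by
  refine tendsto_zero_of_isLittleO_rpow le_rfl ?_
  refine (isBigO_absPow m).trans_isLittleO ?_
  have h1 : (fun x : ℝ => x ^ (0 : ℝ)) = fun _ => (1 : ℝ) := by ext; simp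
  rw [h1, isLittleO_one_iff]
  have h := (Real.continuousAt_rpow_const 0 m (Or.inr hm.le)).tendsto
  rw [Real.zero_rpow hm.ne'] at h
  exact h.mono_left nhdsWithin_le_nhds

/-- The limits of `|x|^{α/2} G` and of `|x|^{-(1+α/2)} (G - C₀ |x|^{-α/2})`. -/
theorem tendsto_of_asymptotics {α : ℝ} (hα₀ : 0 ≤ α) (hα₁ : α < 1) {G : ℝ → ℂ} {C₀ C₁ : ℂ}
    (h : (fun x => G x - (C₀ * sol₀ α x + C₁ * sol₁ α x)) =o[𝓝[>] 0]
      fun x : ℝ => x ^ (3 / 2 : ℝ)) :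
    Tendsto (fun x => absPow (α / 2) x * G x) (𝓝[>] 0) (𝓝 C₀) ∧
      Tendsto (fun x => absPow (-(1 + α / 2)) x * (G x - C₀ * sol₀ α x)) (𝓝[>] 0) (𝓝 C₁) := by
  constructor
  · have h1 := tendsto_zero_of_isLittleO_rpow (by linarith)
      (IsLittleO.absPow_mul h (α / 2) rfl)
    have h2 := (tendsto_absPow_zero (m := 1 + α) (by linarith)).const_mul C₁
    have h3 := (h1.add h2).add_const C₀
    rw [mul_zero, add_zero, zero_add] at h3
    refine h3.congr' ?_
    filter_upwards [self_mem_nhdsWithin] with x hx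
    have e1 : absPow (α / 2) x * sol₀ α x = 1 := by
      rw [absPow_mul hx, add_neg_cancel, absPow_zero]
    have e2 : absPow (α / 2) x * sol₁ α x = absPow (1 + α) x := by
      rw [absPow_mul hx]; congr 1; ring
    linear_combination -C₀ * e1 - C₁ * e2
  -- The remaining exponent is 3/2 - (1 + α/2) = (1 - α)/2, which is non-negative.
  · have h1 := tendsto_zero_of_isLittleO_rpow (by linarith)
      (IsLittleO.absPow_mul h (-(1 + α / 2)) rfl)
    have h3 := h1.add_const C₁
    rw [zero_add] at h3
    refine h3.congr' ?_
    filter_upwards [self_mem_nhdsWithin] with x hx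
    have e2 : absPow (-(1 + α / 2)) x * sol₁ α x = 1 := by
      rw [absPow_mul hx, neg_add_cancel, absPow_zero]
    linear_combination -C₁ * e2

theorem coeff_unique {α : ℝ} (hα₀ : 0 ≤ α) (hα₁ : α < 1) {G : ℝ → ℂ} {C₀ C₁ D₀ D₁ : ℂ}
    (h : (fun x => G x - (C₀ * sol₀ α x + C₁ * sol₁ α x)) =o[𝓝[>] 0]
      fun x : ℝ => x ^ (3 / 2 : ℝ))
    (h' : (fun x => G x - (D₀ * sol₀ α x + D₁ * sol₁ α x)) =o[𝓝[>] 0]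
      fun x : ℝ => x ^ (3 / 2 : ℝ)) : C₀ = D₀ ∧ C₁ = D₁ := by
  have a := tendsto_of_asymptotics hα₀ hα₁ h
  have b := tendsto_of_asymptotics hα₀ hα₁ h'
  have e := tendsto_nhds_unique a.1 b.1
  subst e
  exact ⟨rfl, tendsto_nhds_unique a.2 b.2⟩

/-! ### Green's formula -/

theorem potential_nonneg {α : ℝ} (hα₀ : 0 ≤ α) (k : ℤ) (x : ℝ) : 0 ≤ potential α k x := by
  unfold potential
  positivity

theorem not_integrableOn_Ioi_of_le {f : ℝ → ℝ} {R : ℝ} (h : ∀ x, R ≤ x → 1 ≤ f x) :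
    ¬IntegrableOn f (Set.Ioi R) := by
  intro hf
  have h1 : IntegrableOn (fun _ : ℝ => (1 : ℝ)) (Set.Ioi R) := by
    refine Integrable.mono' hf aestronglyMeasurable_const ?_
    filter_upwards [ae_restrict_mem measurableSet_Ioi] with x hx
    simpa using h x (le_of_lt hx)
  rw [integrableOn_const_iff] at h1
  simp at h1

/-- The derivative of a weak solution is square integrable at infinity. -/
theorem IsRegularRep.memLp_deriv {α : ℝ} (hα₀ : 0 ≤ α) {k : ℤ} {g h G G' : ℝ → ℂ} {C₀ C₁ : ℂ}
    (H : WeakPair α k g h) (R : IsRegularRep α k g h G G' C₀ C₁) :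
    MemLp G' 2 (volume.restrict (Set.Ioi 1)) := by
  have hGL : MemLp G 2 (volume.restrict (Set.Ioi 0)) := H.memLp.ae_eq R.ae_eq
  have hq := (R.primitive'.mul R.primitive.conj)
  have hN := (R.primitive.mul R.primitive.conj)
  have cG' := R.primitive'.continuousOn
  have hsub : Set.Ioi (1 : ℝ) ⊆ Set.Ioi 0 := Set.Ioi_subset_Ioi zero_le_one
  have meas : AEStronglyMeasurable G' (volume.restrict (Set.Ioi 1)) :=
    (cG'.mono hsub).aestronglyMeasurable measurableSet_Ioi
  have ihG : IntegrableOn (fun x => ‖h x‖ * ‖G x‖) (Set.Ioi 0) :=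
    H.memLp'.norm.integrable_mul hGL.norm
  set K : ℝ := ∫ x in Set.Ioi 0, ‖h x‖ * ‖G x‖
  set q : ℝ → ℂ := fun x => G' x * (starRingEnd ℂ) (G x)
  have isq : ∀ a b, 0 < a → 0 < b → IntervalIntegrable (fun x => ‖G' x‖ ^ 2) volume a b :=
    fun a b ha hb => ((cG'.mono (uIcc_subset_Ioi ha hb)).norm.pow 2).intervalIntegrable
  set F : ℝ → ℝ := fun b => ∫ x in (1 : ℝ)..b, ‖G' x‖ ^ 2
  -- The real part of (G' conj G)' is |G'|² + V|G|² - Re(h conj G). As V ≥ 0, it is at least |G'|² -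
  -- |h||G|, and |h||G| is integrable with total mass `K`.
  have hF : ∀ b, 1 ≤ b → F b ≤ (q b).re + (K - (q 1).re) := by
    intro b hb
    have hb0 : 0 < b := one_pos.trans_le hb
    have e := hq.re_integral one_pos hb0
    have iK : IntervalIntegrable (fun x => ‖h x‖ * ‖G x‖) volume 1 b :=
      (intervalIntegrable_iff_integrableOn_Ioc_of_le hb).2
        (ihG.mono_set fun x hx => one_pos.trans hx.1)
    have hK : ∫ x in (1 : ℝ)..b, ‖h x‖ * ‖G x‖ ≤ K := by
      rw [intervalIntegral.integral_of_le hb]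
      exact setIntegral_mono_set ihG (ae_of_all _ fun x => by positivity)
        (Eventually.of_forall fun x hx => one_pos.trans hx.1)
    have hle : F b - ∫ x in (1 : ℝ)..b, ‖h x‖ * ‖G x‖ ≤ (q b).re - (q 1).re := by
      rw [← e, ← intervalIntegral.integral_sub (isq 1 b one_pos hb0) iK]
      refine intervalIntegral.integral_mono_on hb ((isq 1 b one_pos hb0).sub iK)
        (hq.re_intervalIntegrable one_pos hb0) fun x hx => ?_
      have e1 : ((G' x) * (starRingEnd ℂ) (G' x)).re = ‖G' x‖ ^ 2 := by
        rw [Complex.mul_conj, Complex.normSq_eq_norm_sq, Complex.ofReal_re]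
      have e2 : ((potential α k x : ℂ) * (G x * (starRingEnd ℂ) (G x))).re =
          potential α k x * ‖G x‖ ^ 2 := by
        rw [Complex.mul_conj, Complex.normSq_eq_norm_sq, ← Complex.ofReal_mul, Complex.ofReal_re]
      have e3 : (h x * (starRingEnd ℂ) (G x)).re ≤ ‖h x‖ * ‖G x‖ := by
        refine (Complex.re_le_norm _).trans ?_
        simp
      have e4 : ((potential α k x * G x - h x) * (starRingEnd ℂ) (G x) +
          G' x * (starRingEnd ℂ) (G' x)) = (potential α k x : ℂ) * (G x * (starRingEnd ℂ) (G x)) -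
          h x * (starRingEnd ℂ) (G x) + G' x * (starRingEnd ℂ) (G' x) := by ring
      rw [e4, Complex.add_re, Complex.sub_re, e1, e2]
      have := mul_nonneg (potential_nonneg hα₀ k x) (sq_nonneg ‖G x‖)
      linarith
    linarith
  have mono : ∀ a b, 1 ≤ a → a ≤ b → F a ≤ F b := fun a b ha hab =>
    intervalIntegral.integral_mono_interval le_rfl ha hab
      (ae_of_all _ fun x => sq_nonneg _) (isq 1 b one_pos (by linarith))
  have F0 : ∀ a, 1 ≤ a → 0 ≤ F a := fun a ha =>
    intervalIntegral.integral_nonneg ha fun x _ => sq_nonneg _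
  set K' : ℝ := K - (q 1).re
  -- Re(G' conj G) is half the derivative of |G|², so a second integration over [1, R] bounds ∫ F by
  -- |G(R)|²/2 + R|K'|. Monotonicity of `F` bounds that integral below by (R/2) F(R/2).
  have hGsq : ∀ R, 1 ≤ R → F (R / 2) ≤ ‖G R‖ ^ 2 + 2 * |K'| ∨ R < 2 := by
    intro R hR
    by_cases h2 : R < 2
    · exact Or.inr h2
    rw [not_lt] at h2
    left
    have e := hN.re_integral (a := 1) (b := R) one_pos (by linarith)
    have e1 : ∀ x, (G x * (starRingEnd ℂ) (G x)).re = ‖G x‖ ^ 2 := fun x => by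
      rw [Complex.mul_conj, Complex.normSq_eq_norm_sq, Complex.ofReal_re]
    have e2 : ∀ x, (G' x * (starRingEnd ℂ) (G x) + G x * (starRingEnd ℂ) (G' x)).re =
        2 * (q x).re := fun x => by
      simp only [q, Complex.add_re, Complex.mul_re, Complex.conj_re, Complex.conj_im]; ring
    simp only [e1, e2] at e
    have hi := hN.re_intervalIntegrable (a := 1) (b := R) one_pos (by linarith)
    simp only [e2] at hi
    have iF : IntervalIntegrable F volume 1 R :=
      (show MonotoneOn F (Set.uIcc 1 R) from fun x hx y hy hxy => mono x y (by
        rw [Set.uIcc_of_le hR] at hx; exact hx.1) hxy).intervalIntegrable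
    have iF2 : IntervalIntegrable F volume (R / 2) R :=
      iF.mono_set (by
        rw [Set.uIcc_of_le hR, Set.uIcc_of_le (by linarith)]
        exact Set.Icc_subset_Icc_left (by linarith))
    have l1 : (R / 2) * F (R / 2) ≤ ∫ x in (R / 2)..R, F x := by
      have := intervalIntegral.integral_mono_on (a := R / 2) (b := R) (by linarith)
        (intervalIntegrable_const (c := F (R / 2))) iF2 fun x hx => mono _ _ (by linarith) hx.1
      rw [intervalIntegral.integral_const, smul_eq_mul] at this
      linarith
    have l2 : ∫ x in (R / 2)..R, F x ≤ ∫ x in (1 : ℝ)..R, F x := by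
      refine intervalIntegral.integral_mono_interval (by linarith) (by linarith) le_rfl ?_ iF
      filter_upwards [ae_restrict_mem measurableSet_Ioc] with x hx
      exact F0 x hx.1.le
    have l3 : ∫ x in (1 : ℝ)..R, F x ≤ ∫ x in (1 : ℝ)..R, (1 / 2 * (2 * (q x).re) + K') := by
      refine intervalIntegral.integral_mono_on hR iF
        ((hi.const_mul _).add intervalIntegrable_const) fun x hx => ?_
      have := hF x hx.1
      linarith
    rw [intervalIntegral.integral_add (hi.const_mul _) intervalIntegrable_const,
      intervalIntegral.integral_const_mul, e, intervalIntegral.integral_const, smul_eq_mul] at l3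
    have l4 : (R - 1) * K' ≤ R * |K'| := by
      calc (R - 1) * K' ≤ (R - 1) * |K'| :=
            mul_le_mul_of_nonneg_left (le_abs_self _) (by linarith)
        _ ≤ R * |K'| := mul_le_mul_of_nonneg_right (by linarith) (abs_nonneg _)
    have l5 : (R / 2) * F (R / 2) ≤ (R / 2) * (‖G R‖ ^ 2 + 2 * |K'|) := by
      have := sq_nonneg ‖G 1‖
      have l6 : 1 * ‖G R‖ ^ 2 ≤ R * ‖G R‖ ^ 2 :=
        mul_le_mul_of_nonneg_right hR (sq_nonneg _)
      nlinarith
    exact le_of_mul_le_mul_left l5 (by linarith)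
  -- If `F` exceeded this constant at some point, then |G| ≥ 1 on a whole neighbourhood of infinity,
  -- contradicting G ∈ L².
  have bound : ∀ b, 1 ≤ b → F b ≤ 1 + 2 * |K'| := by
    intro b hb
    by_contra hcon
    rw [not_le] at hcon
    have hbad : ∀ x, 2 * b ≤ x → 1 ≤ ‖G x‖ ^ 2 := by
      intro x hx
      rcases hGsq x (by linarith) with h1 | h1
      · have := mono b (x / 2) hb (by linarith)
        linarith
      · linarith
    refine not_integrableOn_Ioi_of_le hbad ?_
    exact IntegrableOn.mono_set ((memLp_two_iff_integrable_sq_norm hGL.1).1 hGL) fun x hx =>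
      (show (0 : ℝ) < x by linarith [show 2 * b < x from hx])
  rw [memLp_two_iff_integrable_sq_norm meas]
  refine integrableOn_Ioi_of_intervalIntegral_norm_bounded (l := atTop) (b := fun b : ℝ => max b 1)
    (1 + 2 * |K'|) 1 (fun i => ?_) (tendsto_atTop_mono (fun b => le_max_left _ _) tendsto_id)
    (Eventually.of_forall fun b => ?_)
  · exact (intervalIntegrable_iff_integrableOn_Ioc_of_le (le_max_right _ _)).1
      (isq _ _ one_pos (one_pos.trans_le (le_max_right _ _)))
  · simp only [norm_pow, norm_norm]
    exact bound _ (le_max_right _ _)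

theorem IsLittleO.conj {F : ℝ → ℂ} {g : ℝ → ℝ} {l : Filter ℝ} (h : F =o[l] g) :
    (fun x => (starRingEnd ℂ) (F x)) =o[l] g :=
  (h.norm_left.congr_left fun x => (RCLike.norm_conj (F x)).symm).of_norm_left

theorem IsBigO.conj {F : ℝ → ℂ} {g : ℝ → ℝ} {l : Filter ℝ} (h : F =O[l] g) :
    (fun x => (starRingEnd ℂ) (F x)) =O[l] g :=
  (h.norm_left.congr_left fun x => (RCLike.norm_conj (F x)).symm).of_norm_left

theorem isBigO_comb {C₀ C₁ : ℂ} {m n l : ℝ} (hm : l ≤ m) (hn : l ≤ n) :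
    (fun x => C₀ * absPow m x + C₁ * absPow n x) =O[𝓝[>] 0] fun x : ℝ => x ^ l :=
  (((isBigO_absPow m).trans (isBigO_rpow_rpow hm)).const_mul_left C₀).add
    (((isBigO_absPow n).trans (isBigO_rpow_rpow hn)).const_mul_left C₁)

theorem tendsto_mul_zero {F G : ℝ → ℂ} {m n : ℝ} (hF : F =O[𝓝[>] 0] fun x : ℝ => x ^ m)
    (hG : G =o[𝓝[>] 0] fun x : ℝ => x ^ n) (hmn : 0 ≤ m + n) :
    Tendsto (fun x => F x * G x) (𝓝[>] 0) (𝓝 0) := by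
  refine tendsto_zero_of_isLittleO_rpow hmn ((hF.mul_isLittleO hG).congr' EventuallyEq.rfl ?_)
  filter_upwards [self_mem_nhdsWithin] with x hx
  rw [← Real.rpow_add hx]

theorem conj_absPow (m x : ℝ) : (starRingEnd ℂ) (absPow m x) = absPow m x := Complex.conj_ofReal _

section Green

variable {α : ℝ} {k : ℤ} {g₁ h₁ g₂ h₂ G₁ G₁' G₂ G₂' : ℝ → ℂ} {C₀ C₁ D₀ D₁ : ℂ}

/-- The leading parts have a constant Wronskian. Each of the six terms containing a remainder
vanishes in the limit: the leading parts have orders -α/2 and -α/2 - 1, the remainders o(x^{3/2})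
and o(x^{1/2}), so each mixed product is o(x^{(1-α)/2}) and products of two remainders are smaller
still. -/
theorem IsRegularRep.tendsto_wronskian (hα₀ : 0 ≤ α) (hα₁ : α < 1)
    (R₁ : IsRegularRep α k g₁ h₁ G₁ G₁' C₀ C₁) (R₂ : IsRegularRep α k g₂ h₂ G₂ G₂' D₀ D₁) :
    Tendsto (fun x => G₁' x * (starRingEnd ℂ) (G₂ x) - G₁ x * (starRingEnd ℂ) (G₂' x)) (𝓝[>] 0)
      (𝓝 ((1 + α) * (C₁ * (starRingEnd ℂ) D₀ - C₀ * (starRingEnd ℂ) D₁))) := by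
  have s1 : (fun x => C₀ * sol₀ α x + C₁ * sol₁ α x) =O[𝓝[>] 0] fun x : ℝ => x ^ (-(α / 2)) :=
    isBigO_comb le_rfl (by linarith)
  have s2 : (fun x => D₀ * sol₀ α x + D₁ * sol₁ α x) =O[𝓝[>] 0] fun x : ℝ => x ^ (-(α / 2)) :=
    isBigO_comb le_rfl (by linarith)
  have s1' : (fun x => C₀ * ((-(α / 2) : ℝ) * absPow (-(α / 2) - 1) x) +
      C₁ * ((1 + α / 2 : ℝ) * absPow (1 + α / 2 - 1) x)) =O[𝓝[>] 0]
        fun x : ℝ => x ^ (-(α / 2) - 1) := by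
    simp only [← mul_assoc]; exact isBigO_comb le_rfl (by linarith)
  have s2' : (fun x => D₀ * ((-(α / 2) : ℝ) * absPow (-(α / 2) - 1) x) +
      D₁ * ((1 + α / 2 : ℝ) * absPow (1 + α / 2 - 1) x)) =O[𝓝[>] 0]
        fun x : ℝ => x ^ (-(α / 2) - 1) := by
    simp only [← mul_assoc]; exact isBigO_comb le_rfl (by linarith)
  have t1 := tendsto_mul_zero s1' (IsLittleO.conj R₂.asymptotics) (by linarith)
  have t2 := tendsto_mul_zero (IsBigO.conj s2) R₁.asymptotics' (by linarith)
  have t3 := tendsto_mul_zero R₁.asymptotics'.isBigO (IsLittleO.conj R₂.asymptotics) (by norm_num)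
  have t4 := tendsto_mul_zero s1 (IsLittleO.conj R₂.asymptotics') (by linarith)
  have t5 := tendsto_mul_zero (IsBigO.conj s2') R₁.asymptotics (by linarith)
  have t6 := tendsto_mul_zero R₁.asymptotics.isBigO (IsLittleO.conj R₂.asymptotics') (by norm_num)
  have T := ((((((t1.add t2).add t3).sub t4).sub t5).sub t6)).const_add
    ((1 + α) * (C₁ * (starRingEnd ℂ) D₀ - C₀ * (starRingEnd ℂ) D₁))
  simp only [add_zero, sub_zero] at T
  refine T.congr' ?_
  filter_upwards [self_mem_nhdsWithin] with x hx
  have W := wronskian_sol α hx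
  simp only [map_sub, map_add, map_mul, conj_absPow, Complex.conj_ofReal]
  linear_combination -(C₁ * (starRingEnd ℂ) D₀ - C₀ * (starRingEnd ℂ) D₁) * W

/-- The Wronskian of the two solutions is a primitive of the integrand up to sign. Its limit at 0 is
the boundary form, and its limit at infinity is zero. -/
theorem green_formula (hα₀ : 0 ≤ α) (hα₁ : α < 1)
    (H₁ : WeakPair α k g₁ h₁) (R₁ : IsRegularRep α k g₁ h₁ G₁ G₁' C₀ C₁)
    (H₂ : WeakPair α k g₂ h₂) (R₂ : IsRegularRep α k g₂ h₂ G₂ G₂' D₀ D₁) :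
    ∫ x in Set.Ioi 0, (h₁ x * (starRingEnd ℂ) (g₂ x) - g₁ x * (starRingEnd ℂ) (h₂ x)) =
      (1 + α) * (C₁ * (starRingEnd ℂ) D₀ - C₀ * (starRingEnd ℂ) D₁) := by
  have conjL : ∀ {u : ℝ → ℂ} {μ : Measure ℝ}, MemLp u 2 μ →
      MemLp (fun x => (starRingEnd ℂ) (u x)) 2 μ := fun hu =>
    (Complex.conjLIE.toContinuousLinearEquiv.toContinuousLinearMap).comp_memLp' hu
  set w : ℝ → ℂ := fun x => G₁' x * (starRingEnd ℂ) (G₂ x) - G₁ x * (starRingEnd ℂ) (G₂' x)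
  set v : ℝ → ℂ := fun x => g₁ x * (starRingEnd ℂ) (h₂ x) - h₁ x * (starRingEnd ℂ) (g₂ x)
  have hw : IsPrimitive w v := by
    refine ((R₁.primitive'.mul R₂.primitive.conj).sub
      (R₁.primitive.mul R₂.primitive'.conj)).congr (fun x _ => rfl) ?_
    filter_upwards [R₁.ae_eq, R₂.ae_eq] with x e1 e2
    simp only [v, e1, e2, map_sub, map_mul, Complex.conj_ofReal]
    ring
  have hv : IntegrableOn v (Set.Ioi 0) :=
    (H₁.memLp.integrable_mul (conjL H₂.memLp')).sub (H₁.memLp'.integrable_mul (conjL H₂.memLp))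
  have h1 : volume.restrict (Set.Ioi (1 : ℝ)) ≤ volume.restrict (Set.Ioi 0) :=
    Measure.restrict_mono (Set.Ioi_subset_Ioi zero_le_one) le_rfl
  have hwi : IntegrableOn w (Set.Ioi 1) :=
    ((R₁.memLp_deriv hα₀ H₁).integrable_mul
      (conjL ((H₂.memLp.ae_eq R₂.ae_eq).mono_measure h1))).sub
    (((H₁.memLp.ae_eq R₁.ae_eq).mono_measure h1).integrable_mul (conjL (R₂.memLp_deriv hα₀ H₂)))
  have e1 : Tendsto (fun b : ℝ => ∫ x in (1 : ℝ)..b, v x) atTop (𝓝 (∫ x in Set.Ioi 1, v x)) :=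
    intervalIntegral_tendsto_integral_Ioi 1 (hv.mono_set (Set.Ioi_subset_Ioi zero_le_one)) tendsto_id
  have e2 : Tendsto w atTop (𝓝 ((∫ x in Set.Ioi 1, v x) + w 1)) := by
    refine (e1.add_const (w 1)).congr' ?_
    filter_upwards [eventually_gt_atTop 0] with b hb
    rw [hw.integral_eq 1 b one_pos hb]; ring
  -- The limit at infinity exists because `v` is integrable. It must be 0 because `w` is itself
  -- integrable on (1, ∞): the solutions and their derivatives are square integrable there.
  have e3 : (∫ x in Set.Ioi 1, v x) + w 1 = 0 := by
    refine IntegrableAtFilter.eq_zero_of_tendsto (μ := volume)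
      (⟨Set.Ioi 1, Ioi_mem_atTop _, hwi⟩) (fun s hs => ?_) e2
    rcases mem_atTop_sets.1 hs with ⟨b, hb⟩
    rw [← top_le_iff, ← Real.volume_Ici (a := b)]
    exact measure_mono hb
  rw [e3] at e2
  have key := hw.integral_Ioi hv (R₁.tendsto_wronskian hα₀ hα₁ R₂) e2
  rw [zero_sub] at key
  rw [← neg_inj, ← key, ← integral_neg]
  exact integral_congr_ae (ae_of_all _ fun x => by simp only [v]; ring)

end Green

/-! ### The singular functions `|x|^m P` -/

theorem WeakPair.of_isPrimitive {α : ℝ} {k : ℤ} {G G' h : ℝ → ℂ}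
    (hG : MemLp G 2 (volume.restrict (Set.Ioi 0))) (hh : MemLp h 2 (volume.restrict (Set.Ioi 0)))
    (hp : IsPrimitive G G') (hp' : IsPrimitive G' (fun x => (potential α k x : ℝ) * G x - h x)) :
    WeakPair α k G h := by
  refine ⟨hG, hh, fun f hf => ?_⟩
  have I1 := hf.integrableOn_mul (MemLp.intervalIntegrable_of_Ioi hG)
    (hf.diffExpr_continuousOn α k)
    fun x hx => diffExpr_eq_zero_of_tsupport_subset subset_rfl hx α k
  have I2 := hf.integrableOn_mul (MemLp.intervalIntegrable_of_Ioi hh) hf.continuous.continuousOn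
    fun x hx => image_eq_zero_of_notMem_tsupport hx
  rw [eq_comm, ← sub_eq_zero, ← integral_sub I1 I2, ← hp.integral_test_eq_zero hp' hf]
  refine integral_congr_ae (ae_of_all _ fun x => ?_)
  simp only [diffExpr]
  ring

theorem memLp_Ioi_of_bound {g : ℝ → ℂ} {m b C : ℝ} (hm : -(1 / 2) < m) (hb : 0 < b)
    (hg : ContinuousOn g (Set.Ioi 0)) (h0 : ∀ x, b < x → g x = 0)
    (hC : ∀ x ∈ Set.Ioc 0 b, ‖g x‖ ≤ C * x ^ m) : MemLp g 2 (volume.restrict (Set.Ioi 0)) := by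
  have meas : AEStronglyMeasurable g (volume.restrict (Set.Ioi 0)) :=
    hg.aestronglyMeasurable measurableSet_Ioi
  have meas' : AEStronglyMeasurable g (volume.restrict (Set.Ioc 0 b)) :=
    meas.mono_measure (Measure.restrict_mono Set.Ioc_subset_Ioi_self le_rfl)
  have h1 : MemLp g 2 (volume.restrict (Set.Ioc 0 b)) := by
    refine (memLp_absPow hm hb).of_le_mul (c := C) meas' ?_
    filter_upwards [ae_restrict_mem measurableSet_Ioc] with x hx
    rw [norm_absPow hx.1]
    exact hC x hx
  rw [memLp_two_iff_integrable_sq_norm meas'] at h1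
  rw [memLp_two_iff_integrable_sq_norm meas]
  refine IntegrableOn.of_forall_sdiff_eq_zero h1 measurableSet_Ioi fun x hx => ?_
  rw [h0 x (by_contra fun h => hx.2 ⟨hx.1, not_lt.1 h⟩)]
  simp

/-- The function `-(2 w' P' + w P'') + k² |x|^{2α} w P` for `w = |x|^m`, which is `S_{α,k} (w P)`
when `m` is one of the two exponents at the origin. -/
def singularImage (α : ℝ) (k : ℤ) (P : ℝ → ℂ) (m x : ℝ) : ℂ :=
  -(2 * (m * absPow (m - 1) x) * deriv P x + absPow m x * deriv (deriv P) x) +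
    k ^ 2 * absPow (2 * α) x * (absPow m x * P x)

/-- P'(0) = 0 gives |P'| ≤ Cx and |P - P(0)| ≤ Cx². The first absorbs one inverse power of x in the
commutator term |x|^{m-1} P', so that S(|x|^m P) remains O(|x|^m) near 0; the second makes |x|^m (P
- 1) = O(|x|^{m+2}), hence o(|x|^{3/2}) for m > -1/2. -/
theorem exists_norm_bounds_of_cutoff {P : ℝ → ℂ} (hP : ContDiff ℝ ∞ P) (hPc : HasCompactSupport P)
    (hP₁ : deriv P 0 = 0) : ∃ b C : ℝ, 0 < b ∧ 0 ≤ C ∧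
      (∀ x, b ≤ x → P x = 0 ∧ deriv P x = 0 ∧ deriv (deriv P) x = 0) ∧
      ∀ x, 0 ≤ x → ‖P x‖ ≤ C ∧ ‖deriv P x‖ ≤ C * x ∧ ‖deriv (deriv P) x‖ ≤ C ∧
        ‖P x - P 0‖ ≤ C * x ^ 2 := by
  have hP' : ContDiff ℝ ∞ (deriv P) := (contDiff_infty_iff_deriv.1 hP).2
  have hP'' : ContDiff ℝ ∞ (deriv (deriv P)) := (contDiff_infty_iff_deriv.1 hP').2
  obtain ⟨C0, hC0⟩ := hP.continuous.bounded_above_of_compact_support hPc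
  obtain ⟨C2, hC2⟩ := hP''.continuous.bounded_above_of_compact_support hPc.deriv.deriv
  obtain ⟨r, hr⟩ := hPc.isCompact.isBounded.subset_ball 0
  set C := max C0 C2
  have hC : 0 ≤ C := (norm_nonneg _).trans ((hC0 0).trans (le_max_left _ _))
  have d1 : ∀ x, 0 ≤ x → ‖deriv P x‖ ≤ C * x := by
    intro x hx
    have h := (convex_Icc (0 : ℝ) x).norm_image_sub_le_of_norm_deriv_le (f := deriv P) (C := C)
      (fun y _ => hP'.differentiable (by simp) y) (fun y _ => (hC2 y).trans (le_max_right _ _))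
      (Set.left_mem_Icc.2 hx) (Set.right_mem_Icc.2 hx)
    rwa [hP₁, sub_zero, sub_zero, Real.norm_of_nonneg hx] at h
  refine ⟨max r 1, C, by positivity, hC, fun x hx => ?_, fun x hx => ⟨(hC0 x).trans
    (le_max_left _ _), d1 x hx, (hC2 x).trans (le_max_right _ _), ?_⟩⟩
  · have : x ∉ Metric.ball (0 : ℝ) r := by
      simp only [Metric.mem_ball, dist_zero_right, Real.norm_eq_abs, not_lt]
      exact ((le_max_left _ _).trans hx).trans (le_abs_self x)
    exact ⟨eq_zero_of_tsupport_subset hr this, deriv_eq_zero_of_tsupport_subset hr this,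
      deriv_deriv_eq_zero_of_tsupport_subset hr this⟩
  · have h := (convex_Icc (0 : ℝ) x).norm_image_sub_le_of_norm_deriv_le (f := P) (C := C * x)
      (fun y _ => hP.differentiable (by simp) y) (fun y hy => (d1 y hy.1).trans
        (mul_le_mul_of_nonneg_left hy.2 hC))
      (Set.left_mem_Icc.2 hx) (Set.right_mem_Icc.2 hx)
    rw [sub_zero, Real.norm_of_nonneg hx] at h
    linarith [h, show C * x * x = C * x ^ 2 by ring]

section Singular

variable {α : ℝ} {P : ℝ → ℂ}

theorem norm_singularImage_le (hα₀ : 0 ≤ α) (k : ℤ) {m b C : ℝ}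
    (hC : ∀ x, 0 ≤ x → ‖P x‖ ≤ C ∧ ‖deriv P x‖ ≤ C * x ∧ ‖deriv (deriv P) x‖ ≤ C ∧
        ‖P x - P 0‖ ≤ C * x ^ 2) {x : ℝ} (hx : x ∈ Set.Ioc 0 b) :
    ‖singularImage α k P m x‖ ≤ (2 * |m| * C + C + k ^ 2 * b ^ (2 * α) * C) * x ^ m := by
  obtain ⟨c0, c1, c2, -⟩ := hC x hx.1.le
  have hxm : 0 ≤ x ^ m := Real.rpow_nonneg hx.1.le m
  have e1 : ‖2 * (m * absPow (m - 1) x) * deriv P x‖ ≤ 2 * |m| * C * x ^ m := by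
    rw [norm_mul, norm_mul, norm_mul, norm_absPow hx.1, Complex.norm_real, Real.norm_eq_abs,
      Complex.norm_ofNat]
    calc 2 * (|m| * x ^ (m - 1)) * ‖deriv P x‖ ≤ 2 * (|m| * x ^ (m - 1)) * (C * x) := by
          have := Real.rpow_nonneg hx.1.le (m - 1); gcongr
      _ = 2 * |m| * C * (x ^ (m - 1) * x) := by ring
      _ = 2 * |m| * C * x ^ m := by rw [← Real.rpow_add_one hx.1.ne', sub_add_cancel]
  have e2 : ‖absPow m x * deriv (deriv P) x‖ ≤ C * x ^ m := by
    rw [norm_mul, norm_absPow hx.1, mul_comm]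
    gcongr
  have e3 : ‖(k : ℂ) ^ 2 * absPow (2 * α) x * (absPow m x * P x)‖ ≤
      k ^ 2 * b ^ (2 * α) * C * x ^ m := by
    rw [norm_mul, norm_mul, norm_mul, norm_absPow hx.1 m, norm_pow, Complex.norm_intCast, sq_abs]
    calc (k : ℝ) ^ 2 * ‖absPow (2 * α) x‖ * (x ^ m * ‖P x‖)
        ≤ (k : ℝ) ^ 2 * b ^ (2 * α) * (x ^ m * C) := by
          have := norm_absPow_le_of_Ioc (m := 2 * α) (by linarith) hx
          have hb : 0 ≤ b ^ (2 * α) := Real.rpow_nonneg (hx.1.le.trans hx.2) _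
          gcongr
      _ = _ := by ring
  refine (norm_add_le _ _).trans ?_
  rw [norm_neg]
  have := norm_add_le (2 * (m * absPow (m - 1) x) * deriv P x) (absPow m x * deriv (deriv P) x)
  linarith

theorem isPrimitive_absPow_mul (hP : ContDiff ℝ ∞ P) (k : ℤ) {m : ℝ}
    (hm : m * (m - 1) = α * (2 + α) / 4) :
    IsPrimitive (fun x => absPow m x * P x)
      (fun x => m * absPow (m - 1) x * P x + absPow m x * deriv P x) ∧
    IsPrimitive (fun x => m * absPow (m - 1) x * P x + absPow m x * deriv P x)
      (fun x => (potential α k x : ℝ) * (absPow m x * P x) - singularImage α k P m x) := by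
  have p1 : IsPrimitive P (deriv P) := .of_hasDerivAt (fun x _ => (contDiff.hasDerivAt_deriv hP x).1)
    (contDiff_infty_iff_deriv.1 hP).2.continuous.continuousOn
  have p2 : IsPrimitive (deriv P) (deriv (deriv P)) :=
    .of_hasDerivAt (fun x _ => (contDiff.hasDerivAt_deriv hP x).2)
    (contDiff_infty_iff_deriv.1 (contDiff_infty_iff_deriv.1 hP).2).2.continuous.continuousOn
  refine ⟨(isPrimitive_absPow m).mul p1, ?_⟩
  refine (((isPrimitive_absPow' hm).mul p1).add ((isPrimitive_absPow m).mul p2)).congr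
    (fun x _ => rfl) (ae_of_all _ fun x => ?_)
  simp only [singularImage, potential_eq_add α k, absPow]
  push_cast
  ring

theorem weakPair_absPow_mul (hα₀ : 0 ≤ α) (k : ℤ) (hP : ContDiff ℝ ∞ P)
    (hPc : HasCompactSupport P) (hP₁ : deriv P 0 = 0) {m : ℝ} (hm' : -(1 / 2) < m)
    (hm : m * (m - 1) = α * (2 + α) / 4) :
    WeakPair α k (fun x => absPow m x * P x) (singularImage α k P m) := by
  obtain ⟨b, C, hb, hC0, hz, hC⟩ := exists_norm_bounds_of_cutoff hP hPc hP₁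
  obtain ⟨p1, p2⟩ := isPrimitive_absPow_mul hP k hm
  have cP' : Continuous (deriv P) := (contDiff_infty_iff_deriv.1 hP).2.continuous
  have cP'' : Continuous (deriv (deriv P)) :=
    (contDiff_infty_iff_deriv.1 (contDiff_infty_iff_deriv.1 hP).2).2.continuous
  refine .of_isPrimitive ?_ ?_ p1 p2
  · refine memLp_Ioi_of_bound (C := C) hm' hb p1.continuousOn (fun x hx => ?_) fun x hx => ?_
    · rw [(hz x hx.le).1, mul_zero]
    · rw [norm_mul, norm_absPow hx.1, mul_comm]
      exact mul_le_mul_of_nonneg_right (hC x hx.1.le).1 (Real.rpow_nonneg hx.1.le m)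
  · refine memLp_Ioi_of_bound hm' hb ?_ (fun x hx => ?_)
      fun x hx => norm_singularImage_le hα₀ k hC hx
    · exact (((continuousOn_const.mul (continuousOn_const.mul (continuousOn_absPow _))).mul
        cP'.continuousOn).add ((continuousOn_absPow _).mul cP''.continuousOn)).neg.add
        ((continuousOn_const.mul (continuousOn_absPow _)).mul
          ((continuousOn_absPow _).mul hP.continuous.continuousOn))
    · obtain ⟨z0, z1, z2⟩ := hz x hx.le
      simp [singularImage, z0, z1, z2]

theorem isLittleO_rpow_rpow {a b : ℝ} (hab : b < a) :
    (fun x : ℝ => x ^ a) =o[𝓝[>] 0] fun x : ℝ => x ^ b := by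
  have h1 : (fun x : ℝ => x ^ (a - b)) =o[𝓝[>] 0] fun _ => (1 : ℝ) := by
    rw [isLittleO_one_iff]
    have h := (Real.continuousAt_rpow_const 0 (a - b) (Or.inr (sub_pos.2 hab).le)).tendsto
    rw [Real.zero_rpow (sub_pos.2 hab).ne'] at h
    exact h.mono_left nhdsWithin_le_nhds
  refine ((isBigO_refl (fun x : ℝ => x ^ b) _).mul_isLittleO h1).congr' ?_ (by simp)
  filter_upwards [self_mem_nhdsWithin] with x hx
  rw [← Real.rpow_add hx, add_sub_cancel]

theorem isLittleO_absPow_mul_sub (hP : ContDiff ℝ ∞ P) (hPc : HasCompactSupport P)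
    (hP₀ : P 0 = 1) (hP₁ : deriv P 0 = 0) {m : ℝ} (hm : -(1 / 2) < m) :
    (fun x => absPow m x * P x - absPow m x) =o[𝓝[>] 0] fun x : ℝ => x ^ (3 / 2 : ℝ) := by
  obtain ⟨b, C, hb, hC0, hz, hC⟩ := exists_norm_bounds_of_cutoff hP hPc hP₁
  refine IsBigO.trans_isLittleO (g := fun x : ℝ => x ^ (m + 2)) (IsBigO.of_bound C ?_)
    (isLittleO_rpow_rpow (by linarith))
  filter_upwards [self_mem_nhdsWithin] with x (hx : 0 < x)
  have h := (hC x hx.le).2.2.2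
  rw [hP₀] at h
  rw [show absPow m x * P x - absPow m x = absPow m x * (P x - 1) by ring, norm_mul,
    norm_absPow hx, Real.norm_of_nonneg (Real.rpow_nonneg hx.le _), Real.rpow_add hx,
    Real.rpow_two]
  calc x ^ m * ‖P x - 1‖ ≤ x ^ m * (C * x ^ 2) :=
        mul_le_mul_of_nonneg_left h (Real.rpow_nonneg hx.le _)
    _ = C * (x ^ m * x ^ 2) := by ring

end Singular

/-! ### Reflection of the half-lines -/

/-- The reflection that carries `ℝ⁺` to `ℝ^±`. -/
def flip : Side → ℝ → ℝ
  | .minus => fun x => -x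
  | .plus => fun x => x

theorem flip_flip (s : Side) (x : ℝ) : flip s (flip s x) = x := by cases s <;> simp [flip]

theorem abs_flip (s : Side) (x : ℝ) : |flip s x| = |x| := by cases s <;> simp [flip]

theorem absPow_flip (s : Side) (m x : ℝ) : absPow m (flip s x) = absPow m x := by
  rw [absPow, abs_flip, absPow]

theorem contDiff_flip (s : Side) : ContDiff ℝ ∞ (flip s) := by
  cases s
  · exact contDiff_neg
  · exact contDiff_id

theorem flip_mem_halfLine (s : Side) {x : ℝ} : flip s x ∈ halfLine s ↔ x ∈ Set.Ioi (0 : ℝ) := by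
  cases s <;> simp [flip, halfLine]

theorem flip_mem_Ioi (s : Side) {x : ℝ} : flip s x ∈ Set.Ioi (0 : ℝ) ↔ x ∈ halfLine s := by
  cases s <;> simp [flip, halfLine]

/-- `flip` as a homeomorphism. -/
def flipHomeomorph (s : Side) : ℝ ≃ₜ ℝ where
  toFun := flip s
  invFun := flip s
  left_inv := flip_flip s
  right_inv := flip_flip s
  continuous_toFun := (contDiff_flip s).continuous
  continuous_invFun := (contDiff_flip s).continuous

theorem measurePreserving_flip (s : Side) :
    MeasurePreserving (flip s) (sideMeasure .plus) (sideMeasure s) := by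
  cases s
  · have h := (Measure.measurePreserving_neg (volume : Measure ℝ)).restrict_preimage
      (s := Set.Iio (0 : ℝ)) measurableSet_Iio
    have e : (Neg.neg ⁻¹' Set.Iio (0 : ℝ)) = Set.Ioi 0 := by ext x; simp
    rw [e] at h
    exact h
  · exact MeasurePreserving.id _

theorem measurePreserving_flip' (s : Side) :
    MeasurePreserving (flip s) (sideMeasure s) (sideMeasure .plus) :=
  (measurePreserving_flip s).symm (flipHomeomorph s).toMeasurableEquiv

theorem integral_flip (s : Side) (f : ℝ → ℂ) :
    ∫ x in Set.Ioi 0, f (flip s x) = ∫ x in halfLine s, f x :=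
  (measurePreserving_flip s).integral_comp (flipHomeomorph s).measurableEmbedding f

theorem IsTest.flip_of_plus {f : ℝ → ℂ} (hf : IsTest .plus f) (s : Side) :
    IsTest s (fun x => f (flip s x)) :=
  ⟨hf.1.comp (contDiff_flip s), hf.2.1.comp_homeomorph (flipHomeomorph s), fun _ hx =>
    (flip_mem_Ioi s).1 (hf.2.2
      ((tsupport_comp_eq_preimage f (flipHomeomorph s)).subset hx))⟩

theorem IsTest.flip_to_plus {s : Side} {f : ℝ → ℂ} (hf : IsTest s f) :
    IsTest .plus (fun x => f (flip s x)) :=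
  ⟨hf.1.comp (contDiff_flip s), hf.2.1.comp_homeomorph (flipHomeomorph s), fun _ hx =>
    (flip_mem_halfLine s).1 (hf.2.2
      ((tsupport_comp_eq_preimage f (flipHomeomorph s)).subset hx))⟩

theorem deriv_deriv_comp_flip (s : Side) (f : ℝ → ℂ) (x : ℝ) :
    deriv (deriv fun y => f (flip s y)) x = deriv (deriv f) (flip s x) := by
  cases s
  · have h : (deriv fun y => f (flip .minus y)) = fun y => -deriv f (-y) := by
      funext y; simp only [flip]; exact deriv_comp_neg f y
    rw [h, deriv.fun_neg, deriv_comp_neg]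
    simp [flip]
  · rfl

theorem potential_flip (α : ℝ) (k : ℤ) (s : Side) (x : ℝ) :
    potential α k (flip s x) = potential α k x := by
  simp only [potential, abs_flip]
  rw [← sq_abs (flip s x), abs_flip, sq_abs]

theorem diffExpr_comp_flip (α : ℝ) (k : ℤ) (s : Side) (f : ℝ → ℂ) (x : ℝ) :
    diffExpr α k (fun y => f (flip s y)) x = diffExpr α k f (flip s x) := by
  simp only [diffExpr, deriv_deriv_comp_flip, potential_flip]

theorem map_flip_nhds (s : Side) : map (flip s) (𝓝[>] 0) = 𝓝[halfLine s] 0 := by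
  have h := (flipHomeomorph s).isEmbedding.map_nhdsWithin_eq (Set.Ioi 0) 0
  have e : (flipHomeomorph s) '' Set.Ioi 0 = halfLine s := by
    ext x
    constructor
    · rintro ⟨y, hy, rfl⟩
      exact (flip_mem_halfLine s).2 hy
    · intro hx
      exact ⟨flip s x, (flip_mem_Ioi s).2 hx, flip_flip s x⟩
  have e0 : (flipHomeomorph s) 0 = 0 := by
    change flip s 0 = 0
    cases s <;> simp [flip]
  rw [e, e0] at h
  exact h

theorem hasShortRange_iff_flip {α : ℝ} {s : Side} {G : ℝ → ℂ} {c₀ c₁ : ℂ} :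
    HasShortRange α s G c₀ c₁ ↔ HasShortRange α .plus (fun x => G (flip s x)) c₀ c₁ := by
  simp only [HasShortRange, ← map_flip_nhds s, tendsto_map'_iff, isLittleO_map,
    Function.comp_def, abs_flip]
  rfl

/-- The o(x^{3/2}) expansion already implies both limits. The condition becomes a single little-o
statement, linear in the function and its coefficients. -/
theorem hasShortRange_plus_iff {α : ℝ} (hα₀ : 0 ≤ α) (hα₁ : α < 1) {G : ℝ → ℂ} {c₀ c₁ : ℂ} :
    HasShortRange α .plus G c₀ c₁ ↔
      (fun x => G x - (c₀ * sol₀ α x + c₁ * sol₁ α x)) =o[𝓝[>] 0] fun x : ℝ => x ^ (3 / 2 : ℝ) := by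
  have e : (fun x : ℝ => |x| ^ (3 / 2 : ℝ)) =ᶠ[𝓝[>] 0] fun x : ℝ => x ^ (3 / 2 : ℝ) := by
    filter_upwards [self_mem_nhdsWithin] with x (hx : 0 < x)
    rw [abs_of_pos hx]
  constructor
  · rintro ⟨-, -, h⟩
    exact h.congr' EventuallyEq.rfl e
  · intro h
    obtain ⟨h1, h2⟩ := tendsto_of_asymptotics hα₀ hα₁ h
    exact ⟨h1, h2, h.congr' EventuallyEq.rfl e.symm⟩

theorem IsContinuousRep.flip {s : Side} {G : ℝ → ℂ} {u : HalfSpace s} (h : IsContinuousRep s G u) :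
    ContinuousOn (fun x => G (flip s x)) (Set.Ioi 0) ∧
      (fun x => u (GrushinFibre.flip s x)) =ᵐ[volume.restrict (Set.Ioi 0)]
        fun x => G (GrushinFibre.flip s x) :=
  ⟨h.1.comp (contDiff_flip s).continuous.continuousOn fun _ hx => (flip_mem_halfLine s).2 hx,
    (measurePreserving_flip s).quasiMeasurePreserving.ae_eq_comp h.2⟩

theorem isContinuousRep_of_flip {s : Side} {G : ℝ → ℂ} {u : HalfSpace s}
    (hG : ContinuousOn G (Set.Ioi 0))
    (h : (fun x => u (flip s x)) =ᵐ[volume.restrict (Set.Ioi 0)] G) :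
    IsContinuousRep s (fun x => G (flip s x)) u := by
  refine ⟨hG.comp (contDiff_flip s).continuous.continuousOn fun _ hx => (flip_mem_Ioi s).2 hx, ?_⟩
  have := (measurePreserving_flip' s).quasiMeasurePreserving.ae_eq_comp h
  simpa only [Function.comp_def, flip_flip] using this

theorem IsContinuousRep.eqOn {s : Side} {G G' : ℝ → ℂ} {u : HalfSpace s}
    (h : IsContinuousRep s G u) (h' : IsContinuousRep s G' u) : Set.EqOn G G' (halfLine s) :=
  Measure.eqOn_open_of_ae_eq (h.2.symm.trans h'.2) (isOpen_halfLine s) h.1 h'.1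

/-- Weak solutions on `ℝ^±` in terms of weak solutions on `ℝ⁺`. -/
theorem isWeakDiffExpr_iff_weakPair {α : ℝ} {k : ℤ} {s : Side} {u v : HalfSpace s} :
    IsWeakDiffExpr α k s u v ↔
      WeakPair α k (fun x => u (flip s x)) (fun x => v (flip s x)) := by
  constructor
  · intro h
    refine ⟨(Lp.memLp u).comp_measurePreserving (measurePreserving_flip s),
      (Lp.memLp v).comp_measurePreserving (measurePreserving_flip s), fun f hf => ?_⟩
    have e := h _ (hf.flip_of_plus s)
    rw [← integral_flip, ← integral_flip] at e
    simpa only [diffExpr_comp_flip, flip_flip] using e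
  · intro h f hf
    have e := h.integral_eq _ hf.flip_to_plus
    rw [← integral_flip, ← integral_flip]
    simpa only [diffExpr_comp_flip, flip_flip] using e

/-! ### Asymptotic coefficients of vectors on a half-line. -/

/-- The numbers `c₀`, `c₁` are the asymptotic coefficients of `u` at the origin. -/
def HasCoeffs (α : ℝ) (s : Side) (u : HalfSpace s) (c₀ c₁ : ℂ) : Prop :=
  ∃ G, IsContinuousRep s G u ∧ HasShortRange α s G c₀ c₁

theorem HasCoeffs.unique {α : ℝ} (hα₀ : 0 ≤ α) (hα₁ : α < 1) {s : Side} {u : HalfSpace s}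
    {c₀ c₁ d₀ d₁ : ℂ} (h : HasCoeffs α s u c₀ c₁) (h' : HasCoeffs α s u d₀ d₁) :
    c₀ = d₀ ∧ c₁ = d₁ := by
  obtain ⟨G, hG, a⟩ := h
  obtain ⟨G', hG', b⟩ := h'
  rw [hasShortRange_iff_flip, hasShortRange_plus_iff hα₀ hα₁] at a b
  refine coeff_unique hα₀ hα₁ a (b.congr' ?_ EventuallyEq.rfl)
  filter_upwards [self_mem_nhdsWithin] with x hx
  rw [hG.eqOn hG' ((flip_mem_halfLine s).2 hx)]

theorem HasCoeffs.add {α : ℝ} (hα₀ : 0 ≤ α) (hα₁ : α < 1) {s : Side} {u v : HalfSpace s}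
    {c₀ c₁ d₀ d₁ : ℂ} (h : HasCoeffs α s u c₀ c₁) (h' : HasCoeffs α s v d₀ d₁) :
    HasCoeffs α s (u + v) (c₀ + d₀) (c₁ + d₁) := by
  obtain ⟨G, hG, a⟩ := h
  obtain ⟨G', hG', b⟩ := h'
  refine ⟨fun x => G x + G' x, ⟨hG.1.add hG'.1, (Lp.coeFn_add u v).trans (hG.2.add hG'.2)⟩, ?_⟩
  rw [hasShortRange_iff_flip, hasShortRange_plus_iff hα₀ hα₁] at a b ⊢
  refine (a.add b).congr_left fun x => ?_
  ring

theorem HasCoeffs.smul {α : ℝ} (hα₀ : 0 ≤ α) (hα₁ : α < 1) {s : Side} {u : HalfSpace s}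
    {c₀ c₁ : ℂ} (a : ℂ) (h : HasCoeffs α s u c₀ c₁) :
    HasCoeffs α s (a • u) (a * c₀) (a * c₁) := by
  obtain ⟨G, hG, b⟩ := h
  refine ⟨fun x => a * G x, ⟨continuousOn_const.mul hG.1,
    (Lp.coeFn_smul a u).trans (hG.2.const_smul a)⟩, ?_⟩
  rw [hasShortRange_iff_flip, hasShortRange_plus_iff hα₀ hα₁] at b ⊢
  refine (b.const_mul_left a).congr_left fun x => ?_
  ring

theorem HasCoeffs.sub {α : ℝ} (hα₀ : 0 ≤ α) (hα₁ : α < 1) {s : Side} {u v : HalfSpace s}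
    {c₀ c₁ d₀ d₁ : ℂ} (h : HasCoeffs α s u c₀ c₁) (h' : HasCoeffs α s v d₀ d₁) :
    HasCoeffs α s (u - v) (c₀ - d₀) (c₁ - d₁) := by
  have := h.add hα₀ hα₁ (h'.smul hα₀ hα₁ (-1))
  simpa [sub_eq_add_neg] using this

section

variable {α : ℝ} {k : ℤ} {s : Side} {u v u' v' : HalfSpace s}

theorem IsRegularRep.hasCoeffs (hα₀ : 0 ≤ α) (hα₁ : α < 1) {h G G' : ℝ → ℂ} {C₀ C₁ : ℂ}
    (R : IsRegularRep α k (fun x => u (flip s x)) h G G' C₀ C₁) : HasCoeffs α s u C₀ C₁ := by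
  refine ⟨fun x => G (flip s x), isContinuousRep_of_flip R.primitive.continuousOn R.ae_eq, ?_⟩
  rw [hasShortRange_iff_flip, hasShortRange_plus_iff hα₀ hα₁]
  simpa only [flip_flip] using R.asymptotics

theorem IsWeakDiffExpr.exists_hasCoeffs (hα₀ : 0 ≤ α) (hα₁ : α < 1)
    (h : IsWeakDiffExpr α k s u v) : ∃ c₀ c₁, HasCoeffs α s u c₀ c₁ := by
  obtain ⟨G, G', C₀, C₁, R⟩ :=
    (isWeakDiffExpr_iff_weakPair.1 h).exists_isRegularRep hα₀ hα₁
  exact ⟨C₀, C₁, R.hasCoeffs hα₀ hα₁⟩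

theorem inner_halfSpace (u v : HalfSpace s) :
    ⟪u, v⟫_ℂ = ∫ x in halfLine s, v x * (starRingEnd ℂ) (u x) := by
  rw [L2.inner_def]
  rfl

theorem IsWeakDiffExpr.green (hα₀ : 0 ≤ α) (hα₁ : α < 1) (h : IsWeakDiffExpr α k s u v)
    (h' : IsWeakDiffExpr α k s u' v') {c₀ c₁ d₀ d₁ : ℂ} (hc : HasCoeffs α s u c₀ c₁)
    (hd : HasCoeffs α s u' d₀ d₁) :
    ⟪u', v⟫_ℂ - ⟪v', u⟫_ℂ = (1 + α) * (c₁ * (starRingEnd ℂ) d₀ - c₀ * (starRingEnd ℂ) d₁) := by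
  have H := isWeakDiffExpr_iff_weakPair.1 h
  have H' := isWeakDiffExpr_iff_weakPair.1 h'
  obtain ⟨G, G', C₀, C₁, R⟩ := H.exists_isRegularRep hα₀ hα₁
  obtain ⟨F, F', D₀, D₁, R'⟩ := H'.exists_isRegularRep hα₀ hα₁
  -- The given coefficients may come from any continuous representative; uniqueness identifies them
  -- with those of the regular one.
  obtain ⟨rfl, rfl⟩ := hc.unique hα₀ hα₁ (R.hasCoeffs hα₀ hα₁)
  obtain ⟨rfl, rfl⟩ := hd.unique hα₀ hα₁ (R'.hasCoeffs hα₀ hα₁)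
  rw [← green_formula hα₀ hα₁ H R H' R', inner_halfSpace, inner_halfSpace, ← integral_flip,
    ← integral_flip]
  have conjL : ∀ {u : ℝ → ℂ} {μ : Measure ℝ}, MemLp u 2 μ →
      MemLp (fun x => (starRingEnd ℂ) (u x)) 2 μ := fun hu =>
    (Complex.conjLIE.toContinuousLinearEquiv.toContinuousLinearMap).comp_memLp' hu
  exact (integral_sub (H.memLp'.integrable_mul (conjL H'.memLp))
    (H.memLp.integrable_mul (conjL H'.memLp'))).symm

theorem WeakPair.exists_isWeakDiffExpr {g h : ℝ → ℂ} (H : WeakPair α k g h) (s : Side) :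
    ∃ u v : HalfSpace s, (u =ᵐ[sideMeasure s] fun x => g (flip s x)) ∧
      IsWeakDiffExpr α k s u v := by
  have m1 := H.memLp.comp_measurePreserving (measurePreserving_flip' s)
  have m2 := H.memLp'.comp_measurePreserving (measurePreserving_flip' s)
  refine ⟨m1.toLp _, m2.toLp _, m1.coeFn_toLp, fun f hf => ?_⟩
  have e := H.integral_eq _ hf.flip_to_plus
  have e1 : ∫ x in halfLine s, (m2.toLp _ : HalfSpace s) x * f x =
      ∫ x in halfLine s, h (flip s x) * f x :=
    integral_congr_ae (by filter_upwards [m2.coeFn_toLp] with x hx; rw [hx]; rfl)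
  have e2 : ∫ x in halfLine s, (m1.toLp _ : HalfSpace s) x * diffExpr α k f x =
      ∫ x in halfLine s, g (flip s x) * diffExpr α k f x :=
    integral_congr_ae (by filter_upwards [m1.coeFn_toLp] with x hx; rw [hx]; rfl)
  rw [e1, e2, ← integral_flip, ← integral_flip]
  simpa only [diffExpr_comp_flip, flip_flip] using e

theorem comp_flip_cutoff {P : ℝ → ℂ} (hP : ContDiff ℝ ∞ P) (hPc : HasCompactSupport P)
    (hP₀ : P 0 = 1) (hP₁ : deriv P 0 = 0) (s : Side) :
    ContDiff ℝ ∞ (fun x => P (flip s x)) ∧ HasCompactSupport (fun x => P (flip s x)) ∧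
      P (flip s 0) = 1 ∧ deriv (fun x => P (flip s x)) 0 = 0 := by
  refine ⟨hP.comp (contDiff_flip s), hPc.comp_homeomorph (flipHomeomorph s), ?_, ?_⟩
  · cases s <;> simpa [flip] using hP₀
  · cases s
    · simp only [flip, deriv_comp_neg, neg_zero, hP₁]
    · exact hP₁

/-- The function `|x|^m P` belongs to the domain of the adjoint. -/
theorem exists_singular_vector (hα₀ : 0 ≤ α) (k : ℤ) {P : ℝ → ℂ} (hP : ContDiff ℝ ∞ P)
    (hPc : HasCompactSupport P) (hP₀ : P 0 = 1) (hP₁ : deriv P 0 = 0) (s : Side) {m : ℝ}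
    (hm' : -(1 / 2) < m) (hm : m * (m - 1) = α * (2 + α) / 4) :
    ∃ u v : HalfSpace s, IsContinuousRep s (fun x => absPow m x * P x) u ∧
      IsWeakDiffExpr α k s u v ∧
      (fun x => absPow m (flip s x) * P (flip s x) - absPow m x) =o[𝓝[>] 0]
        fun x : ℝ => x ^ (3 / 2 : ℝ) := by
  obtain ⟨q1, q2, q3, q4⟩ := comp_flip_cutoff hP hPc hP₀ hP₁ s
  obtain ⟨u, v, hu, huv⟩ := (weakPair_absPow_mul hα₀ k q1 q2 q4 hm' hm).exists_isWeakDiffExpr s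
  refine ⟨u, v, ⟨?_, ?_⟩, huv, ?_⟩
  · refine ContinuousOn.mul ?_ hP.continuous.continuousOn
    have h := (continuousOn_absPow m).comp (contDiff_flip s).continuous.continuousOn
      fun x hx => (flip_mem_Ioi s).2 hx
    refine h.congr fun x _ => ?_
    exact (absPow_flip s m x).symm
  · simpa only [flip_flip, absPow_flip] using hu
  · have := isLittleO_absPow_mul_sub q1 q2 q3 q4 hm'
    simpa only [absPow_flip] using this

end

/-! ### Adjoint and closure of the half-line operators -/

/-- The adjoint of a graph is the orthogonal complement rotated by (a, b) ↦ (-b, a). Two rotations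
cancel up to sign, so the double adjoint lies in the double orthogonal complement, which is the
closure. -/
theorem mem_topologicalClosure_of_mem_adjoint_adjoint {H : Type*} [NormedAddCommGroup H]
    [InnerProductSpace ℂ H] [CompleteSpace H] {K : Submodule ℂ (H × H)} {x : H × H}
    (hx : x ∈ K.adjoint.adjoint) : x ∈ K.topologicalClosure := by
  -- The product `H × H` carries the sup norm. Orthogonality is used in its Hilbert version, which
  -- has the same topology.
  set L := WithLp.prodContinuousLinearEquiv 2 ℂ H H
  set K' : Submodule ℂ (WithLp 2 (H × H)) := K.comap L.toLinearEquiv.toLinearMap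
  have h1 : L.symm x ∈ K'.topologicalClosure := by
    rw [← Submodule.orthogonal_orthogonal_eq_closure, Submodule.mem_orthogonal]
    intro y hy
    rw [Submodule.mem_orthogonal] at hy
    have hy' : (-(L y).2, (L y).1) ∈ K.adjoint := by
      rw [Submodule.mem_adjoint_iff]
      intro a b hab
      have := hy (L.symm (a, b)) (by simpa [K'] using hab)
      rw [WithLp.prod_inner_apply] at this
      rw [inner_neg_right, ← neg_add', neg_eq_zero, add_comm]
      exact this
    have h2 := (Submodule.mem_adjoint_iff _ x).1 hx _ _ hy'
    rw [inner_neg_left, sub_neg_eq_add] at h2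
    rw [WithLp.prod_inner_apply]
    exact h2
  have h3 : L (L.symm x) ∈ closure (L '' (K' : Set (WithLp 2 (H × H)))) :=
    (image_closure_subset_closure_image L.continuous) ⟨_, h1, rfl⟩
  rw [L.apply_symm_apply] at h3
  refine closure_mono ?_ h3
  rintro _ ⟨y, hy, rfl⟩
  exact hy

section HalfLine

variable {α : ℝ} {k : ℤ} {s : Side}

theorem IsTest.memLp {f : ℝ → ℂ} (hf : IsTest s f) : MemLp f 2 (sideMeasure s) :=
  (hf.continuous.memLp_of_hasCompactSupport hf.2.1).restrict _

theorem IsTest.conj {f : ℝ → ℂ} (hf : IsTest s f) : IsTest s (fun x => (starRingEnd ℂ) (f x)) :=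
  ⟨(Complex.conjLIE.toContinuousLinearEquiv.toContinuousLinearMap).contDiff.comp hf.1,
    hf.2.1.comp_left (map_zero _),
    (closure_mono (Function.support_comp_subset (map_zero _) f)).trans hf.2.2⟩

theorem deriv_conj (f : ℝ → ℂ) (x : ℝ) :
    deriv (fun y => (starRingEnd ℂ) (f y)) x = (starRingEnd ℂ) (deriv f x) := by
  by_cases h : DifferentiableAt ℝ f x
  · exact ((Complex.conjLIE.toContinuousLinearEquiv.toContinuousLinearMap).hasFDerivAt.comp_hasDerivAt
      x h.hasDerivAt).deriv
  · rw [deriv_zero_of_not_differentiableAt h, deriv_zero_of_not_differentiableAt, map_zero]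
    intro h'
    refine h ?_
    have := ((Complex.conjLIE.toContinuousLinearEquiv.toContinuousLinearMap).differentiableAt).comp
      x h'
    simpa [Function.comp_def] using this

/-- The coefficients are real. This is what turns the bilinear pairing of weak derivatives into the
sesquilinear pairing of the adjoint. -/
theorem diffExpr_conj (f : ℝ → ℂ) (x : ℝ) :
    diffExpr α k (fun y => (starRingEnd ℂ) (f y)) x = (starRingEnd ℂ) (diffExpr α k f x) := by
  have h : deriv (fun y => (starRingEnd ℂ) (f y)) = fun y => (starRingEnd ℂ) (deriv f y) :=
    funext (deriv_conj f)
  simp only [diffExpr, h, deriv_conj, map_add, map_neg, map_mul, Complex.conj_ofReal]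

theorem IsTest.memLp_diffExpr_plus {f : ℝ → ℂ} (hf : IsTest .plus f) (α : ℝ) (k : ℤ) :
    MemLp (diffExpr α k f) 2 (volume.restrict (Set.Ioi 0)) := by
  obtain ⟨a, b, ha, hab, hs⟩ := hf.exists_Ioo
  have hc := hf.diffExpr_continuousOn α k
  have z : ∀ x, x ∉ Set.Ioo a b → diffExpr α k f x = 0 :=
    fun x hx => diffExpr_eq_zero_of_tsupport_subset hs hx α k
  obtain ⟨C, hC⟩ := isCompact_Icc.exists_bound_of_continuousOn
    (hc.mono fun x (hx : x ∈ Set.Icc a b) => ha.trans_le hx.1)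
  have hC0 : 0 ≤ C := (norm_nonneg _).trans (hC a (Set.left_mem_Icc.2 hab.le))
  refine memLp_Ioi_of_bound (m := 0) (C := C) (by norm_num) (ha.trans hab) hc
    (fun x hx => z x fun h => absurd h.2 (not_lt.2 hx.le)) fun x _ => ?_
  rw [Real.rpow_zero, mul_one]
  by_cases h : x ∈ Set.Icc a b
  · exact hC x h
  · rw [z x fun h' => h (Set.Ioo_subset_Icc_self h'), norm_zero]
    exact hC0

theorem IsTest.memLp_diffExpr {f : ℝ → ℂ} (hf : IsTest s f) (α : ℝ) (k : ℤ) :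
    MemLp (diffExpr α k f) 2 (sideMeasure s) := by
  have := (hf.flip_to_plus.memLp_diffExpr_plus α k).comp_measurePreserving
    (measurePreserving_flip' s)
  simpa only [Function.comp_def, diffExpr_comp_flip, flip_flip] using this

theorem IsTest.toLp_mem_minimalGraph {f : ℝ → ℂ} (hf : IsTest s f) (α : ℝ) (k : ℤ) :
    (hf.memLp.toLp f, (hf.memLp_diffExpr α k).toLp _) ∈ minimalGraph α k s :=
  ⟨f, hf, hf.memLp.coeFn_toLp, (hf.memLp_diffExpr α k).coeFn_toLp⟩

theorem mem_halfOp_domain_of_isTest {f : ℝ → ℂ} (hf : IsTest s f) (α : ℝ) (k : ℤ) :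
    hf.memLp.toLp f ∈ (halfOp α k s).domain := by
  have h := hf.toLp_mem_minimalGraph α k
  rw [← halfOp_graph] at h
  exact LinearPMap.mem_domain_of_mem_graph h

theorem halfOp_dense (α : ℝ) (k : ℤ) (s : Side) :
    Dense ((halfOp α k s).domain : Set (HalfSpace s)) := by
  rw [Submodule.dense_iff_topologicalClosure_eq_top, Submodule.topologicalClosure_eq_top_iff,
    Submodule.eq_bot_iff]
  intro u hu
  rw [Submodule.mem_orthogonal] at hu
  have hloc : LocallyIntegrableOn (fun x => u x) (halfLine s) volume :=
    locallyIntegrableOn_of_locallyIntegrable_restrict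
      ((Lp.memLp u).locallyIntegrable (by norm_num))
  have hz := (isOpen_halfLine s).ae_eq_zero_of_integral_contDiff_smul_eq_zero hloc
    fun g hg hgc hgs => by
      have ht : IsTest s (fun x => (g x : ℂ)) := by
        refine ⟨Complex.ofRealCLM.contDiff.comp hg,
          hgc.comp_left (g := fun r : ℝ => (r : ℂ)) Complex.ofReal_zero, ?_⟩
        exact (closure_mono (Function.support_comp_subset Complex.ofReal_zero g)).trans hgs
      have h := hu _ (mem_halfOp_domain_of_isTest ht α k)
      rw [inner_halfSpace] at h
      rw [← h, ← setIntegral_eq_integral_of_forall_compl_eq_zero (s := halfLine s)]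
      · refine integral_congr_ae ?_
        filter_upwards [ht.memLp.coeFn_toLp] with x hx
        rw [hx, Complex.conj_ofReal, Complex.real_smul, mul_comm]
      · intro x hx
        rw [image_eq_zero_of_notMem_tsupport fun h => hx (hgs h), zero_smul]
  refine Lp.ext ?_
  refine EventuallyEq.trans ?_ (Lp.coeFn_zero _ _ _).symm
  rw [EventuallyEq, ae_restrict_iff' (isOpen_halfLine s).measurableSet]
  exact hz

/-- The adjoint of the half-line operator is the maximal operator. -/
theorem mem_halfOp_adjoint_graph {u v : HalfSpace s} :
    (u, v) ∈ (halfOp α k s)†.graph ↔ IsWeakDiffExpr α k s u v := by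
  rw [LinearPMap.adjoint_graph_eq_graph_adjoint (halfOp_dense α k s), halfOp_graph,
    Submodule.mem_adjoint_iff]
  have key : ∀ f, IsTest s f → ∀ a b : HalfSpace s, a =ᵐ[sideMeasure s] f →
      b =ᵐ[sideMeasure s] diffExpr α k f → ⟪b, u⟫_ℂ - ⟪a, v⟫_ℂ =
        (∫ x in halfLine s, u x * diffExpr α k (fun y => (starRingEnd ℂ) (f y)) x) -
        ∫ x in halfLine s, v x * (starRingEnd ℂ) (f x) := by
    intro f hf a b ha hb
    rw [inner_halfSpace, inner_halfSpace]
    congr 1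
    · refine integral_congr_ae ?_
      filter_upwards [hb] with x hx
      rw [hx, diffExpr_conj]
    · refine integral_congr_ae ?_
      filter_upwards [ha] with x hx
      rw [hx]
  constructor
  · intro h f hf
    have e := h _ _ (hf.conj.toLp_mem_minimalGraph α k)
    rw [key _ hf.conj _ _ hf.conj.memLp.coeFn_toLp
      (hf.conj.memLp_diffExpr α k).coeFn_toLp] at e
    simp only [Complex.conj_conj] at e
    exact (sub_eq_zero.1 e).symm
  · rintro h a b ⟨f, hf, ha, hb⟩
    rw [key f hf a b ha hb, sub_eq_zero]
    exact (h _ hf.conj).symm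

theorem isWeakDiffExpr_of_test {f : ℝ → ℂ} (hf : IsTest s f) {u v : HalfSpace s}
    (hu : u =ᵐ[sideMeasure s] f) (hv : v =ᵐ[sideMeasure s] diffExpr α k f) :
    IsWeakDiffExpr α k s u v := by
  have ht := hf.flip_to_plus
  have W : WeakPair α k (fun x => f (flip s x)) (diffExpr α k fun x => f (flip s x)) := by
    refine .of_isPrimitive (ht.memLp) (ht.memLp_diffExpr α k) ht.isPrimitive
      (ht.deriv.isPrimitive.congr (fun _ _ => rfl) (ae_of_all _ fun x => ?_))
    simp only [diffExpr]
    ring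
  rw [isWeakDiffExpr_iff_weakPair]
  have eu := (measurePreserving_flip s).quasiMeasurePreserving.ae_eq_comp hu
  have ev := (measurePreserving_flip s).quasiMeasurePreserving.ae_eq_comp hv
  refine ⟨W.memLp.ae_eq eu.symm, W.memLp'.ae_eq (ev.trans ?_).symm, fun g hg => ?_⟩
  · exact ae_of_all _ fun x => (diffExpr_comp_flip α k s f x).symm
  · have e := W.integral_eq g hg
    have e1 : ∫ x in Set.Ioi 0, v (flip s x) * g x =
        ∫ x in Set.Ioi 0, diffExpr α k (fun x => f (flip s x)) x * g x := by
      refine integral_congr_ae ?_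
      filter_upwards [ev] with x hx
      simp only [Function.comp_def] at hx
      rw [hx, diffExpr_comp_flip]
    have e2 : ∫ x in Set.Ioi 0, u (flip s x) * diffExpr α k g x =
        ∫ x in Set.Ioi 0, f (flip s x) * diffExpr α k g x := by
      refine integral_congr_ae ?_
      filter_upwards [eu] with x hx
      simp only [Function.comp_def] at hx
      rw [hx]
    rw [e1, e2, e]

theorem halfOp_le_adjoint (α : ℝ) (k : ℤ) (s : Side) : halfOp α k s ≤ (halfOp α k s)† := by
  refine LinearPMap.le_of_le_graph ?_
  rw [halfOp_graph]
  rintro ⟨u, v⟩ ⟨f, hf, hu, hv⟩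
  exact mem_halfOp_adjoint_graph.2 (isWeakDiffExpr_of_test hf hu hv)

theorem IsWeakDiffExpr.add {u v u' v' : HalfSpace s} (h : IsWeakDiffExpr α k s u v)
    (h' : IsWeakDiffExpr α k s u' v') : IsWeakDiffExpr α k s (u + u') (v + v') := by
  rw [← mem_halfOp_adjoint_graph] at *
  exact Submodule.add_mem _ h h'

theorem IsWeakDiffExpr.sub {u v u' v' : HalfSpace s} (h : IsWeakDiffExpr α k s u v)
    (h' : IsWeakDiffExpr α k s u' v') : IsWeakDiffExpr α k s (u - u') (v - v') := by
  rw [← mem_halfOp_adjoint_graph] at *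
  exact Submodule.sub_mem _ h h'

theorem IsWeakDiffExpr.smul {u v : HalfSpace s} (c : ℂ) (h : IsWeakDiffExpr α k s u v) :
    IsWeakDiffExpr α k s (c • u) (c • v) := by
  rw [← mem_halfOp_adjoint_graph] at *
  exact Submodule.smul_mem _ c h

/-- The singular part with prescribed coefficients, as a vector of the adjoint domain. -/
theorem exists_singularPart (hα₀ : 0 ≤ α) (hα₁ : α < 1) (k : ℤ) {P : ℝ → ℂ} (hP : ContDiff ℝ ∞ P)
    (hPc : HasCompactSupport P) (hP₀ : P 0 = 1) (hP₁ : deriv P 0 = 0) (s : Side) (c₀ c₁ : ℂ) :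
    ∃ u v : HalfSpace s, IsContinuousRep s (singularPart α P c₀ c₁) u ∧
      IsWeakDiffExpr α k s u v ∧ HasCoeffs α s u c₀ c₁ := by
  obtain ⟨u, v, hu, huv, ou⟩ := exists_singular_vector hα₀ k hP hPc hP₀ hP₁ s
    (m := -(α / 2)) (by linarith) (exponent_sol₀ α)
  obtain ⟨u', v', hu', huv', ou'⟩ := exists_singular_vector hα₀ k hP hPc hP₀ hP₁ s
    (m := 1 + α / 2) (by linarith) (exponent_sol₁ α)
  have rep : IsContinuousRep s (singularPart α P c₀ c₁) (c₀ • u + c₁ • u') := by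
    refine ⟨((hu.1.const_smul c₀).add (hu'.1.const_smul c₁)).congr fun x _ => ?_, ?_⟩
    · simp only [singularPart, absPow, Pi.add_apply, Pi.smul_apply, smul_eq_mul]; ring
    · filter_upwards [Lp.coeFn_add (c₀ • u) (c₁ • u'), Lp.coeFn_smul c₀ u, Lp.coeFn_smul c₁ u',
        hu.2, hu'.2] with x e1 e2 e3 e4 e5
      rw [e1, Pi.add_apply, e2, e3, Pi.smul_apply, Pi.smul_apply, e4, e5]
      simp only [singularPart, absPow, smul_eq_mul]; ring
  refine ⟨c₀ • u + c₁ • u', c₀ • v + c₁ • v', rep, (huv.smul c₀).add (huv'.smul c₁), _, rep, ?_⟩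
  rw [hasShortRange_iff_flip, hasShortRange_plus_iff hα₀ hα₁]
  refine ((ou.const_mul_left c₀).add (ou'.const_mul_left c₁)).congr_left fun x => ?_
  simp only [singularPart, absPow, abs_flip]
  ring

/-- The descriptions of the closure and of the form domain do not involve a cut-off; their proofs
use this auxiliary one. -/
theorem exists_cutoff : ∃ P : ℝ → ℂ, ContDiff ℝ ∞ P ∧ HasCompactSupport P ∧ P 0 = 1 ∧
    deriv P 0 = 0 := by
  obtain ⟨f⟩ : Nonempty (ContDiffBump (0 : ℝ)) := inferInstance
  refine ⟨fun x => (f x : ℂ), Complex.ofRealCLM.contDiff.comp f.contDiff,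
    f.hasCompactSupport.comp_left (g := fun r : ℝ => (r : ℂ)) Complex.ofReal_zero, ?_, ?_⟩
  · simp [f.one_of_mem_closedBall (Metric.mem_closedBall_self f.rIn_pos.le)]
  · have : (fun x => (f x : ℂ)) =ᶠ[𝓝 0] fun _ => (1 : ℂ) := by
      filter_upwards [f.eventuallyEq_one] with x hx
      rw [hx]; simp
    rw [this.deriv_eq]
    simp

theorem one_add_ne_zero (hα₀ : 0 ≤ α) : (1 + α : ℂ) ≠ 0 := by
  have : (1 + α : ℝ) ≠ 0 := by positivity
  exact_mod_cast this

/-- The closure of the half-line operator consists of the elements of the graph of the adjoint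
with vanishing coefficients. -/
theorem mem_topologicalClosure_minimalGraph (hα₀ : 0 ≤ α) (hα₁ : α < 1) {u v : HalfSpace s} :
    (u, v) ∈ (minimalGraph α k s).topologicalClosure ↔
      IsWeakDiffExpr α k s u v ∧ HasCoeffs α s u 0 0 := by
  constructor
  · intro h
    have hcl : (minimalGraph α k s).topologicalClosure ≤ (halfOp α k s)†.graph := by
      refine Submodule.topologicalClosure_minimal _ ?_
        (LinearPMap.adjoint_isClosed (halfOp_dense α k s))
      rw [← halfOp_graph]
      exact LinearPMap.le_graph_of_le (halfOp_le_adjoint α k s)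
    have hw := mem_halfOp_adjoint_graph.1 (hcl h)
    refine ⟨hw, ?_⟩
    -- Pairing with a fixed maximal vector is a closed condition that holds on the minimal graph,
    -- hence on its closure. Maximal vectors with coefficients (1, 0) and (0, 1) then force `c₁ = 0`
    -- and `c₀ = 0` through Green's formula.
    have hsymp : ∀ a b : HalfSpace s, IsWeakDiffExpr α k s a b →
        ⟪a, v⟫_ℂ - ⟪b, u⟫_ℂ = 0 := by
      intro a b hab
      have hc : IsClosed {p : HalfSpace s × HalfSpace s | ⟪a, p.2⟫_ℂ - ⟪b, p.1⟫_ℂ = 0} :=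
        isClosed_eq (by fun_prop) continuous_const
      refine closure_minimal (fun p hp => ?_) hc h
      have h1 := mem_halfOp_adjoint_graph.2 hab
      rw [LinearPMap.adjoint_graph_eq_graph_adjoint (halfOp_dense α k s), halfOp_graph,
        Submodule.mem_adjoint_iff] at h1
      have h2 := h1 _ _ hp
      have h3 := congrArg (starRingEnd ℂ) h2
      rw [map_sub, inner_conj_symm, inner_conj_symm, map_zero] at h3
      exact h3
    obtain ⟨c₀, c₁, hc⟩ := hw.exists_hasCoeffs hα₀ hα₁
    obtain ⟨P, hP, hPc, hP₀, hP₁⟩ := exists_cutoff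
    obtain ⟨a, b, -, hab, hca⟩ := exists_singularPart hα₀ hα₁ k hP hPc hP₀ hP₁ s 1 0
    obtain ⟨a', b', -, hab', hca'⟩ := exists_singularPart hα₀ hα₁ k hP hPc hP₀ hP₁ s 0 1
    have e1 := hw.green hα₀ hα₁ hab hc hca
    have e2 := hw.green hα₀ hα₁ hab' hc hca'
    rw [hsymp _ _ hab] at e1
    rw [hsymp _ _ hab'] at e2
    have hne := one_add_ne_zero hα₀
    have z1 : c₁ = 0 := by simpa [hne] using e1.symm
    have z0 : c₀ = 0 := by simpa [hne] using e2.symm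
    rwa [z0, z1] at hc
  · rintro ⟨hw, hc⟩
    -- Conversely, if both coefficients vanish, Green's formula against any maximal vector has no
    -- boundary term, so (u, v) lies in the double adjoint.
    refine mem_topologicalClosure_of_mem_adjoint_adjoint ?_
    rw [Submodule.mem_adjoint_iff]
    intro a b hab
    rw [← halfOp_graph, ← LinearPMap.adjoint_graph_eq_graph_adjoint (halfOp_dense α k s)] at hab
    have hab := mem_halfOp_adjoint_graph.1 hab
    obtain ⟨d₀, d₁, hd⟩ := hab.exists_hasCoeffs hα₀ hα₁
    have e := hw.green hα₀ hα₁ hab hc hd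
    simp only [zero_mul, sub_zero, mul_zero] at e
    rw [← neg_eq_zero, neg_sub]
    exact e

end HalfLine

/-! ### The second-order a priori estimate -/

theorem hasDerivAt_potential {α : ℝ} {k : ℤ} {x : ℝ} (hx : 0 < x) :
    HasDerivAt (potential α k)
      (k ^ 2 * (2 * α * x ^ (2 * α - 1)) - 2 * (α * (2 + α) / 4) / x ^ 3) x := by
  have h1 : HasDerivAt (fun y : ℝ => (k : ℝ) ^ 2 * y ^ (2 * α) + (α * (2 + α) / 4) * (y ^ 2)⁻¹)
      (k ^ 2 * (2 * α * x ^ (2 * α - 1)) + (α * (2 + α) / 4) * (-(2 * x) / (x ^ 2) ^ 2)) x := by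
    have h := ((hasDerivAt_pow 2 x).fun_inv (by positivity : x ^ 2 ≠ 0)).const_mul (α * (2 + α) / 4)
    have h' := (Real.hasDerivAt_rpow_const (x := x) (p := 2 * α) (Or.inl hx.ne')).const_mul
      ((k : ℝ) ^ 2)
    refine (h'.add h).congr_deriv ?_
    push_cast
    ring
  have h2 := h1.congr_of_eventuallyEq (f₁ := potential α k) (by
    filter_upwards [Ioi_mem_nhds hx] with y (hy : 0 < y)
    simp only [potential, abs_of_pos hy]
    field_simp)
  refine h2.congr_deriv ?_
  field_simp
  ring

/-- The derivative of the potential on `(0, ∞)`. -/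
def potentialDeriv (α : ℝ) (k : ℤ) (x : ℝ) : ℝ :=
  k ^ 2 * (2 * α * x ^ (2 * α - 1)) - 2 * (α * (2 + α) / 4) / x ^ 3

theorem hasDerivAt_potentialDeriv {α : ℝ} {k : ℤ} {x : ℝ} (hx : 0 < x) :
    HasDerivAt (potentialDeriv α k) (k ^ 2 * (2 * α * ((2 * α - 1) * x ^ (2 * α - 2))) +
      6 * (α * (2 + α) / 4) / x ^ 4) x := by
  have h1 := ((Real.hasDerivAt_rpow_const (x := x) (p := 2 * α - 1) (Or.inl hx.ne')).const_mul
    (2 * α)).const_mul ((k : ℝ) ^ 2)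
  have h2 := ((hasDerivAt_pow 3 x).fun_inv (by positivity : x ^ 3 ≠ 0)).const_mul
    (2 * (α * (2 + α) / 4))
  have h3 := h1.sub h2
  have e : potentialDeriv α k =
      (fun y : ℝ => (k : ℝ) ^ 2 * (2 * α * y ^ (2 * α - 1))) -
        fun y : ℝ => 2 * (α * (2 + α) / 4) * (y ^ 3)⁻¹ := by
    funext y
    simp [potentialDeriv, div_eq_mul_inv]
  rw [e]
  refine h3.congr_deriv ?_
  rw [show 2 * α - 1 - 1 = 2 * α - 2 by ring]
  field_simp
  push_cast
  ring

theorem rpow_le_one_add_inv_sq {α : ℝ} (hα₀ : 0 ≤ α) (hα₁ : α < 1) {x : ℝ} (hx : 0 < x) :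
    x ^ (2 * α - 2) ≤ 1 + (x ^ 2)⁻¹ := by
  rcases le_total 1 x with h | h
  · have := Real.rpow_le_one_of_one_le_of_nonpos h (by linarith : 2 * α - 2 ≤ 0)
    have : 0 ≤ (x ^ 2)⁻¹ := by positivity
    linarith
  · have h1 := Real.rpow_le_rpow_of_exponent_ge hx h (by linarith : -2 ≤ 2 * α - 2)
    rw [Real.rpow_neg hx.le, Real.rpow_two] at h1
    linarith

/-- The pointwise inequality behind the second-order estimate; the right-hand side differs from
the left-hand side by a sum of squares. Here `c` is the coefficient of `x⁻²` and `d2` stands for the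
second derivative of the potential. -/
theorem pointwise_second_order {c ε K x W u u' u'' V V' w2 : ℝ} (hx : 0 < x) (hc : 0 ≤ c)
    (hε₁ : ε ≤ 1) (hW : 0 ≤ W) (hV : V = W + c / x ^ 2)
    (hw : w2 ≤ ((c - 3 / 4) ^ 2 - 9 / 16 * ε) / x ^ 4 + K) :
    ε * u'' ^ 2 + ((-2 * (u'' * u * V + u' * u' * V + u' * u * V') +
      (2 * u * u' * V' + u ^ 2 * (w2 + 6 * c / x ^ 4))) +
      (1 - ε) / 2 * (2 * u' * u'' / x - u' ^ 2 / x ^ 2) +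
      3 * ((1 - ε) / 4 + 2 * c) / 2 * (2 * u * u' / x ^ 3 - 3 * u ^ 2 / x ^ 4)) ≤
      (V * u - u'') ^ 2 + K * u ^ 2 := by
  have hδ : 0 ≤ (1 - ε) / 4 + 2 * c := by linarith
  have s1 : 0 ≤ (1 - ε) * (u'' - u' / (2 * x)) ^ 2 := mul_nonneg (by linarith) (sq_nonneg _)
  have s2 : 0 ≤ ((1 - ε) / 4 + 2 * c) * ((u' - 3 * u / (2 * x)) / x) ^ 2 :=
    mul_nonneg hδ (sq_nonneg _)
  have s3 : 0 ≤ 2 * W * u' ^ 2 := by positivity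
  have s4 : 0 ≤ (2 * W * (c / x ^ 2) + W ^ 2) * u ^ 2 := by positivity
  have s5 : 0 ≤ (((c - 3 / 4) ^ 2 - 9 / 16 * ε) / x ^ 4 + K - w2) * u ^ 2 :=
    mul_nonneg (by linarith) (sq_nonneg _)
  have id : (V * u - u'') ^ 2 + K * u ^ 2 - (ε * u'' ^ 2 +
      ((-2 * (u'' * u * V + u' * u' * V + u' * u * V') +
      (2 * u * u' * V' + u ^ 2 * (w2 + 6 * c / x ^ 4))) +
      (1 - ε) / 2 * (2 * u' * u'' / x - u' ^ 2 / x ^ 2) +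
      3 * ((1 - ε) / 4 + 2 * c) / 2 * (2 * u * u' / x ^ 3 - 3 * u ^ 2 / x ^ 4))) =
      (1 - ε) * (u'' - u' / (2 * x)) ^ 2 +
      ((1 - ε) / 4 + 2 * c) * ((u' - 3 * u / (2 * x)) / x) ^ 2 + 2 * W * u' ^ 2 +
      (2 * W * (c / x ^ 2) + W ^ 2) * u ^ 2 +
      (((c - 3 / 4) ^ 2 - 9 / 16 * ε) / x ^ 4 + K - w2) * u ^ 2 := by
    rw [hV]
    field_simp
    ring
  linarith

theorem continuousOn_potential (α : ℝ) (k : ℤ) : ContinuousOn (potential α k) (Set.Ioi 0) :=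
  fun _ hx => (hasDerivAt_potential hx).continuousAt.continuousWithinAt

/-- Expanding ∫ (Vu - u'')² and integrating the cross term by parts gives ∫ u''² + V²u² + 2Vu'² -
V''u². The only dangerous part is V'' ~ 6c/x⁴. Hardy's inequality for u and for u' supplies ∫ u''² ≥
(9/16) ∫ u²/x⁴ and ∫ u'²/x² ≥ (9/4) ∫ u²/x⁴, and the resulting coefficient of u²/x⁴ is c² + 9c/2 -
6c + 9/16 = (c - 3/4)². -/
theorem exists_real_second_order_bound {α : ℝ} (hα₀ : 0 ≤ α) (hα₁ : α < 1) (k : ℤ) :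
    ∃ ε K : ℝ, 0 < ε ∧ 0 ≤ K ∧ ∀ (u u' u'' : ℝ → ℝ) (a b : ℝ), 0 < a → a ≤ b →
      (∀ x, HasDerivAt u (u' x) x) → (∀ x, HasDerivAt u' (u'' x) x) → Continuous u'' →
      u a = 0 → u b = 0 → u' a = 0 → u' b = 0 →
      ε * ∫ x in a..b, u'' x ^ 2 ≤
        (∫ x in a..b, (potential α k x * u x - u'' x) ^ 2) + K * ∫ x in a..b, u x ^ 2 := by
  set c : ℝ := α * (2 + α) / 4 with hc
  have hc0 : 0 ≤ c := by positivity
  -- For α ≥ 0 this is equivalent to α < 1. It makes the Rellich constant (c - 3/4)² positive; that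
  -- constant is taken for `ε`.
  have hc1 : c < 3 / 4 := by rw [hc]; nlinarith
  set ε : ℝ := (c - 3 / 4) ^ 2
  have hε : 0 < ε := by have : c - 3 / 4 ≠ 0 := by linarith
                        positivity
  have hε1 : ε ≤ 1 := by simp only [ε]; nlinarith
  -- Keeping ε ∫ u''² on the left costs (9/16) ε in the coefficient of u²/x⁴. The remaining (7/16) ε
  -- absorbs the second derivative of k²|x|^{2α}.
  set η : ℝ := 7 / 16 * ε
  have hη : 0 < η := by positivity
  -- The constant comes from k² (x^{2α})'' ≤ 2k² (1 + x⁻²) together with 2k² x⁻² ≤ η x⁻⁴ + k⁴/η.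
  refine ⟨ε, 2 * k ^ 2 + k ^ 4 / η, hε, by positivity, ?_⟩
  intro u u' u'' a b ha hab hu hu' cu'' ua ub ua' ub'
  set K : ℝ := 2 * k ^ 2 + k ^ 4 / η
  have cu : Continuous u := continuous_iff_continuousAt.2 fun x => (hu x).continuousAt
  have cu' : Continuous u' := continuous_iff_continuousAt.2 fun x => (hu' x).continuousAt
  set w2 : ℝ → ℝ := fun x => k ^ 2 * (2 * α * ((2 * α - 1) * x ^ (2 * α - 2)))
  -- `B` vanishes at both ends, so its derivative integrates to zero and may be added freely. The
  -- first bracket integrates -2Vuu'' by parts; the terms in u'²/x and u²/x³ complete the squares of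
  -- the two Hardy inequalities.
  set B : ℝ → ℝ := fun x => (-2 * (u' x * u x * potential α k x) + u x ^ 2 * potentialDeriv α k x) +
    (1 - ε) / 2 * (u' x ^ 2 * x⁻¹) + 3 * ((1 - ε) / 4 + 2 * c) / 2 * (u x ^ 2 * (x ^ 3)⁻¹)
  set B' : ℝ → ℝ := fun x => ((-2 * (u'' x * u x * potential α k x + u' x * u' x * potential α k x +
      u' x * u x * potentialDeriv α k x) +
      (2 * u x * u' x * potentialDeriv α k x + u x ^ 2 * (w2 x + 6 * c / x ^ 4))) +
      (1 - ε) / 2 * (2 * u' x * u'' x / x - u' x ^ 2 / x ^ 2) +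
      3 * ((1 - ε) / 4 + 2 * c) / 2 * (2 * u x * u' x / x ^ 3 - 3 * u x ^ 2 / x ^ 4))
  have pos : ∀ x ∈ Set.uIcc a b, 0 < x := fun x hx => uIcc_subset_Ioi ha (ha.trans_le hab) hx
  have hB : ∀ x ∈ Set.uIcc a b, HasDerivAt B (B' x) x := by
    intro x hx
    have hx0 := pos x hx
    have d1 := (((hu' x).mul (hu x)).mul (hasDerivAt_potential (α := α) (k := k) hx0)).const_mul (-2)
    have d2 := ((hu x).pow 2).mul (hasDerivAt_potentialDeriv (α := α) (k := k) hx0)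
    have d3 := (((hu' x).pow 2).mul (hasDerivAt_inv hx0.ne')).const_mul ((1 - ε) / 2)
    have d4 := (((hu x).pow 2).mul ((hasDerivAt_pow 3 x).fun_inv
      (by positivity : x ^ 3 ≠ 0))).const_mul (3 * ((1 - ε) / 4 + 2 * c) / 2)
    have d := ((d1.add d2).add d3).add d4
    refine d.congr_deriv ?_
    simp only [Pi.mul_apply, Pi.pow_apply, B', w2, potentialDeriv, ← hc]
    push_cast
    field_simp
    ring
  have cpot := (continuousOn_potential α k).mono pos
  have cpot' : ContinuousOn (potentialDeriv α k) (Set.uIcc a b) := fun x hx =>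
    (hasDerivAt_potentialDeriv (pos x hx)).continuousAt.continuousWithinAt
  have cw2 : ContinuousOn w2 (Set.uIcc a b) := by
    refine continuousOn_const.mul (continuousOn_const.mul (continuousOn_const.mul ?_))
    exact continuousOn_id.rpow_const fun x hx => Or.inl (pos x hx).ne'
  have cdiv : ∀ (r : ℝ) (n : ℕ), ContinuousOn (fun x : ℝ => r / x ^ n) (Set.uIcc a b) := fun r n =>
    continuousOn_const.div (by fun_prop) fun x hx => (pow_pos (pos x hx) n).ne'
  have cB' : ContinuousOn B' (Set.uIcc a b) := by
    have q1 := cu.continuousOn (s := Set.uIcc a b)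
    have q2 := cu'.continuousOn (s := Set.uIcc a b)
    have q3 := cu''.continuousOn (s := Set.uIcc a b)
    have hne : ∀ x ∈ Set.uIcc a b, x ≠ 0 := fun x hx => (pos x hx).ne'
    have hne2 : ∀ n : ℕ, ∀ x ∈ Set.uIcc a b, x ^ n ≠ 0 := fun n x hx => (pow_pos (pos x hx) n).ne'
    refine ContinuousOn.add (ContinuousOn.add (ContinuousOn.add ?_ ?_) ?_) ?_
    · fun_prop
    · exact ((continuousOn_const.mul q1).mul q2 |>.mul cpot').add
        ((q1.pow 2).mul (cw2.add (cdiv _ 4)))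
    · exact continuousOn_const.mul ((((continuousOn_const.mul q2).mul q3).div continuousOn_id hne).sub
        ((q2.pow 2).div (continuousOn_id.pow 2) (hne2 2)))
    · exact continuousOn_const.mul ((((continuousOn_const.mul q1).mul q2).div
        (continuousOn_id.pow 3) (hne2 3)).sub
        ((continuousOn_const.mul (q1.pow 2)).div (continuousOn_id.pow 4) (hne2 4)))
  have iB := intervalIntegral.integral_eq_sub_of_hasDerivAt hB cB'.intervalIntegrable
  have B0 : B b - B a = 0 := by simp [B, ua, ub, ua', ub']
  rw [B0] at iB
  have i1 : IntervalIntegrable (fun x => ε * u'' x ^ 2) volume a b :=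
    Continuous.intervalIntegrable (by fun_prop) _ _
  have i2 : IntervalIntegrable (fun x => (potential α k x * u x - u'' x) ^ 2) volume a b :=
    (((cpot.mul cu.continuousOn).sub cu''.continuousOn).pow 2).intervalIntegrable
  have i3 : IntervalIntegrable (fun x => K * u x ^ 2) volume a b :=
    Continuous.intervalIntegrable (by fun_prop) _ _
  have main := intervalIntegral.integral_mono_on hab (i1.add cB'.intervalIntegrable) (i2.add i3)
    fun x hx => ?_
  · rw [intervalIntegral.integral_add i1 cB'.intervalIntegrable, intervalIntegral.integral_add i2 i3,
      iB, add_zero, intervalIntegral.integral_const_mul, intervalIntegral.integral_const_mul] at main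
    exact main
  · have hx0 : 0 < x := ha.trans_le hx.1
    refine pointwise_second_order (W := k ^ 2 * |x| ^ (2 * α)) hx0 hc0 hε1 (by positivity) ?_ ?_
    · simp only [potential, hc]
      field_simp
    · have e1 : (c - 3 / 4) ^ 2 - 9 / 16 * ε = η := by simp only [η, ε]; ring
      rw [e1]
      have hr := rpow_le_one_add_inv_sq hα₀ hα₁ hx0
      have hr0 : 0 ≤ x ^ (2 * α - 2) := Real.rpow_nonneg hx0.le _
      have hk : (0 : ℝ) ≤ (k : ℝ) ^ 2 := sq_nonneg _
      have t1 : w2 x ≤ 2 * k ^ 2 * (1 + (x ^ 2)⁻¹) := by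
        have h2 : 2 * α * (2 * α - 1) ≤ 2 := by nlinarith
        calc w2 x = k ^ 2 * (2 * α * (2 * α - 1)) * x ^ (2 * α - 2) := by simp only [w2]; ring
          _ ≤ k ^ 2 * 2 * x ^ (2 * α - 2) := by gcongr
          _ ≤ k ^ 2 * 2 * (1 + (x ^ 2)⁻¹) := by gcongr
          _ = _ := by ring
      have t2 : 2 * (k : ℝ) ^ 2 * (x ^ 2)⁻¹ ≤ η * ((x ^ 2)⁻¹) ^ 2 + k ^ 4 / η := by
        have h3 : 0 ≤ η * ((x ^ 2)⁻¹ - k ^ 2 / η) ^ 2 := by positivity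
        have h4 : η * ((x ^ 2)⁻¹ - k ^ 2 / η) ^ 2 =
            η * ((x ^ 2)⁻¹) ^ 2 + k ^ 4 / η - 2 * (k : ℝ) ^ 2 * (x ^ 2)⁻¹ := by
          field_simp; ring
        linarith
      have e2 : η / x ^ 4 = η * ((x ^ 2)⁻¹) ^ 2 := by field_simp
      rw [e2]
      simp only [K]
      linarith

theorem norm_sq_halfSpace {s : Side} (u : HalfSpace s) :
    ‖u‖ ^ 2 = ∫ x in halfLine s, ‖u x‖ ^ 2 := by
  have h := inner_halfSpace u u
  rw [inner_self_eq_norm_sq_to_K] at h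
  have e : ∀ x, u x * (starRingEnd ℂ) (u x) = ((‖u x‖ ^ 2 : ℝ) : ℂ) := fun x => by
    rw [Complex.mul_conj, Complex.normSq_eq_norm_sq]
  simp only [e, integral_complex_ofReal] at h
  have h' : (((‖u‖ ^ 2 : ℝ)) : ℂ) = ((∫ x in halfLine s, ‖u x‖ ^ 2 : ℝ) : ℂ) := by
    rw [← h]; push_cast; rfl
  exact_mod_cast h'

theorem integral_flip_real (s : Side) (f : ℝ → ℝ) :
    ∫ x in Set.Ioi 0, f (flip s x) = ∫ x in halfLine s, f x :=
  (measurePreserving_flip s).integral_comp (flipHomeomorph s).measurableEmbedding f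

theorem IsTest.second_order_bound_plus {α : ℝ} {k : ℤ} {ε K : ℝ}
    (H : ∀ (u u' u'' : ℝ → ℝ) (a b : ℝ), 0 < a → a ≤ b →
      (∀ x, HasDerivAt u (u' x) x) → (∀ x, HasDerivAt u' (u'' x) x) → Continuous u'' →
      u a = 0 → u b = 0 → u' a = 0 → u' b = 0 →
      ε * ∫ x in a..b, u'' x ^ 2 ≤
        (∫ x in a..b, (potential α k x * u x - u'' x) ^ 2) + K * ∫ x in a..b, u x ^ 2)
    {f : ℝ → ℂ} (hf : IsTest .plus f) :
    ε * ∫ x in Set.Ioi 0, ‖_root_.deriv (_root_.deriv f) x‖ ^ 2 ≤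
      (∫ x in Set.Ioi 0, ‖diffExpr α k f x‖ ^ 2) + K * ∫ x in Set.Ioi 0, ‖f x‖ ^ 2 := by
  obtain ⟨a, b, ha, hab, hs⟩ := hf.exists_Ioo
  have hz : ∀ x, x ∉ Set.Ioo a b → f x = 0 ∧ _root_.deriv f x = 0 ∧
      _root_.deriv (_root_.deriv f) x = 0 :=
    fun x hx => ⟨eq_zero_of_tsupport_subset hs hx, deriv_eq_zero_of_tsupport_subset hs hx,
      deriv_deriv_eq_zero_of_tsupport_subset hs hx⟩
  have red : ∀ F : ℝ → ℝ, (∀ x, x ∉ Set.Ioo a b → F x = 0) →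
      ∫ x in Set.Ioi 0, F x = ∫ x in a..b, F x := by
    intro F hF
    rw [intervalIntegral.integral_of_le hab.le]
    exact (setIntegral_eq_of_subset_of_forall_sdiff_eq_zero measurableSet_Ioi
      (fun x hx => ha.trans hx.1) fun x hx => hF x fun h => hx.2 (Set.Ioo_subset_Ioc_self h))
  have za := hz a (by simp)
  have zb := hz b (by simp)
  have c2 : Continuous (_root_.deriv (_root_.deriv f)) := hf.deriv.deriv.continuous
  have cf := hf.continuous
  have hr := H (fun x => (f x).re) (fun x => (_root_.deriv f x).re)
    (fun x => (_root_.deriv (_root_.deriv f) x).re) a b ha hab.le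
    (fun x => Complex.reCLM.hasFDerivAt.comp_hasDerivAt x (hf.hasDerivAt x))
    (fun x => Complex.reCLM.hasFDerivAt.comp_hasDerivAt x (hf.deriv.hasDerivAt x))
    (by fun_prop) (by simp [za]) (by simp [zb]) (by simp [za]) (by simp [zb])
  have hi := H (fun x => (f x).im) (fun x => (_root_.deriv f x).im)
    (fun x => (_root_.deriv (_root_.deriv f) x).im) a b ha hab.le
    (fun x => Complex.imCLM.hasFDerivAt.comp_hasDerivAt x (hf.hasDerivAt x))
    (fun x => Complex.imCLM.hasFDerivAt.comp_hasDerivAt x (hf.deriv.hasDerivAt x))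
    (by fun_prop) (by simp [za]) (by simp [zb]) (by simp [za]) (by simp [zb])
  have nsq : ∀ z : ℂ, ‖z‖ ^ 2 = z.re ^ 2 + z.im ^ 2 := fun z => by
    rw [← Complex.normSq_eq_norm_sq, Complex.normSq_apply]; ring
  have cpot : ContinuousOn (potential α k) (Set.uIcc a b) :=
    (continuousOn_potential α k).mono (uIcc_subset_Ioi ha (ha.trans hab))
  rw [red _ fun x hx => by simp [(hz x hx).2.2],
    red _ fun x hx => by simp [diffExpr, (hz x hx).2.2, (hz x hx).1],
    red _ fun x hx => by simp [(hz x hx).1]]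
  simp only [nsq]
  have eD : ∀ x, (diffExpr α k f x).re =
      potential α k x * (f x).re - (_root_.deriv (_root_.deriv f) x).re ∧
      (diffExpr α k f x).im =
      potential α k x * (f x).im - (_root_.deriv (_root_.deriv f) x).im := fun x => by
    simp only [diffExpr, Complex.add_re, Complex.add_im, Complex.neg_re, Complex.neg_im,
      Complex.re_ofReal_mul, Complex.im_ofReal_mul]
    constructor <;> ring
  simp only [fun x => (eD x).1, fun x => (eD x).2]
  have cre : ∀ {g : ℝ → ℂ}, Continuous g → Continuous fun x => (g x).re := fun h => by fun_prop
  have cim : ∀ {g : ℝ → ℂ}, Continuous g → Continuous fun x => (g x).im := fun h => by fun_prop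
  have add_sq : ∀ F G : ℝ → ℝ, ContinuousOn F (Set.uIcc a b) → ContinuousOn G (Set.uIcc a b) →
      ∫ x in a..b, (F x ^ 2 + G x ^ 2) = (∫ x in a..b, F x ^ 2) + ∫ x in a..b, G x ^ 2 :=
    fun F G hF hG => intervalIntegral.integral_add (hF.pow 2).intervalIntegrable
      (hG.pow 2).intervalIntegrable
  rw [add_sq _ _ (cre c2).continuousOn (cim c2).continuousOn,
    add_sq _ _ (cre cf).continuousOn (cim cf).continuousOn,
    add_sq (fun x => potential α k x * (f x).re - (_root_.deriv (_root_.deriv f) x).re)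
      (fun x => potential α k x * (f x).im - (_root_.deriv (_root_.deriv f) x).im)
      ((cpot.mul (cre cf).continuousOn).sub (cre c2).continuousOn)
      ((cpot.mul (cim cf).continuousOn).sub (cim c2).continuousOn)]
  linarith

theorem IsTest.integral_norm_deriv_sq_plus {f : ℝ → ℂ} (hf : IsTest .plus f) :
    ((∫ x in Set.Ioi 0, ‖_root_.deriv f x‖ ^ 2 : ℝ) : ℂ) =
      ∫ x in Set.Ioi 0, -(_root_.deriv (_root_.deriv f) x) * (starRingEnd ℂ) (f x) := by
  obtain ⟨a, b, ha, hab, hs⟩ := hf.exists_Ioo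
  have hz : ∀ x, x ∉ Set.Ioo a b → f x = 0 ∧ _root_.deriv f x = 0 ∧
      _root_.deriv (_root_.deriv f) x = 0 :=
    fun x hx => ⟨eq_zero_of_tsupport_subset hs hx, deriv_eq_zero_of_tsupport_subset hs hx,
      deriv_deriv_eq_zero_of_tsupport_subset hs hx⟩
  have hp := hf.deriv.isPrimitive.mul hf.conj.isPrimitive
  have h0 := hp.integral_Ioi_eq_zero ha hab.le (by simp [hz a (by simp)])
    (by simp [hz b (by simp)]) fun x hx => by
      have := hz x fun h => hx (Set.Ioo_subset_Ioc_self h)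
      simp [this]
  have i1 : IntegrableOn (fun x => _root_.deriv (_root_.deriv f) x * (starRingEnd ℂ) (f x))
      (Set.Ioi 0) :=
    hf.deriv.deriv.memLp.integrable_mul hf.conj.memLp
  have i2 : IntegrableOn (fun x => _root_.deriv f x * _root_.deriv (fun y => (starRingEnd ℂ) (f y)) x)
      (Set.Ioi 0) := hf.deriv.memLp.integrable_mul hf.conj.deriv.memLp
  rw [integral_add i1 i2] at h0
  have e : ∫ x in Set.Ioi 0, _root_.deriv f x * _root_.deriv (fun y => (starRingEnd ℂ) (f y)) x =
      ((∫ x in Set.Ioi 0, ‖_root_.deriv f x‖ ^ 2 : ℝ) : ℂ) := by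
    rw [← integral_complex_ofReal]
    refine integral_congr_ae (ae_of_all _ fun x => ?_)
    simp only [deriv_conj]
    rw [Complex.mul_conj, Complex.normSq_eq_norm_sq]
  rw [e] at h0
  simp only [neg_mul, integral_neg]
  linear_combination h0

/-! ### The domain of the closure is contained in `H²₀` -/

section

variable {α : ℝ} {k : ℤ} {s : Side}

theorem deriv_comp_flip_norm (s : Side) (f : ℝ → ℂ) (x : ℝ) :
    ‖deriv (fun y => f (flip s y)) x‖ = ‖deriv f (flip s x)‖ := by
  cases s
  · simp only [flip, deriv_comp_neg, norm_neg]
  · rfl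

theorem norm_toLp_sq {f : ℝ → ℂ} (hf : MemLp f 2 (sideMeasure s)) :
    ‖hf.toLp f‖ ^ 2 = ∫ x in Set.Ioi 0, ‖f (flip s x)‖ ^ 2 := by
  rw [norm_sq_halfSpace, integral_flip_real s fun x => ‖f x‖ ^ 2]
  refine integral_congr_ae ?_
  filter_upwards [hf.coeFn_toLp] with x hx
  rw [hx]

/-- The bound on f'' is the integrated inequality. The bound on f' follows by interpolation, ‖f'‖² =
⟨f, -f''⟩ ≤ ‖f‖ ‖f''‖. -/
theorem exists_second_order_bound (hα₀ : 0 ≤ α) (hα₁ : α < 1) (k : ℤ) (s : Side) :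
    ∃ C : ℝ, 0 ≤ C ∧ ∀ f (hf : IsTest s f),
      ‖hf.deriv.deriv.memLp.toLp _‖ ≤
        C * ‖((hf.memLp.toLp f, (hf.memLp_diffExpr α k).toLp _) : HalfSpace s × HalfSpace s)‖ ∧
      ‖hf.deriv.memLp.toLp _‖ ≤
        C * ‖((hf.memLp.toLp f, (hf.memLp_diffExpr α k).toLp _) : HalfSpace s × HalfSpace s)‖ := by
  obtain ⟨ε, K, hε, hK, H⟩ := exists_real_second_order_bound hα₀ hα₁ k
  set C : ℝ := Real.sqrt ((1 + K) / ε)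
  -- Interpolation gives ‖f'‖² ≤ C N², and C ≤ (C + 1)², so `C + 1` serves for both derivatives.
  refine ⟨C + 1, by positivity, fun f hf => ?_⟩
  set N : ℝ := ‖((hf.memLp.toLp f, (hf.memLp_diffExpr α k).toLp _) : HalfSpace s × HalfSpace s)‖
  have hN : 0 ≤ N := norm_nonneg _
  have n1 : ‖hf.memLp.toLp f‖ ≤ N := le_max_left _ _
  have n2 : ‖(hf.memLp_diffExpr α k).toLp _‖ ≤ N := le_max_right _ _
  have ht := hf.flip_to_plus
  have B := ht.second_order_bound_plus H
  simp only [deriv_deriv_comp_flip, diffExpr_comp_flip] at B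
  rw [← norm_toLp_sq hf.deriv.deriv.memLp, ← norm_toLp_sq hf.memLp,
    ← norm_toLp_sq (hf.memLp_diffExpr α k)] at B
  have b2 : ‖hf.deriv.deriv.memLp.toLp _‖ ≤ C * N := by
    refine le_of_sq_le_sq ?_ (by positivity)
    have e : (C * N) ^ 2 = (1 + K) / ε * N ^ 2 := by
      rw [mul_pow, Real.sq_sqrt (by positivity)]
    rw [e, div_mul_eq_mul_div, le_div_iff₀ hε, mul_comm]
    refine B.trans ?_
    have q1 : ‖hf.memLp.toLp f‖ ^ 2 ≤ N ^ 2 := pow_le_pow_left₀ (norm_nonneg _) n1 2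
    have q2 : ‖(hf.memLp_diffExpr α k).toLp _‖ ^ 2 ≤ N ^ 2 := pow_le_pow_left₀ (norm_nonneg _) n2 2
    have q3 := mul_le_mul_of_nonneg_left q1 hK
    linarith
  refine ⟨b2.trans (mul_le_mul_of_nonneg_right (by linarith) hN), ?_⟩
  have e1 := ht.integral_norm_deriv_sq_plus
  simp only [deriv_deriv_comp_flip, deriv_comp_flip_norm] at e1
  rw [← norm_toLp_sq hf.deriv.memLp,
    integral_flip s fun x => -deriv (deriv f) x * (starRingEnd ℂ) (f x)] at e1
  have e2 : ∫ x in halfLine s, -deriv (deriv f) x * (starRingEnd ℂ) (f x) =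
      ⟪hf.memLp.toLp f, -hf.deriv.deriv.memLp.toLp _⟫_ℂ := by
    rw [inner_neg_right, inner_halfSpace, ← integral_neg]
    refine integral_congr_ae ?_
    filter_upwards [hf.memLp.coeFn_toLp, hf.deriv.deriv.memLp.coeFn_toLp] with x h1 h2
    rw [h1, h2, neg_mul]
  rw [e2] at e1
  have e3 : ‖hf.deriv.memLp.toLp _‖ ^ 2 ≤ N * (C * N) := by
    have h := norm_inner_le_norm (𝕜 := ℂ) (hf.memLp.toLp f) (-hf.deriv.deriv.memLp.toLp _)
    rw [← e1, Complex.norm_real, Real.norm_of_nonneg (sq_nonneg _), norm_neg] at h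
    exact h.trans (mul_le_mul n1 b2 (norm_nonneg _) hN)
  refine le_of_sq_le_sq (e3.trans ?_) (by positivity)
  have hC : 0 ≤ C := Real.sqrt_nonneg _
  have : 0 ≤ N ^ 2 * (C ^ 2 + C + 1) := by positivity
  nlinarith

theorem toLp_sub_eq {f g : ℝ → ℂ} (hf : MemLp f 2 (sideMeasure s)) (hg : MemLp g 2 (sideMeasure s))
    {h : ℝ → ℂ} (hh : MemLp h 2 (sideMeasure s)) (e : h = f - g) :
    hh.toLp h = hf.toLp f - hg.toLp g := by
  subst e
  exact MemLp.toLp_sub hf hg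

theorem IsTest.sub {f g : ℝ → ℂ} (hf : IsTest s f) (hg : IsTest s g) : IsTest s (f - g) := by
  have := hf.add (hg.smul (-1))
  rwa [neg_one_smul, ← sub_eq_add_neg] at this

theorem deriv_sub_test {f g : ℝ → ℂ} (hf : IsTest s f) (hg : IsTest s g) :
    deriv (f - g) = deriv f - deriv g :=
  funext fun x => deriv_sub (hf.differentiable x) (hg.differentiable x)

theorem diffExpr_sub {f g : ℝ → ℂ} (hf : IsTest s f) (hg : IsTest s g) :
    diffExpr α k (f - g) = diffExpr α k f - diffExpr α k g := by
  have h := diffExpr_add α k hf (hg.smul (-1))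
  rw [diffExpr_smul α k (-1) hg, neg_one_smul, neg_one_smul, ← sub_eq_add_neg,
    ← sub_eq_add_neg] at h
  exact h

/-- A graph-norm convergent sequence of test functions. -/
theorem exists_seq_of_mem_topologicalClosure {u v : HalfSpace s}
    (h : (u, v) ∈ (minimalGraph α k s).topologicalClosure) :
    ∃ (f : ℕ → ℝ → ℂ) (hf : ∀ n, IsTest s (f n)),
      Tendsto (fun n => (((hf n).memLp.toLp _, ((hf n).memLp_diffExpr α k).toLp _) :
        HalfSpace s × HalfSpace s)) atTop (𝓝 (u, v)) := by
  obtain ⟨p, hp, hlim⟩ := mem_closure_iff_seq_limit.1 h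
  choose f hf h1 h2 using hp
  refine ⟨f, hf, hlim.congr fun n => ?_⟩
  refine Prod.ext (Lp.ext ?_) (Lp.ext ?_)
  · exact (h1 n).trans (hf n).memLp.coeFn_toLp.symm
  · exact (h2 n).trans ((hf n).memLp_diffExpr α k).coeFn_toLp.symm

theorem tendsto_eLpNorm_of_tendsto {g : ℕ → ℝ → ℂ} (hg : ∀ n, MemLp (g n) 2 (sideMeasure s))
    {v : HalfSpace s} (h : Tendsto (fun n => (hg n).toLp _) atTop (𝓝 v)) :
    Tendsto (fun n => eLpNorm (fun x => g n x - v x) 2 (sideMeasure s)) atTop (𝓝 0) := by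
  rw [Lp.tendsto_Lp_iff_tendsto_eLpNorm'] at h
  refine h.congr fun n => eLpNorm_congr_ae ?_
  filter_upwards [(hg n).coeFn_toLp] with x hx
  simp only [Pi.sub_apply, hx]

theorem cauchySeq_of_norm_sub_le {E F : Type*} [SeminormedAddCommGroup E] [SeminormedAddCommGroup F]
    {p : ℕ → E} {q : ℕ → F} {C : ℝ} (hp : CauchySeq p)
    (h : ∀ n m, ‖q n - q m‖ ≤ C * ‖p n - p m‖) : CauchySeq q := by
  rw [Metric.cauchySeq_iff] at hp ⊢
  intro ε hε
  obtain ⟨N, hN⟩ := hp (ε / (|C| + 1)) (by positivity)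
  refine ⟨N, fun n hn m hm => ?_⟩
  have h1 := hN n hn m hm
  rw [dist_eq_norm] at h1 ⊢
  calc ‖q n - q m‖ ≤ C * ‖p n - p m‖ := h n m
    _ ≤ (|C| + 1) * ‖p n - p m‖ :=
        mul_le_mul_of_nonneg_right (by linarith [le_abs_self C]) (norm_nonneg _)
    _ < (|C| + 1) * (ε / (|C| + 1)) := mul_lt_mul_of_pos_left h1 (by positivity)
    _ = ε := by field_simp

/-- By linearity the a priori estimate applies to differences: a sequence of test functions that is
Cauchy in the graph norm has Cauchy first and second derivatives. -/
theorem memH20_of_mem_topologicalClosure (hα₀ : 0 ≤ α) (hα₁ : α < 1) {u v : HalfSpace s}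
    (h : (u, v) ∈ (minimalGraph α k s).topologicalClosure) : MemH20 s u := by
  obtain ⟨f, hf, hlim⟩ := exists_seq_of_mem_topologicalClosure h
  obtain ⟨C, hC, hb⟩ := exists_second_order_bound hα₀ hα₁ k s
  have hsub : ∀ n m, ((((hf n).sub (hf m)).memLp.toLp _,
      (((hf n).sub (hf m)).memLp_diffExpr α k).toLp _) : HalfSpace s × HalfSpace s) =
      ((hf n).memLp.toLp _, ((hf n).memLp_diffExpr α k).toLp _) -
      ((hf m).memLp.toLp _, ((hf m).memLp_diffExpr α k).toLp _) := fun n m =>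
    Prod.ext (toLp_sub_eq (hf n).memLp (hf m).memLp ((hf n).sub (hf m)).memLp rfl)
      (toLp_sub_eq ((hf n).memLp_diffExpr α k) ((hf m).memLp_diffExpr α k)
        (((hf n).sub (hf m)).memLp_diffExpr α k) (diffExpr_sub (hf n) (hf m)))
  have c1 : CauchySeq fun n => (hf n).deriv.memLp.toLp _ :=
    cauchySeq_of_norm_sub_le (C := C) hlim.cauchySeq fun n m => by
      rw [← hsub, ← toLp_sub_eq (hf n).deriv.memLp (hf m).deriv.memLp
        ((hf n).sub (hf m)).deriv.memLp (deriv_sub_test (hf n) (hf m))]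
      exact (hb _ ((hf n).sub (hf m))).2
  have c2 : CauchySeq fun n => (hf n).deriv.deriv.memLp.toLp _ :=
    cauchySeq_of_norm_sub_le (C := C) hlim.cauchySeq fun n m => by
      rw [← hsub, ← toLp_sub_eq (hf n).deriv.deriv.memLp (hf m).deriv.deriv.memLp
        ((hf n).sub (hf m)).deriv.deriv.memLp (by
        rw [deriv_sub_test (hf n) (hf m), deriv_sub_test (hf n).deriv (hf m).deriv])]
      exact (hb _ ((hf n).sub (hf m))).1
  obtain ⟨d1, hd1⟩ := cauchySeq_tendsto_of_complete c1
  obtain ⟨d2, hd2⟩ := cauchySeq_tendsto_of_complete c2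
  have h0 : Tendsto (fun n => (hf n).memLp.toLp _) atTop (𝓝 u) :=
    (continuous_fst.tendsto (u, v)).comp hlim
  exact ⟨f, d1, d2, hf, tendsto_eLpNorm_of_tendsto (fun n => (hf n).memLp) h0,
    tendsto_eLpNorm_of_tendsto (fun n => (hf n).deriv.memLp) hd1,
    tendsto_eLpNorm_of_tendsto (fun n => (hf n).deriv.deriv.memLp) hd2⟩

end

/-! ### The quadratic form and the form domain -/

section

variable {α : ℝ} {k : ℤ} {s : Side}

/-- The quadratic form of the half-line operator, on functions on `ℝ⁺`. -/
def energy (α : ℝ) (k : ℤ) (f : ℝ → ℂ) : ℝ :=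
  (∫ x in Set.Ioi 0, ‖deriv f x‖ ^ 2) + ∫ x in Set.Ioi 0, potential α k x * ‖f x‖ ^ 2

theorem memLp_conj {u : ℝ → ℂ} {μ : Measure ℝ} (hu : MemLp u 2 μ) :
    MemLp (fun x => (starRingEnd ℂ) (u x)) 2 μ :=
  (Complex.conjLIE.toContinuousLinearEquiv.toContinuousLinearMap).comp_memLp' hu

theorem integral_diffExpr_mul_conj {f : ℝ → ℂ} (hf : IsTest .plus f) (α : ℝ) (k : ℤ) :
    ∫ x in Set.Ioi 0, diffExpr α k f x * (starRingEnd ℂ) (f x) = (energy α k f : ℂ) := by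
  have i1 : Integrable (fun x => diffExpr α k f x * (starRingEnd ℂ) (f x))
      (volume.restrict (Set.Ioi 0)) :=
    (hf.memLp_diffExpr α k).integrable_mul (memLp_conj hf.memLp)
  have i2 : Integrable (fun x => -(deriv (deriv f) x) * (starRingEnd ℂ) (f x))
      (volume.restrict (Set.Ioi 0)) :=
    hf.deriv.deriv.memLp.neg.integrable_mul (memLp_conj hf.memLp)
  rw [energy, Complex.ofReal_add, hf.integral_norm_deriv_sq_plus, ← sub_eq_iff_eq_add',
    ← integral_sub i1 i2, ← integral_complex_ofReal]
  refine integral_congr_ae (ae_of_all _ fun x => ?_)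
  simp only [diffExpr]
  have h := Complex.mul_conj (f x)
  rw [Complex.normSq_eq_norm_sq] at h
  push_cast at h ⊢
  linear_combination (potential α k x : ℂ) * h

theorem integral_norm_deriv_sq_le_energy (hα₀ : 0 ≤ α) (k : ℤ) (f : ℝ → ℂ) :
    ∫ x in Set.Ioi 0, ‖deriv f x‖ ^ 2 ≤ energy α k f :=
  le_add_of_nonneg_right <| integral_nonneg fun x =>
    mul_nonneg (potential_nonneg hα₀ k x) (sq_nonneg _)

theorem energy_nonneg (hα₀ : 0 ≤ α) (k : ℤ) (f : ℝ → ℂ) : 0 ≤ energy α k f :=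
  (integral_nonneg fun _ => sq_nonneg _).trans (integral_norm_deriv_sq_le_energy hα₀ k f)

theorem inner_diffExpr_eq_energy {f : ℝ → ℂ} (hf : IsTest s f) (α : ℝ) (k : ℤ) :
    ⟪hf.memLp.toLp f, (hf.memLp_diffExpr α k).toLp _⟫_ℂ = energy α k (fun x => f (flip s x)) := by
  rw [← integral_diffExpr_mul_conj hf.flip_to_plus, inner_halfSpace]
  simp only [diffExpr_comp_flip]
  rw [integral_flip s fun x => diffExpr α k f x * (starRingEnd ℂ) (f x)]
  refine integral_congr_ae ?_
  filter_upwards [hf.memLp.coeFn_toLp, (hf.memLp_diffExpr α k).coeFn_toLp] with x h1 h2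
  rw [h1, h2]

/-- Elements of the domain of the half-line operator. -/
theorem exists_isTest_of_mem_domain (x : (halfOp α k s).domain) :
    ∃ (f : ℝ → ℂ) (hf : IsTest s f), (x : HalfSpace s) = hf.memLp.toLp f ∧
      halfOp α k s x = (hf.memLp_diffExpr α k).toLp _ := by
  have h := (halfOp α k s).mem_graph x
  rw [halfOp_graph] at h
  obtain ⟨f, hf, h1, h2⟩ := h
  exact ⟨f, hf, Lp.ext (h1.trans hf.memLp.coeFn_toLp.symm),
    Lp.ext (h2.trans (hf.memLp_diffExpr α k).coeFn_toLp.symm)⟩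

/-- Test functions as elements of the domain of the half-line operator. -/
def IsTest.toDomain {f : ℝ → ℂ} (hf : IsTest s f) (α : ℝ) (k : ℤ) : (halfOp α k s).domain :=
  ⟨hf.memLp.toLp f, mem_halfOp_domain_of_isTest hf α k⟩

theorem IsTest.halfOp_toDomain {f : ℝ → ℂ} (hf : IsTest s f) (α : ℝ) (k : ℤ) :
    halfOp α k s (hf.toDomain α k) = (hf.memLp_diffExpr α k).toLp _ := by
  have h := hf.toLp_mem_minimalGraph α k
  rw [← halfOp_graph, LinearPMap.mem_graph_iff] at h
  obtain ⟨y, hy1, hy2⟩ := h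
  have : y = hf.toDomain α k := Subtype.ext hy1
  rw [← this]
  exact hy2

theorem IsTest.inner_toDomain_sub {f g : ℝ → ℂ} (hf : IsTest s f) (hg : IsTest s g) (α : ℝ)
    (k : ℤ) :
    ⟪((hf.toDomain α k - hg.toDomain α k : (halfOp α k s).domain) : HalfSpace s),
      halfOp α k s (hf.toDomain α k - hg.toDomain α k)⟫_ℂ =
      energy α k (fun x => (f - g) (flip s x)) := by
  have e : hf.toDomain α k - hg.toDomain α k = (hf.sub hg).toDomain α k :=
    Subtype.ext (toLp_sub_eq hf.memLp hg.memLp (hf.sub hg).memLp rfl).symm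
  rw [e, (hf.sub hg).halfOp_toDomain, ← inner_diffExpr_eq_energy (hf.sub hg)]
  rfl

/-- The quadratic form of `A` is non-negative. -/
def IsNonneg {H : Type*} [NormedAddCommGroup H] [InnerProductSpace ℂ H] (A : H →ₗ.[ℂ] H) : Prop :=
  ∀ x : A.domain, ∃ r : ℝ, 0 ≤ r ∧ ⟪(x : H), A x⟫_ℂ = r

theorem isNonneg_halfOp (hα₀ : 0 ≤ α) (k : ℤ) (s : Side) : IsNonneg (halfOp α k s) := fun x => by
  obtain ⟨f, hf, h1, h2⟩ := exists_isTest_of_mem_domain x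
  exact ⟨_, energy_nonneg hα₀ k _, by rw [h1, h2, inner_diffExpr_eq_energy hf]⟩

section Abstract

variable {H : Type*} [NormedAddCommGroup H] [InnerProductSpace ℂ H] {A : H →ₗ.[ℂ] H}

/-- Parallelogram identity for the form, with the non-negative term at x - y dropped. -/
theorem IsNonneg.norm_inner_add_le (hA : IsNonneg A) (x y : A.domain) :
    ‖⟪((x + y : A.domain) : H), A (x + y)⟫_ℂ‖ ≤
      2 * ‖⟪(x : H), A x⟫_ℂ‖ + 2 * ‖⟪(y : H), A y⟫_ℂ‖ := by
  obtain ⟨a, ha, ea⟩ := hA x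
  obtain ⟨b, hb, eb⟩ := hA y
  obtain ⟨c, hc, ec⟩ := hA (x + y)
  obtain ⟨d, hd, ed⟩ := hA (x - y)
  have e : ⟪((x + y : A.domain) : H), A (x + y)⟫_ℂ + ⟪((x - y : A.domain) : H), A (x - y)⟫_ℂ =
      2 * ⟪(x : H), A x⟫_ℂ + 2 * ⟪(y : H), A y⟫_ℂ := by
    simp only [LinearPMap.map_add, LinearPMap.map_sub, Submodule.coe_add,
      AddSubgroupClass.coe_sub, inner_add_left, inner_add_right, inner_sub_left, inner_sub_right]
    ring
  rw [ea, eb, ec, ed] at e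
  rw [ea, eb, ec]
  simp only [Complex.norm_real, Real.norm_of_nonneg, ha, hb, hc]
  have e' : c + d = 2 * a + 2 * b := by exact_mod_cast e
  linarith

theorem MemFormDomain.add (hA : IsNonneg A) {u v : H} (hu : MemFormDomain A u)
    (hv : MemFormDomain A v) : MemFormDomain A (u + v) := by
  obtain ⟨f, hf, hf'⟩ := hu
  obtain ⟨g, hg, hg'⟩ := hv
  refine ⟨fun n => f n + g n, hf.add hg, ?_⟩
  have h := (hf'.norm.const_mul 2).add (hg'.norm.const_mul 2)
  simp only [norm_zero, mul_zero, add_zero] at h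
  refine squeeze_zero_norm (fun p => ?_) h
  rw [add_sub_add_comm]
  exact hA.norm_inner_add_le _ _

theorem MemFormDomain.smul (c : ℂ) {u : H} (hu : MemFormDomain A u) :
    MemFormDomain A (c • u) := by
  obtain ⟨f, hf, hf'⟩ := hu
  refine ⟨fun n => c • f n, hf.const_smul c, ?_⟩
  have h := hf'.const_mul ((starRingEnd ℂ) c * c)
  rw [mul_zero] at h
  refine h.congr fun p => ?_
  rw [← smul_sub, LinearPMap.map_smul, Submodule.coe_smul, inner_smul_left, inner_smul_right]
  ring

/-- Graph convergence is stronger than form convergence: both entries of ⟨fₙ - fₘ, A(fₙ - fₘ)⟩ tend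
to 0. -/
theorem memFormDomain_of_tendsto {f : ℕ → A.domain} {u v : H}
    (hu : Tendsto (fun n => (f n : H)) atTop (𝓝 u)) (hv : Tendsto (fun n => A (f n)) atTop (𝓝 v)) :
    MemFormDomain A u := by
  refine ⟨f, hu, ?_⟩
  have cu := (hu.comp tendsto_fst).sub (hu.comp (tendsto_snd (f := (atTop : Filter ℕ))))
  have cv := (hv.comp tendsto_fst).sub (hv.comp (tendsto_snd (f := (atTop : Filter ℕ))))
  have h := Tendsto.inner (𝕜 := ℂ) cu cv
  simp only [sub_self, inner_zero_left] at h
  refine h.congr fun p => ?_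
  simp only [Function.comp_def, LinearPMap.map_sub, AddSubgroupClass.coe_sub]

end Abstract

theorem memFormDomain_of_mem_topologicalClosure {u v : HalfSpace s}
    (h : (u, v) ∈ (minimalGraph α k s).topologicalClosure) : MemFormDomain (halfOp α k s) u := by
  obtain ⟨f, hf, hlim⟩ := exists_seq_of_mem_topologicalClosure h
  refine memFormDomain_of_tendsto (f := fun n => (hf n).toDomain α k) (v := v)
    ((continuous_fst.tendsto (u, v)).comp hlim) ?_
  refine ((continuous_snd.tendsto (u, v)).comp hlim).congr fun n => ?_
  rw [(hf n).halfOp_toDomain]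
  rfl

/-- A test function vanishes at 0, so it is the integral of its derivative; Cauchy–Schwarz and ∫
|f'|² ≤ energy do the rest. -/
theorem IsTest.norm_le_sqrt {f : ℝ → ℂ} (hf : IsTest .plus f) (hα₀ : 0 ≤ α) (k : ℤ) {x : ℝ}
    (hx : 0 < x) : ‖f x‖ ≤ x ^ (1 / 2 : ℝ) * energy α k f ^ (1 / 2 : ℝ) := by
  have h0 : f 0 = 0 := image_eq_zero_of_notMem_tsupport fun h => lt_irrefl (0 : ℝ) (hf.2.2 h)
  have e : ∫ t in (0 : ℝ)..x, _root_.deriv f t = f x := by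
    rw [intervalIntegral.integral_eq_sub_of_hasDerivAt (fun t _ => hf.hasDerivAt t)
      (hf.deriv.continuous.intervalIntegrable _ _), h0, sub_zero]
  have hm := hf.deriv.memLp
  have h := norm_integral_absPow_mul_le (m := 0) (by norm_num) hx
    (hm.mono_measure (Measure.restrict_mono Set.Ioc_subset_Ioi_self le_rfl))
  simp only [absPow_zero, one_mul, e] at h
  refine h.trans ?_
  norm_num only [Real.one_rpow, one_mul]
  refine mul_le_mul_of_nonneg_left (Real.rpow_le_rpow ?_ ?_ (by norm_num)) (by positivity)
  · exact intervalIntegral.integral_nonneg hx.le fun _ _ => sq_nonneg _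
  · refine le_trans ?_ (integral_norm_deriv_sq_le_energy hα₀ k f)
    rw [intervalIntegral.integral_of_le hx.le]
    exact setIntegral_mono_set (hm.integrable_norm_pow two_ne_zero) (ae_of_all _ fun _ => sq_nonneg _)
      (ae_of_all _ Set.Ioc_subset_Ioi_self)

end

/-! ### Form domain and leading coefficient -/

section

variable {α : ℝ} {k : ℤ} {s : Side}

theorem exists_subseq_tendsto_ae {f : ℕ → ℝ → ℂ} (hf : ∀ n, MemLp (f n) 2 (sideMeasure s))
    {u : HalfSpace s} (h : Tendsto (fun n => (hf n).toLp _) atTop (𝓝 u)) :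
    ∃ ns : ℕ → ℕ, StrictMono ns ∧
      ∀ᵐ x ∂(sideMeasure s), Tendsto (fun i => f (ns i) x) atTop (𝓝 (u x)) := by
  have h1 := tendsto_eLpNorm_of_tendsto hf h
  have h2 := tendstoInMeasure_of_tendsto_eLpNorm (μ := sideMeasure s) (p := 2) (by norm_num)
    (fun n => (hf n).aestronglyMeasurable) (Lp.aestronglyMeasurable u) h1
  exact h2.exists_seq_tendsto_ae

/-- A form-Cauchy sequence of test functions is controlled by `|x|^{1/2}` near the origin. -/
theorem MemFormDomain.exists_bound (hα₀ : 0 ≤ α) {u : HalfSpace s}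
    (hu : MemFormDomain (halfOp α k s) u) : ∃ δ : ℝ, 0 < δ ∧
      ∀ᵐ x ∂(volume.restrict (Set.Ioi 0)), x < δ → ‖u (flip s x)‖ ≤ x ^ (1 / 2 : ℝ) := by
  obtain ⟨F, hF, hq⟩ := hu
  choose f hf h1 h2 using fun n => exists_isTest_of_mem_domain (F n)
  have hF' : ∀ n, F n = (hf n).toDomain α k := fun n => Subtype.ext (h1 n)
  simp only [hF', IsTest.inner_toDomain_sub] at hq
  simp only [h1] at hF
  obtain ⟨ns, hns, hlim⟩ := exists_subseq_tendsto_ae (fun n => (hf n).memLp) hF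
  have hev : ∀ᶠ p : ℕ × ℕ in atTop ×ˢ atTop,
      ‖(energy α k (fun x => (f p.1 - f p.2) (flip s x)) : ℂ)‖ < 1 := by
    have := hq.norm
    rw [norm_zero] at this
    exact this.eventually (gt_mem_nhds one_pos)
  rw [prod_atTop_atTop_eq, eventually_atTop_prod_self'] at hev
  obtain ⟨N, hN⟩ := hev
  -- The function `f N` vanishes on (0, a). There fₙ coincides with fₙ - f_N, whose energy is below
  -- 1 for n ≥ N, and the resulting bound passes to the almost everywhere limit.
  obtain ⟨a, b, ha, hab, hs⟩ := (hf N).flip_to_plus.exists_Ioo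
  refine ⟨a, ha, ?_⟩
  have hl := (measurePreserving_flip s).quasiMeasurePreserving.ae hlim
  filter_upwards [hl, ae_restrict_mem measurableSet_Ioi] with x hx (hx0 : 0 < x) hxa
  have hz : f N (flip s x) = 0 :=
    eq_zero_of_tsupport_subset (f := fun x => f N (flip s x)) hs fun h => lt_asymm hxa h.1
  refine le_of_tendsto hx.norm ?_
  filter_upwards [eventually_ge_atTop N] with i hi
  have h3 := hN (ns i) (hi.trans (hns.id_le i)) N le_rfl
  rw [Complex.norm_real, Real.norm_of_nonneg (energy_nonneg hα₀ k _)] at h3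
  have h4 := (((hf (ns i)).sub (hf N)).flip_to_plus).norm_le_sqrt hα₀ k hx0
  simp only [Pi.sub_apply, hz, sub_zero] at h4 h3
  refine h4.trans (mul_le_of_le_one_right (by positivity) ?_)
  exact Real.rpow_le_one (energy_nonneg hα₀ k _) h3.le (by norm_num)

/-- If c₀ ≠ 0 then |u| is of size |c₀||x|^{-α/2} near 0, which is incompatible with the bound
|x|^{1/2} on the form domain. -/
theorem coeff_zero_of_memFormDomain (hα₀ : 0 ≤ α) {u : HalfSpace s} {c₀ c₁ : ℂ}
    (hc : HasCoeffs α s u c₀ c₁) (hu : MemFormDomain (halfOp α k s) u) : c₀ = 0 := by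
  obtain ⟨G, hG, hS⟩ := hc
  obtain ⟨δ, hδ, hb⟩ := hu.exists_bound hα₀
  have hT := (hasShortRange_iff_flip.1 hS).1
  by_contra hne
  have hpos : 0 < ‖c₀‖ := norm_pos_iff.2 hne
  have e1 : ∀ᶠ x in 𝓝[>] (0 : ℝ), ‖c₀‖ / 2 < ‖((|x| ^ (α / 2) : ℝ) : ℂ) * G (flip s x)‖ :=
    hT.norm.eventually (lt_mem_nhds (half_lt_self hpos))
  have e2 : ∀ᶠ x in 𝓝[>] (0 : ℝ), x ^ (α / 2 + 1 / 2) < ‖c₀‖ / 2 := by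
    have h := (Real.continuousAt_rpow_const 0 (α / 2 + 1 / 2) (Or.inr (by positivity))).tendsto
    rw [Real.zero_rpow (by positivity)] at h
    exact (h.mono_left nhdsWithin_le_nhds).eventually (gt_mem_nhds (half_pos hpos))
  have e3 : ∀ᶠ x in 𝓝[>] (0 : ℝ), x < δ := nhdsWithin_le_nhds (gt_mem_nhds hδ)
  obtain ⟨r, hr, hsub⟩ := mem_nhdsGT_iff_exists_Ioo_subset.1 (e1.and (e2.and e3))
  -- The form-domain bound holds only almost everywhere, so the contradiction is that an interval of
  -- positive length would be null.
  have hae : ∀ᵐ x ∂(volume.restrict (Set.Ioo 0 r)), False := by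
    have hsub' : Set.Ioo 0 r ⊆ Set.Ioi (0 : ℝ) := fun x hx => hx.1
    have hb' := ae_restrict_of_ae_restrict_of_subset hsub' hb
    have hg' := ae_restrict_of_ae_restrict_of_subset hsub' hG.flip.2
    filter_upwards [hb', hg', ae_restrict_mem measurableSet_Ioo] with x h1 h2 hx
    obtain ⟨h3, h4, h5⟩ := hsub hx
    have h6 := h1 h5
    rw [h2] at h6
    rw [norm_mul, Complex.norm_real, Real.norm_of_nonneg (by positivity), abs_of_pos hx.1] at h3
    have h7 := mul_le_mul_of_nonneg_left h6 (Real.rpow_nonneg hx.1.le (α / 2))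
    rw [← Real.rpow_add hx.1] at h7
    linarith
  rw [ae_iff] at hae
  simp only [not_false_eq_true, Set.ofPred_true, Measure.restrict_apply_univ, Real.volume_Ioo,
    sub_zero, ENNReal.ofReal_eq_zero] at hae
  exact not_lt.2 hae hr

end

/-! ### The regular solution belongs to the form domain -/

section

variable {α : ℝ} {k : ℤ} {s : Side}

theorem setIntegral_le_of_bound {F : ℝ → ℝ} {r M : ℝ} (hr : 0 ≤ r)
    (h0 : ∀ x, r < x → F x = 0) (hM : ∀ x ∈ Set.Ioc 0 r, |F x| ≤ M) :
    ∫ x in Set.Ioi 0, F x ≤ M * r := by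
  rw [setIntegral_eq_of_subset_of_forall_sdiff_eq_zero measurableSet_Ioi
    (fun x (hx : x ∈ Set.Ioc 0 r) => hx.1) fun x hx => h0 x (not_le.1 fun h => hx.2 ⟨hx.1, h⟩)]
  have h := norm_setIntegral_le_of_norm_le_const (μ := volume) (s := Set.Ioc 0 r) (f := F) (C := M)
    (by simp) hM
  rw [measureReal_def, Real.volume_Ioc, sub_zero, ENNReal.toReal_ofReal hr] at h
  exact (Real.le_norm_self _).trans h

theorem cutoff_eq_comp (t x : ℝ) : cutoff t x = cutoff 1 (t * x) := by
  rw [cutoff, cutoff, one_mul]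

theorem deriv_cutoff (t x : ℝ) : deriv (cutoff t) x = t * deriv (cutoff 1) (t * x) := by
  have h : HasDerivAt (cutoff 1) (deriv (cutoff 1) (t * x)) (t * x) :=
    ((contDiff_cutoff 1).differentiable (by simp) _).hasDerivAt
  have h1 := h.scomp x ((hasDerivAt_id x).const_mul t)
  have e : cutoff 1 ∘ (t * ·) = cutoff t := funext fun y => (cutoff_eq_comp t y).symm
  change HasDerivAt (cutoff 1 ∘ (t * ·)) _ x at h1
  rw [e] at h1
  rw [h1.deriv]
  simp

theorem deriv_cutoff_eq_zero {t x : ℝ} (h : 2 < t * x) : deriv (cutoff t) x = 0 := by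
  rw [deriv_cutoff, (deriv_cutoff_one_eq_zero fun h' => not_lt.2 h'.2 h).1, mul_zero]

/-- By scaling, the derivative is t η'(tx) with η = `cutoff 1`, and it vanishes for tx > 2. Hence t
≤ 2/x wherever it matters, and the bound is uniform in t. -/
theorem exists_norm_deriv_cutoff_le : ∃ K : ℝ, 0 ≤ K ∧
    ∀ t x : ℝ, 0 < t → 0 < x → ‖deriv (cutoff t) x‖ ≤ K / x := by
  have hc : Continuous (deriv (cutoff 1)) :=
    (contDiff_infty_iff_deriv.1 (contDiff_cutoff 1)).2.continuous
  have hs : HasCompactSupport (deriv (cutoff 1)) :=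
    HasCompactSupport.of_support_subset_isCompact isCompact_Icc fun x hx => by_contra fun h =>
      hx (deriv_cutoff_one_eq_zero h).1
  obtain ⟨K, hK⟩ := hc.bounded_above_of_compact_support hs
  have hK0 : 0 ≤ K := (norm_nonneg _).trans (hK 0)
  refine ⟨2 * K, by positivity, fun t x ht hx => ?_⟩
  rcases lt_or_ge 2 (t * x) with h | h
  · rw [deriv_cutoff_eq_zero h, norm_zero]; positivity
  · rw [deriv_cutoff, norm_mul, Complex.norm_real, Real.norm_of_nonneg ht.le, le_div_iff₀ hx]
    have := mul_le_mul h (hK (t * x)) (norm_nonneg _) zero_le_two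
    linarith

/-- Multiplication by the difference of two cut-offs makes the energy small. -/
theorem energy_cutoff_sub_le (hα₀ : 0 ≤ α) (k : ℤ) {w w' : ℝ → ℂ} {b C : ℝ} (hb : 0 < b)
    (hw : ∀ x, 0 < x → HasDerivAt w (w' x) x)
    (hw1 : ∀ x ∈ Set.Ioc 0 b, ‖w x‖ ≤ C * x) (hw2 : ∀ x ∈ Set.Ioc 0 b, ‖w' x‖ ≤ C) :
    ∃ M : ℝ, 0 ≤ M ∧ ∀ N t t' : ℝ, 0 < N → 2 / N ≤ b → N ≤ t → N ≤ t' →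
      energy α k (fun x => cutoff t x * w x - cutoff t' x * w x) ≤ M * (2 / N) := by
  obtain ⟨K, hK, hKb⟩ := exists_norm_deriv_cutoff_le
  set c : ℝ := k ^ 2 * b ^ (2 * α) * b ^ 2 + α * (2 + α) / 4
  -- The difference of the cut-offs is supported in (0, 2/N]. There its derivative is at most 2K/x
  -- and |w| ≤ Cx, which gives 2KC; the cut-offs themselves differ by at most 2, which gives 2C. In
  -- the potential term, x² V ≤ `c` compensates the square of 2Cx. The factor 2/N is the length of
  -- the support.
  refine ⟨(2 * K * C + 2 * C) ^ 2 + c * (2 * C) ^ 2, by positivity,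
    fun N t t' hN hNb ht ht' => ?_⟩
  have hr : 0 ≤ 2 / N := by positivity
  have hd : ∀ x, 0 < x → HasDerivAt (fun x => cutoff t x * w x - cutoff t' x * w x)
      ((deriv (cutoff t) x - deriv (cutoff t') x) * w x + (cutoff t x - cutoff t' x) * w' x) x :=
    fun x hx => by
      have h : ∀ t, HasDerivAt (cutoff t) (deriv (cutoff t) x) x := fun t =>
        ((contDiff_cutoff t).differentiable (by simp) x).hasDerivAt
      refine (((h t).mul (hw x hx)).sub ((h t').mul (hw x hx))).congr_deriv ?_
      ring
  have big : ∀ x, 2 / N < x → ∀ t, N ≤ t → 2 < t * x := fun x hx t ht => by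
    rw [div_lt_iff₀ hN, mul_comm] at hx
    exact hx.trans_le (mul_le_mul_of_nonneg_right ht
      (hr.trans (by rw [div_le_iff₀ hN, mul_comm]; exact hx.le)))
  have cut : ∀ x, ‖cutoff t x - cutoff t' x‖ ≤ 2 := fun x =>
    (norm_sub_le _ _).trans (by linarith [norm_cutoff_le_one t x, norm_cutoff_le_one t' x])
  rw [energy, add_mul]
  refine add_le_add (setIntegral_le_of_bound hr (fun x hx => ?_) fun x hx => ?_)
    (setIntegral_le_of_bound hr (fun x hx => ?_) fun x hx => ?_)
  · rw [(hd x (hr.trans_lt hx)).deriv, cutoff_eq_one (big x hx t ht).le,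
      cutoff_eq_one (big x hx t' ht').le, deriv_cutoff_eq_zero (big x hx t ht),
      deriv_cutoff_eq_zero (big x hx t' ht')]
    simp
  · have hxb : x ∈ Set.Ioc 0 b := ⟨hx.1, hx.2.trans hNb⟩
    rw [(hd x hx.1).deriv, abs_of_nonneg (sq_nonneg _)]
    refine pow_le_pow_left₀ (norm_nonneg _) ((norm_add_le _ _).trans (add_le_add ?_ ?_)) 2
    · rw [norm_mul]
      have h1 := (norm_sub_le (deriv (cutoff t) x) (deriv (cutoff t') x)).trans
        (add_le_add (hKb t x (hN.trans_le ht) hx.1) (hKb t' x (hN.trans_le ht') hx.1))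
      have h2 := mul_le_mul h1 (hw1 x hxb) (norm_nonneg _) (by have := hx.1; positivity)
      have hx0 := hx.1.ne'
      refine h2.trans_eq ?_
      field_simp
      ring
    · rw [norm_mul]
      exact mul_le_mul (cut x) (hw2 x hxb) (norm_nonneg _) zero_le_two
  · rw [cutoff_eq_one (big x hx t ht).le, cutoff_eq_one (big x hx t' ht').le, sub_self, norm_zero]
    simp
  · have hxb : x ∈ Set.Ioc 0 b := ⟨hx.1, hx.2.trans hNb⟩
    have hx0 := hx.1
    have hV := potential_nonneg hα₀ k x
    rw [abs_of_nonneg (by positivity), ← sub_mul, norm_mul]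
    have h1 : ‖cutoff t x - cutoff t' x‖ * ‖w x‖ ≤ 2 * C * x := by
      have := mul_le_mul (cut x) (hw1 x hxb) (norm_nonneg _) zero_le_two
      linarith
    have h2 : potential α k x * x ^ 2 ≤ c := by
      have h3 : potential α k x * x ^ 2 = k ^ 2 * (x ^ (2 * α) * x ^ 2) + α * (2 + α) / 4 := by
        rw [potential, abs_of_pos hx0]
        field_simp
      have h4 : x ^ (2 * α) * x ^ 2 ≤ b ^ (2 * α) * b ^ 2 :=
        mul_le_mul (Real.rpow_le_rpow hx0.le hxb.2 (by linarith))
          (pow_le_pow_left₀ hx0.le hxb.2 2) (by positivity) (by positivity)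
      rw [h3]
      have := mul_le_mul_of_nonneg_left h4 (sq_nonneg (k : ℝ))
      simp only [c]
      linarith
    calc potential α k x * (‖cutoff t x - cutoff t' x‖ * ‖w x‖) ^ 2
        ≤ potential α k x * (2 * C * x) ^ 2 := by gcongr
      _ = potential α k x * x ^ 2 * (2 * C) ^ 2 := by ring
      _ ≤ c * (2 * C) ^ 2 := by gcongr

/-- The truncations `cutoff (n + 1)` · w are test functions that converge to w in L². The energy of
a difference of two of them is at most 2M divided by the smaller index plus one, so they are Cauchy
for the form. -/
theorem memFormDomain_of_bound (hα₀ : 0 ≤ α) (k : ℤ) {w w' : ℝ → ℂ} {b C : ℝ} (hb : 0 < b)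
    (hC : 0 ≤ C) (hw : ∀ x, 0 < x → HasDerivAt w (w' x) x) (hw0 : ∀ x, b < x → w x = 0)
    (hw1 : ∀ x ∈ Set.Ioc 0 b, ‖w x‖ ≤ C * x) (hw2 : ∀ x ∈ Set.Ioc 0 b, ‖w' x‖ ≤ C)
    (hsm : ∀ x, 0 < x → ContDiffAt ℝ ∞ w x) {u : HalfSpace s}
    (hu : (fun x => u (flip s x)) =ᵐ[volume.restrict (Set.Ioi 0)] w) :
    MemFormDomain (halfOp α k s) u := by
  have ht : ∀ n : ℕ, IsTest .plus fun x => cutoff (n + 1) x * w x := fun n => by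
    have hn : (0 : ℝ) < n + 1 := by positivity
    refine isTest_of_Icc (a := 1 / (n + 1)) (b := b) (by positivity)
      (fun x hx => (contDiff_cutoff _).contDiffAt.mul (hsm x hx)) fun x hx => ?_
    by_cases h : 1 / ((n : ℝ) + 1) ≤ x
    · rw [hw0 x (not_le.1 fun h' => hx ⟨h, h'⟩), mul_zero]
    · rw [not_le, lt_div_iff₀ hn] at h
      rw [cutoff_eq_zero (by linarith), zero_mul]
  have hlim : Tendsto (fun n : ℕ => 2 / ((n : ℝ) + 1)) atTop (𝓝 0) :=
    tendsto_const_nhds.div_atTop (tendsto_atTop_add_const_right _ _ tendsto_natCast_atTop_atTop)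
  refine ⟨fun n => ((ht n).flip_of_plus s).toDomain α k, ?_, ?_⟩
  · rw [tendsto_iff_norm_sub_tendsto_zero]
    have hsq : Tendsto (fun n : ℕ => ‖((((ht n).flip_of_plus s).toDomain α k :
        (halfOp α k s).domain) : HalfSpace s) - u‖ ^ 2) atTop (𝓝 0) := by
      have hl2 := hlim.const_mul ((2 * (C * b)) ^ 2)
      rw [mul_zero] at hl2
      refine squeeze_zero (fun n => sq_nonneg _) (fun n => ?_) hl2
      have hn : (0 : ℝ) < n + 1 := by positivity
      rw [norm_sq_halfSpace, ← integral_flip_real s fun x => ‖_‖ ^ 2]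
      have hm := ((ht n).flip_of_plus s).memLp
      have e1 := (measurePreserving_flip s).quasiMeasurePreserving.ae
        (hm.coeFn_toLp.and (Lp.coeFn_sub (hm.toLp _) u))
      have e2 : ∫ x in Set.Ioi 0, ‖(hm.toLp _ - u : HalfSpace s) (flip s x)‖ ^ 2 =
          ∫ x in Set.Ioi 0, ‖cutoff (n + 1) x * w x - w x‖ ^ 2 := by
        refine integral_congr_ae ?_
        filter_upwards [e1, hu] with x hx hx'
        rw [hx.2, Pi.sub_apply, hx.1, hx', flip_flip]
      refine e2.trans_le (setIntegral_le_of_bound (by positivity) (fun x hx => ?_) fun x hx => ?_)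
      · rw [div_lt_iff₀ hn] at hx
        rw [cutoff_eq_one (by linarith), one_mul, sub_self, norm_zero]
        simp
      · rw [abs_of_nonneg (sq_nonneg _)]
        refine pow_le_pow_left₀ (norm_nonneg _) ?_ 2
        rw [← sub_one_mul, norm_mul]
        refine mul_le_mul ((norm_sub_le _ _).trans ?_) ?_ (norm_nonneg _) zero_le_two
        · rw [norm_one]; linarith [norm_cutoff_le_one (n + 1) x]
        · rcases le_or_gt x b with h | h
          · exact (hw1 x ⟨hx.1, h⟩).trans (mul_le_mul_of_nonneg_left h hC)
          · rw [hw0 x h, norm_zero]; positivity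
    have := hsq.sqrt
    simpa using this
  · obtain ⟨M, hM, hE⟩ := energy_cutoff_sub_le hα₀ k hb hw hw1 hw2
    simp only [IsTest.inner_toDomain_sub, Pi.sub_apply, flip_flip]
    have hl2 : Tendsto (fun p : ℕ × ℕ => M * (2 / ((min p.1 p.2 : ℕ) + 1 : ℝ))) (atTop ×ˢ atTop)
        (𝓝 0) := by
      have h := (hlim.const_mul M).comp (f := fun p : ℕ × ℕ => min p.1 p.2) (x := atTop ×ˢ atTop)
        (tendsto_atTop.2 fun N => by
          filter_upwards [prod_mem_prod (mem_atTop N) (mem_atTop N)] with p hp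
          exact le_min hp.1 hp.2)
      rw [mul_zero] at h
      exact h
    have hev : ∀ᶠ p : ℕ × ℕ in atTop ×ˢ atTop, (2 / ((min p.1 p.2 : ℕ) + 1 : ℝ)) ≤ b := by
      have h := hlim.comp (f := fun p : ℕ × ℕ => min p.1 p.2) (x := atTop ×ˢ atTop)
        (tendsto_atTop.2 fun N => by
          filter_upwards [prod_mem_prod (mem_atTop N) (mem_atTop N)] with p hp
          exact le_min hp.1 hp.2)
      exact h.eventually (ge_mem_nhds hb)
    refine squeeze_zero_norm' ?_ hl2
    filter_upwards [hev] with p hp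
    rw [Complex.norm_real, Real.norm_of_nonneg (energy_nonneg hα₀ k _)]
    refine hE _ _ _ (by positivity) hp ?_ ?_
    · gcongr; exact min_le_left _ _
    · gcongr; exact min_le_right _ _

end

/-! ### Characterization of the form domain -/

section

variable {α : ℝ} {k : ℤ} {s : Side}

/-- Since 1 + α/2 ≥ 1, the function |x|^{1+α/2} P is O(|x|) with bounded derivative on its support,
which is all that the truncation argument asks. -/
theorem memFormDomain_sol₁ (hα₀ : 0 ≤ α) (k : ℤ) {P : ℝ → ℂ} (hP : ContDiff ℝ ∞ P)
    (hPc : HasCompactSupport P) (hP₀ : P 0 = 1) (hP₁ : deriv P 0 = 0) {u : HalfSpace s} {c : ℂ}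
    (hu : IsContinuousRep s (singularPart α P 0 c) u) : MemFormDomain (halfOp α k s) u := by
  obtain ⟨q1, q2, -, q4⟩ := comp_flip_cutoff hP hPc hP₀ hP₁ s
  obtain ⟨b, C, hb, hC0, hz, hC⟩ := exists_norm_bounds_of_cutoff q1 q2 q4
  set Q : ℝ → ℂ := fun x => P (flip s x)
  set m : ℝ := 1 + α / 2
  have hm : 0 ≤ m := by positivity
  have pow_le : ∀ {x : ℝ}, x ∈ Set.Ioc 0 b → ‖absPow (m - 1) x‖ ≤ b ^ (m - 1) := fun hx =>
    norm_absPow_le_of_Ioc (by simp only [m]; linarith) hx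
  have hbm : 0 ≤ b ^ (m - 1) := by positivity
  have hbm' : 0 ≤ b ^ m := by positivity
  refine memFormDomain_of_bound hα₀ k (w := fun x => c * (absPow m x * Q x))
    (w' := fun x => c * (m * absPow (m - 1) x * Q x + absPow m x * deriv Q x))
    (b := b) (C := ‖c‖ * (m * b ^ (m - 1) * C + b ^ m * (C * b)) + ‖c‖ * (b ^ (m - 1) * C)) hb
    (by positivity) (fun x hx => ?_) (fun x hx => ?_) (fun x hx => ?_) (fun x hx => ?_)
    (fun x hx => contDiffAt_const.mul ((contDiffAt_absPow hx m).mul q1.contDiffAt)) ?_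
  · exact ((hasDerivAt_absPow hx m).mul (contDiff.hasDerivAt_deriv q1 x).1).const_mul c
  · have hQ : Q x = 0 := (hz x hx.le).1
    simp only [hQ, mul_zero]
  · have e : absPow m x = absPow (m - 1) x * absPow 1 x := by
      rw [absPow_mul hx.1, sub_add_cancel]
    have h1 : ‖absPow 1 x‖ = x := by rw [norm_absPow hx.1, Real.rpow_one]
    rw [e, norm_mul, norm_mul, norm_mul, h1, add_mul]
    have hx0 := hx.1.le
    refine le_add_of_nonneg_of_le (by positivity) ?_
    have h2 := mul_le_mul (pow_le hx) (hC x hx0).1 (norm_nonneg _) hbm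
    calc ‖c‖ * (‖absPow (m - 1) x‖ * x * ‖Q x‖) = ‖c‖ * (‖absPow (m - 1) x‖ * ‖Q x‖) * x := by ring
      _ ≤ ‖c‖ * (b ^ (m - 1) * C) * x := by gcongr
  · rw [norm_mul]
    refine le_add_of_le_of_nonneg (mul_le_mul_of_nonneg_left ?_ (norm_nonneg _)) (by positivity)
    refine (norm_add_le _ _).trans (add_le_add ?_ ?_)
    · rw [norm_mul, norm_mul, Complex.norm_real, Real.norm_of_nonneg hm]
      have h1 := (hC x hx.1.le).1
      have h2 := pow_le hx
      gcongr
    · rw [norm_mul]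
      have h1 := (hC x hx.1.le).2.1.trans (mul_le_mul_of_nonneg_left hx.2 hC0)
      have h2 := norm_absPow_le_of_Ioc hm hx
      gcongr
  · filter_upwards [hu.flip.2] with x hx
    rw [hx]
    simp only [singularPart, absPow, abs_flip, zero_mul, zero_add, Q, m]
    ring

/-- When c₀ = 0, subtracting c₁ |x|^{1+α/2} times a cut-off leaves a vector with zero coefficients.
That vector lies in the domain of the closure, hence in the form domain, and so does the subtracted
function. -/
theorem memFormDomain_iff (hα₀ : 0 ≤ α) (hα₁ : α < 1) {u v : HalfSpace s}
    (h : IsWeakDiffExpr α k s u v) {c₀ c₁ : ℂ} (hc : HasCoeffs α s u c₀ c₁) :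
    MemFormDomain (halfOp α k s) u ↔ c₀ = 0 := by
  refine ⟨coeff_zero_of_memFormDomain hα₀ hc, ?_⟩
  rintro rfl
  obtain ⟨P, hP, hPc, hP₀, hP₁⟩ := exists_cutoff
  obtain ⟨e, e', he, hee, hce⟩ := exists_singularPart hα₀ hα₁ k hP hPc hP₀ hP₁ s 0 c₁
  have h1 := hc.sub hα₀ hα₁ hce
  rw [sub_self, sub_self] at h1
  have h2 := memFormDomain_of_mem_topologicalClosure
    ((mem_topologicalClosure_minimalGraph hα₀ hα₁).2 ⟨h.sub hee, h1⟩)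
  have h3 := h2.add (isNonneg_halfOp hα₀ k s) (memFormDomain_sol₁ hα₀ k hP hPc hP₀ hP₁ he)
  rwa [sub_add_cancel] at h3

end

/-! ### Direct sums of operators -/

section DirectSum

variable {B : ∀ s, HalfSpace s →ₗ.[ℂ] HalfSpace s}

theorem mem_directSum_graph {g v : FibreSpace} :
    (g, v) ∈ (directSum B).graph ↔ ∀ s, (g s, v s) ∈ (B s).graph := by
  simp only [LinearPMap.mem_graph_iff]
  constructor
  · rintro ⟨y, rfl, hy⟩ s
    exact ⟨⟨(y : FibreSpace) s, y.2 s⟩, rfl, by rw [← hy]; rfl⟩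
  · intro h
    choose y hy1 hy2 using h
    refine ⟨⟨g, fun s => by rw [← hy1 s]; exact (y s).2⟩, rfl, ?_⟩
    ext1 s
    rw [← hy2 s]
    exact congrArg _ (Subtype.ext (hy1 s).symm)

theorem mem_topologicalClosure_fibre {K : Submodule ℂ (FibreSpace × FibreSpace)}
    {L : ∀ s, Submodule ℂ (HalfSpace s × HalfSpace s)}
    (h : ∀ g v : FibreSpace, (g, v) ∈ K ↔ ∀ s, (g s, v s) ∈ L s) {g v : FibreSpace} :
    (g, v) ∈ K.topologicalClosure ↔ ∀ s, (g s, v s) ∈ (L s).topologicalClosure := by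
  constructor
  · intro hg s
    have hc : Continuous fun p : FibreSpace × FibreSpace => (p.1 s, p.2 s) := by fun_prop
    refine closure_mono ?_ (image_closure_subset_closure_image hc ⟨_, hg, rfl⟩)
    rintro _ ⟨p, hp, rfl⟩
    exact (h p.1 p.2).1 hp s
  · intro hg
    choose p hp hlim using fun s => mem_closure_iff_seq_limit.1 (hg s)
    refine mem_closure_iff_seq_limit.2 ⟨fun n => (WithLp.toLp 2 fun s => (p s n).1,
      WithLp.toLp 2 fun s => (p s n).2), fun n => (h _ _).2 fun s => hp s n, ?_⟩
    refine Tendsto.prodMk_nhds ?_ ?_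
    · exact ((PiLp.continuous_toLp 2 HalfSpace).tendsto g.ofLp).comp
        (tendsto_pi_nhds.2 fun s => (continuous_fst.tendsto _).comp (hlim s))
    · exact ((PiLp.continuous_toLp 2 HalfSpace).tendsto v.ofLp).comp
        (tendsto_pi_nhds.2 fun s => (continuous_snd.tendsto _).comp (hlim s))

theorem dense_directSum_domain (hB : ∀ s, Dense ((B s).domain : Set (HalfSpace s))) :
    Dense ((directSum B).domain : Set FibreSpace) := by
  have h := dense_pi Set.univ fun s _ => hB s
  have h2 := (PiLp.continuousLinearEquiv 2 ℂ HalfSpace).symm.surjective.denseRange.dense_image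
    (PiLp.continuousLinearEquiv 2 ℂ HalfSpace).symm.continuous h
  refine h2.mono ?_
  rintro _ ⟨g, hg, rfl⟩ s
  exact hg s (Set.mem_univ s)

theorem inner_fibre (g h : FibreSpace) : ⟪g, h⟫_ℂ = ∑ s, ⟪g s, h s⟫_ℂ := PiLp.inner_apply g h

theorem inner_single_fibre (s : Side) (a : HalfSpace s) (g : FibreSpace) :
    ⟪(PiLp.single 2 s a : FibreSpace), g⟫_ℂ = ⟪a, g s⟫_ℂ := by
  rw [inner_fibre, Finset.sum_eq_single s]
  · simp
  · intro t _ ht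
    have e : (PiLp.single 2 s a : FibreSpace) t = 0 := by simp [ht]
    rw [e, inner_zero_left]
  · simp

theorem mem_directSum_adjoint_graph (hB : ∀ s, Dense ((B s).domain : Set (HalfSpace s)))
    {g v : FibreSpace} :
    (g, v) ∈ (directSum B)†.graph ↔ ∀ s, (g s, v s) ∈ (B s)†.graph := by
  rw [LinearPMap.adjoint_graph_eq_graph_adjoint (dense_directSum_domain hB),
    Submodule.mem_adjoint_iff]
  simp only [LinearPMap.adjoint_graph_eq_graph_adjoint (hB _), Submodule.mem_adjoint_iff,
    mem_directSum_graph]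
  constructor
  · intro h s a b hab
    have key := h (PiLp.single 2 s a) (PiLp.single 2 s b) fun t => by
      by_cases ht : t = s
      · subst ht; simpa using hab
      · have e1 : (PiLp.single 2 s a : FibreSpace) t = 0 := by simp [ht]
        have e2 : (PiLp.single 2 s b : FibreSpace) t = 0 := by simp [ht]
        rw [e1, e2]
        exact Submodule.zero_mem _
    rwa [inner_single_fibre, inner_single_fibre] at key
  · intro h a b hab
    rw [inner_fibre, inner_fibre, ← Finset.sum_sub_distrib]
    exact Finset.sum_eq_zero fun s _ => h s _ _ (hab s)

theorem inner_directSum (f : (directSum B).domain) :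
    ⟪(f : FibreSpace), directSum B f⟫_ℂ =
      ∑ s, ⟪(f : FibreSpace) s, B s ⟨(f : FibreSpace) s, f.2 s⟩⟫_ℂ := inner_fibre _ _

/-- Non-negativity is essential from left to right: the form of each component is then bounded by
the total, so no cancellation between the sides can occur. -/
theorem memFormDomain_directSum (hB : ∀ s, IsNonneg (B s)) {g : FibreSpace} :
    MemFormDomain (directSum B) g ↔ ∀ s, MemFormDomain (B s) (g s) := by
  constructor
  · rintro ⟨f, hf, hq⟩ s
    refine ⟨fun n => ⟨(f n : FibreSpace) s, (f n).2 s⟩, ?_, ?_⟩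
    · exact ((PiLp.continuous_apply 2 HalfSpace s).tendsto g).comp hf
    · have hq0 := hq.norm
      rw [norm_zero] at hq0
      refine squeeze_zero_norm (fun p => ?_) hq0
      set d : (directSum B).domain := f p.1 - f p.2
      choose r hr he using fun t => hB t ⟨(d : FibreSpace) t, d.2 t⟩
      have e := inner_directSum d
      simp only [he] at e
      rw [e, ← Complex.ofReal_sum, Complex.norm_real,
        Real.norm_of_nonneg (Finset.sum_nonneg fun t _ => hr t)]
      refine (congrArg norm (he s)).trans_le ?_
      rw [Complex.norm_real, Real.norm_of_nonneg (hr s)]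
      exact Finset.single_le_sum (f := r) (fun t _ => hr t) (Finset.mem_univ s)
  · intro h
    choose f hf hq using h
    refine ⟨fun n => ⟨WithLp.toLp 2 fun s => (f s n : HalfSpace s), fun s => (f s n).2⟩, ?_, ?_⟩
    · exact ((PiLp.continuous_toLp 2 HalfSpace).tendsto g.ofLp).comp (tendsto_pi_nhds.2 hf)
    · have := tendsto_finsetSum Finset.univ fun s _ => hq s
      rw [Finset.sum_const_zero] at this
      exact this.congr fun p => (inner_directSum _).symm

end DirectSum

/-! ### The bilateral-fibre operator -/

section Fibre

variable {α : ℝ} {k : ℤ}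

/-- The asymptotic coefficients of the two components of `g`. -/
def FibreCoeffs (α : ℝ) (g : FibreSpace) (c : Coeffs) : Prop :=
  ∀ s, HasCoeffs α s (g s) (c.1 s) (c.2 s)

theorem FibreCoeffs.unique (hα₀ : 0 ≤ α) (hα₁ : α < 1) {g : FibreSpace} {c d : Coeffs}
    (hc : FibreCoeffs α g c) (hd : FibreCoeffs α g d) : c = d :=
  Prod.ext (funext fun s => ((hc s).unique hα₀ hα₁ (hd s)).1)
    (funext fun s => ((hc s).unique hα₀ hα₁ (hd s)).2)

theorem FibreCoeffs.add (hα₀ : 0 ≤ α) (hα₁ : α < 1) {g h : FibreSpace} {c d : Coeffs}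
    (hc : FibreCoeffs α g c) (hd : FibreCoeffs α h d) : FibreCoeffs α (g + h) (c + d) :=
  fun s => (hc s).add hα₀ hα₁ (hd s)

theorem FibreCoeffs.sub (hα₀ : 0 ≤ α) (hα₁ : α < 1) {g h : FibreSpace} {c d : Coeffs}
    (hc : FibreCoeffs α g c) (hd : FibreCoeffs α h d) : FibreCoeffs α (g - h) (c - d) :=
  fun s => (hc s).sub hα₀ hα₁ (hd s)

theorem FibreCoeffs.smul (hα₀ : 0 ≤ α) (hα₁ : α < 1) {g : FibreSpace} {c : Coeffs} (a : ℂ)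
    (hc : FibreCoeffs α g c) : FibreCoeffs α (a • g) (a • c) :=
  fun s => (hc s).smul hα₀ hα₁ a

theorem fibreOp_dense (α : ℝ) (k : ℤ) : Dense ((fibreOp α k).domain : Set FibreSpace) :=
  dense_directSum_domain (halfOp_dense α k)

theorem mem_fibreOp_adjoint_graph {g v : FibreSpace} :
    (g, v) ∈ (fibreOp α k)†.graph ↔ ∀ s, IsWeakDiffExpr α k s (g s) (v s) :=
  (mem_directSum_adjoint_graph (halfOp_dense α k)).trans
    (forall_congr' fun _ => mem_halfOp_adjoint_graph)

theorem mem_fibreOp_adjoint_domain {g : FibreSpace} :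
    g ∈ (fibreOp α k)†.domain ↔ ∃ v : FibreSpace, ∀ s, IsWeakDiffExpr α k s (g s) (v s) := by
  simp only [LinearPMap.mem_domain_iff, mem_fibreOp_adjoint_graph]

theorem mem_fibreOp_graph {g v : FibreSpace} :
    (g, v) ∈ (fibreOp α k).graph ↔ ∀ s, (g s, v s) ∈ minimalGraph α k s := by
  refine mem_directSum_graph.trans (forall_congr' fun s => ?_)
  rw [halfOp_graph]

theorem fibreOp_le_adjoint (α : ℝ) (k : ℤ) : fibreOp α k ≤ (fibreOp α k)† := by
  refine LinearPMap.le_of_le_graph ?_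
  rintro ⟨g, v⟩ h
  exact (mem_directSum_adjoint_graph (halfOp_dense α k)).2 fun s =>
    LinearPMap.le_graph_of_le (halfOp_le_adjoint α k s) (mem_directSum_graph.1 h s)

theorem fibreOp_isClosable (α : ℝ) (k : ℤ) : (fibreOp α k).IsClosable :=
  (LinearPMap.IsClosed.isClosable (LinearPMap.adjoint_isClosed (fibreOp_dense α k))).leIsClosable
    (fibreOp_le_adjoint α k)

theorem mem_fibreOp_closure_graph (hα₀ : 0 ≤ α) (hα₁ : α < 1) {g v : FibreSpace} :
    (g, v) ∈ (fibreOp α k).closure.graph ↔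
      (∀ s, IsWeakDiffExpr α k s (g s) (v s)) ∧ FibreCoeffs α g 0 := by
  rw [← (fibreOp_isClosable α k).graph_closure_eq_closure_graph,
    mem_topologicalClosure_fibre fun _ _ => mem_fibreOp_graph]
  simp only [mem_topologicalClosure_minimalGraph hα₀ hα₁, forall_and]
  rfl

theorem mem_fibreOp_closure_domain (hα₀ : 0 ≤ α) (hα₁ : α < 1) {g : FibreSpace} :
    g ∈ (fibreOp α k).closure.domain ↔ g ∈ (fibreOp α k)†.domain ∧ FibreCoeffs α g 0 := by
  simp only [LinearPMap.mem_domain_iff, mem_fibreOp_closure_graph hα₀ hα₁, exists_and_right,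
    mem_fibreOp_adjoint_graph]

theorem exists_fibreCoeffs (hα₀ : 0 ≤ α) (hα₁ : α < 1) {g : FibreSpace}
    (hg : g ∈ (fibreOp α k)†.domain) : ∃ c, FibreCoeffs α g c := by
  obtain ⟨v, hv⟩ := mem_fibreOp_adjoint_domain.1 hg
  choose c₀ c₁ hc using fun s => (hv s).exists_hasCoeffs hα₀ hα₁
  exact ⟨(c₀, c₁), hc⟩

variable {P : ℝ → ℂ}

theorem exists_singularFibre (hα₀ : 0 ≤ α) (hα₁ : α < 1) (k : ℤ) (hP : ContDiff ℝ ∞ P)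
    (hPc : HasCompactSupport P) (hP₀ : P 0 = 1) (hP₁ : deriv P 0 = 0) (c : Coeffs) :
    ∃ σ ∈ (fibreOp α k)†.domain,
      (∀ s, IsContinuousRep s (singularPart α P (c.1 s) (c.2 s)) (σ s)) ∧ FibreCoeffs α σ c := by
  choose u v h1 h2 h3 using fun s =>
    exists_singularPart hα₀ hα₁ k hP hPc hP₀ hP₁ s (c.1 s) (c.2 s)
  exact ⟨WithLp.toLp 2 u, mem_fibreOp_adjoint_domain.2 ⟨WithLp.toLp 2 v, h2⟩, h1, h3⟩

/-- With c fixed, φ can only be g - σ, and this vector lies in the domain of the closure precisely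
when g belongs to the adjoint domain and has coefficients c. Existence and uniqueness of the
decomposition thus reduce to those of asymptotic coefficients. -/
theorem isDecomposition_iff (hα₀ : 0 ≤ α) (hα₁ : α < 1) {g φ σ : FibreSpace} {c : Coeffs}
    (hσ : σ ∈ (fibreOp α k)†.domain)
    (hσ' : ∀ s, IsContinuousRep s (singularPart α P (c.1 s) (c.2 s)) (σ s))
    (hσc : FibreCoeffs α σ c) :
    IsDecomposition α k P g φ c ↔
      g ∈ (fibreOp α k)†.domain ∧ FibreCoeffs α g c ∧ φ = g - σ := by
  have e : (∀ s, ∀ᵐ x ∂(sideMeasure s), g s x = φ s x + singularPart α P (c.1 s) (c.2 s) x) ↔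
      g = φ + σ := by
    have : g = φ + σ ↔ ∀ s, g s = φ s + σ s := ⟨fun h s => by rw [h]; rfl, fun h => by
      ext1 s; exact h s⟩
    rw [this]
    refine forall_congr' fun s => ?_
    constructor
    · intro h
      refine Lp.ext ?_
      filter_upwards [h, Lp.coeFn_add (φ s) (σ s), (hσ' s).2] with x h1 h2 h3
      rw [h1, h2, Pi.add_apply, h3]
    · intro h
      filter_upwards [Lp.coeFn_add (φ s) (σ s), (hσ' s).2] with x h2 h3
      rw [h, h2, Pi.add_apply, h3]
  rw [IsDecomposition, e, mem_fibreOp_closure_domain hα₀ hα₁]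
  constructor
  · rintro ⟨⟨h1, h2⟩, rfl⟩
    refine ⟨Submodule.add_mem _ h1 hσ, ?_, by abel⟩
    have := h2.add hα₀ hα₁ hσc
    rwa [zero_add] at this
  · rintro ⟨h1, h2, rfl⟩
    refine ⟨⟨Submodule.sub_mem _ h1 hσ, ?_⟩, by abel⟩
    have := h2.sub hα₀ hα₁ hσc
    rwa [sub_self] at this

theorem mem_boundarySpace (hα₀ : 0 ≤ α) (hα₁ : α < 1) (hP : ContDiff ℝ ∞ P)
    (hPc : HasCompactSupport P) (hP₀ : P 0 = 1) (hP₁ : deriv P 0 = 0) {L : Submodule ℂ Coeffs}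
    {g : FibreSpace} : g ∈ boundarySpace α k P L ↔
      g ∈ (fibreOp α k)†.domain ∧ ∃ c ∈ L, FibreCoeffs α g c := by
  constructor
  · rintro ⟨φ, c, hc, h⟩
    obtain ⟨σ, h1, h2, h3⟩ := exists_singularFibre hα₀ hα₁ k hP hPc hP₀ hP₁ c
    obtain ⟨h4, h5, -⟩ := (isDecomposition_iff hα₀ hα₁ h1 h2 h3).1 h
    exact ⟨h4, c, hc, h5⟩
  · rintro ⟨hg, c, hc, h⟩
    obtain ⟨σ, h1, h2, h3⟩ := exists_singularFibre hα₀ hα₁ k hP hPc hP₀ hP₁ c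
    exact ⟨g - σ, c, hc, (isDecomposition_iff hα₀ hα₁ h1 h2 h3).2 ⟨hg, h, rfl⟩⟩

theorem mem_domRestrict_graph {H : Type*} [NormedAddCommGroup H] [InnerProductSpace ℂ H]
    {A : H →ₗ.[ℂ] H} {S : Submodule ℂ H} {g v : H} :
    (g, v) ∈ (A.domRestrict S).graph ↔ (g, v) ∈ A.graph ∧ g ∈ S := by
  simp only [LinearPMap.mem_graph_iff]
  constructor
  · rintro ⟨y, rfl, hy⟩
    exact ⟨⟨⟨y, y.2.2⟩, rfl, hy⟩, y.2.1⟩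
  · rintro ⟨⟨y, rfl, hy⟩, hS⟩
    exact ⟨⟨y, hS, y.2⟩, rfl, hy⟩

theorem mem_extensionOp_graph (hα₀ : 0 ≤ α) (hα₁ : α < 1) (hP : ContDiff ℝ ∞ P)
    (hPc : HasCompactSupport P) (hP₀ : P 0 = 1) (hP₁ : deriv P 0 = 0) {L : Submodule ℂ Coeffs}
    {g v : FibreSpace} : (g, v) ∈ (extensionOp α k P L).graph ↔
      (g, v) ∈ (fibreOp α k)†.graph ∧ ∃ c ∈ L, FibreCoeffs α g c := by
  rw [extensionOp, mem_domRestrict_graph, mem_boundarySpace hα₀ hα₁ hP hPc hP₀ hP₁]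
  exact and_congr_right fun h => and_iff_right (LinearPMap.mem_domain_of_mem_graph h)

/-! ### The boundary form and self-adjoint extensions. -/

/-- The boundary form. -/
def boundaryForm (c d : Coeffs) : ℂ :=
  ∑ s, (c.2 s * (starRingEnd ℂ) (d.1 s) - c.1 s * (starRingEnd ℂ) (d.2 s))

theorem green_fibre (hα₀ : 0 ≤ α) (hα₁ : α < 1) {g v h w : FibreSpace} {c d : Coeffs}
    (hg : (g, v) ∈ (fibreOp α k)†.graph) (hh : (h, w) ∈ (fibreOp α k)†.graph)
    (hc : FibreCoeffs α g c) (hd : FibreCoeffs α h d) :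
    ⟪w, g⟫_ℂ - ⟪h, v⟫_ℂ = -((1 + α) * boundaryForm c d) := by
  rw [mem_fibreOp_adjoint_graph] at hg hh
  rw [inner_fibre, inner_fibre, ← neg_sub, neg_inj, ← Finset.sum_sub_distrib, boundaryForm,
    Finset.mul_sum]
  exact Finset.sum_congr rfl fun s _ => (hg s).green hα₀ hα₁ (hh s) (hc s) (hd s)

theorem adjoint_graph_anti {H : Type*} [NormedAddCommGroup H] [InnerProductSpace ℂ H]
    [CompleteSpace H] {A B : H →ₗ.[ℂ] H} (hA : Dense (A.domain : Set H)) (h : A ≤ B) :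
    B†.graph ≤ A†.graph := by
  have hB : Dense (B.domain : Set H) := hA.mono h.1
  rw [LinearPMap.adjoint_graph_eq_graph_adjoint hA, LinearPMap.adjoint_graph_eq_graph_adjoint hB]
  intro x hx
  rw [Submodule.mem_adjoint_iff] at hx ⊢
  exact fun a b hab => hx a b (LinearPMap.le_graph_of_le h hab)

/-- Taking adjoints reverses inclusions: B = B† ≤ A† = A. -/
theorem eq_of_le_of_isSelfAdjoint {H : Type*} [NormedAddCommGroup H] [InnerProductSpace ℂ H]
    [CompleteSpace H] {A B : H →ₗ.[ℂ] H} (hA : IsSelfAdjoint A) (hB : IsSelfAdjoint B)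
    (h : A ≤ B) : A = B := by
  refine le_antisymm h (LinearPMap.le_of_le_graph ?_)
  have := adjoint_graph_anti hA.dense_domain h
  rwa [LinearPMap.isSelfAdjoint_def.1 hA, LinearPMap.isSelfAdjoint_def.1 hB] at this

theorem graph_le_adjoint_graph {H : Type*} [NormedAddCommGroup H] [InnerProductSpace ℂ H]
    [CompleteSpace H] {A B : H →ₗ.[ℂ] H} (hA : Dense (A.domain : Set H)) (h : A ≤ B)
    (hB : IsSelfAdjoint B) : B.graph ≤ A†.graph := by
  have := adjoint_graph_anti hA h
  rwa [LinearPMap.isSelfAdjoint_def.1 hB] at this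

/-- Maximal isotropic subspaces for the boundary form. -/
structure IsLagrangian (L : Submodule ℂ Coeffs) : Prop where
  isotropic : ∀ c ∈ L, ∀ d ∈ L, boundaryForm c d = 0
  maximal : ∀ c, (∀ d ∈ L, boundaryForm c d = 0) → c ∈ L

theorem fibreOp_le_extensionOp (hα₀ : 0 ≤ α) (hα₁ : α < 1) (hP : ContDiff ℝ ∞ P)
    (hPc : HasCompactSupport P) (hP₀ : P 0 = 1) (hP₁ : deriv P 0 = 0) (L : Submodule ℂ Coeffs) :
    fibreOp α k ≤ extensionOp α k P L := by
  refine LinearPMap.le_of_le_graph ?_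
  rintro ⟨g, v⟩ h
  rw [mem_extensionOp_graph hα₀ hα₁ hP hPc hP₀ hP₁]
  refine ⟨LinearPMap.le_graph_of_le (fibreOp_le_adjoint α k) h, 0, L.zero_mem, ?_⟩
  exact ((mem_fibreOp_closure_graph hα₀ hα₁).1
    (LinearPMap.le_graph_of_le (fibreOp α k).le_closure h)).2

/-- By Green's formula, a maximal vector belongs to the adjoint of the extension when its
coefficients annihilate L under the boundary form. Conversely, every d ∈ L is realised by a singular
vector, so annihilation of all of L is necessary; maximality returns the coefficients to L. -/
theorem IsLagrangian.isSelfAdjoint (hα₀ : 0 ≤ α) (hα₁ : α < 1) (hP : ContDiff ℝ ∞ P)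
    (hPc : HasCompactSupport P) (hP₀ : P 0 = 1) (hP₁ : deriv P 0 = 0) {L : Submodule ℂ Coeffs}
    (hL : IsLagrangian L) : IsSelfAdjoint (extensionOp α k P L) := by
  have hle := fibreOp_le_extensionOp (k := k) hα₀ hα₁ hP hPc hP₀ hP₁ L
  have hd : Dense ((extensionOp α k P L).domain : Set FibreSpace) :=
    (fibreOp_dense α k).mono hle.1
  rw [LinearPMap.isSelfAdjoint_def]
  refine LinearPMap.eq_of_eq_graph (Submodule.ext ?_)
  rintro ⟨g, v⟩
  constructor
  · intro h
    have hA := adjoint_graph_anti (fibreOp_dense α k) hle h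
    rw [mem_extensionOp_graph hα₀ hα₁ hP hPc hP₀ hP₁]
    obtain ⟨c, hc⟩ := exists_fibreCoeffs hα₀ hα₁ (LinearPMap.mem_domain_of_mem_graph hA)
    refine ⟨hA, c, hL.maximal c fun d hdL => ?_, hc⟩
    obtain ⟨σ, h1, -, h3⟩ := exists_singularFibre hα₀ hα₁ k hP hPc hP₀ hP₁ d
    obtain ⟨w, hw⟩ := LinearPMap.mem_domain_iff.1 h1
    rw [LinearPMap.adjoint_graph_eq_graph_adjoint hd, Submodule.mem_adjoint_iff] at h
    have h5 := h σ w ((mem_extensionOp_graph hα₀ hα₁ hP hPc hP₀ hP₁).2 ⟨hw, d, hdL, h3⟩)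
    rw [green_fibre hα₀ hα₁ hA hw hc h3, neg_eq_zero] at h5
    exact (mul_eq_zero.1 h5).resolve_left (one_add_ne_zero hα₀)
  · intro h
    rw [mem_extensionOp_graph hα₀ hα₁ hP hPc hP₀ hP₁] at h
    obtain ⟨hA, c, hcL, hc⟩ := h
    rw [LinearPMap.adjoint_graph_eq_graph_adjoint hd, Submodule.mem_adjoint_iff]
    intro a b hab
    rw [mem_extensionOp_graph hα₀ hα₁ hP hPc hP₀ hP₁] at hab
    obtain ⟨hab, d, hdL, hd⟩ := hab
    rw [green_fibre hα₀ hα₁ hA hab hc hd, hL.isotropic c hcL d hdL, mul_zero, neg_zero]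

/-- Every element of L is the coefficient vector of some element of the domain, and coefficients are
unique. The operator therefore determines its boundary condition. -/
theorem le_of_extensionOp_eq (hα₀ : 0 ≤ α) (hα₁ : α < 1) (hP : ContDiff ℝ ∞ P)
    (hPc : HasCompactSupport P) (hP₀ : P 0 = 1) (hP₁ : deriv P 0 = 0) {L L' : Submodule ℂ Coeffs}
    (h : extensionOp α k P L = extensionOp α k P L') : L ≤ L' := by
  intro c hc
  obtain ⟨σ, h1, -, h3⟩ := exists_singularFibre hα₀ hα₁ k hP hPc hP₀ hP₁ c
  obtain ⟨w, hw⟩ := LinearPMap.mem_domain_iff.1 h1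
  have h4 := (mem_extensionOp_graph hα₀ hα₁ hP hPc hP₀ hP₁).2 ⟨hw, c, hc, h3⟩
  rw [h, mem_extensionOp_graph hα₀ hα₁ hP hPc hP₀ hP₁] at h4
  obtain ⟨-, d, hd, h5⟩ := h4
  rwa [h3.unique hα₀ hα₁ h5]

theorem fibreCoeffs_zero (hα₀ : 0 ≤ α) (hα₁ : α < 1) : FibreCoeffs α 0 0 :=
  -- The coefficients of a vector do not depend on k, so any value serves here.
  ((mem_fibreOp_closure_domain (k := 0) hα₀ hα₁).1 (Submodule.zero_mem _)).2

/-- The coefficients of the vectors of the domain of `B`. -/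
def coeffSpace (hα₀ : 0 ≤ α) (hα₁ : α < 1) (B : FibreSpace →ₗ.[ℂ] FibreSpace) :
    Submodule ℂ Coeffs where
  carrier := {c | ∃ g ∈ B.domain, FibreCoeffs α g c}
  zero_mem' := ⟨0, B.domain.zero_mem, fibreCoeffs_zero hα₀ hα₁⟩
  add_mem' := by
    rintro c d ⟨g, hg, hc⟩ ⟨h, hh, hd⟩
    exact ⟨g + h, B.domain.add_mem hg hh, hc.add hα₀ hα₁ hd⟩
  smul_mem' := by
    rintro a c ⟨g, hg, hc⟩
    exact ⟨a • g, B.domain.smul_mem a hg, hc.smul hα₀ hα₁ a⟩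

/-- Symmetry of B makes the left-hand side of Green's formula vanish, and 1 + α ≠ 0 can be divided
out. -/
theorem coeffSpace_isotropic (hα₀ : 0 ≤ α) (hα₁ : α < 1) {B : FibreSpace →ₗ.[ℂ] FibreSpace}
    (hle : fibreOp α k ≤ B) (hB : IsSelfAdjoint B) :
    ∀ c ∈ coeffSpace hα₀ hα₁ B, ∀ d ∈ coeffSpace hα₀ hα₁ B, boundaryForm c d = 0 := by
  rintro c ⟨g, hg, hc⟩ d ⟨h, hh, hd⟩
  have hG := graph_le_adjoint_graph (fibreOp_dense α k) hle hB
  obtain ⟨v, hv⟩ := LinearPMap.mem_domain_iff.1 hg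
  obtain ⟨w, hw⟩ := LinearPMap.mem_domain_iff.1 hh
  have e := green_fibre hα₀ hα₁ (hG hv) (hG hw) hc hd
  have hv' := hv
  rw [← LinearPMap.isSelfAdjoint_def.1 hB,
    LinearPMap.adjoint_graph_eq_graph_adjoint hB.dense_domain, Submodule.mem_adjoint_iff] at hv'
  rw [hv' h w hw, eq_comm, neg_eq_zero] at e
  exact (mul_eq_zero.1 e).resolve_left (one_add_ne_zero hα₀)

/-- A self-adjoint extension whose coefficients satisfy a maximal isotropic boundary condition is
the extension with that condition. -/
theorem eq_extensionOp (hα₀ : 0 ≤ α) (hα₁ : α < 1) (hP : ContDiff ℝ ∞ P)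
    (hPc : HasCompactSupport P) (hP₀ : P 0 = 1) (hP₁ : deriv P 0 = 0)
    {B : FibreSpace →ₗ.[ℂ] FibreSpace} (hle : fibreOp α k ≤ B) (hB : IsSelfAdjoint B)
    {L : Submodule ℂ Coeffs} (hL : IsLagrangian L) (hBL : coeffSpace hα₀ hα₁ B ≤ L) :
    B = extensionOp α k P L := by
  refine eq_of_le_of_isSelfAdjoint hB (hL.isSelfAdjoint hα₀ hα₁ hP hPc hP₀ hP₁)
    (LinearPMap.le_of_le_graph ?_)
  rintro ⟨g, v⟩ h
  have hA := graph_le_adjoint_graph (fibreOp_dense α k) hle hB h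
  obtain ⟨c, hc⟩ := exists_fibreCoeffs hα₀ hα₁ (LinearPMap.mem_domain_of_mem_graph hA)
  exact (mem_extensionOp_graph hα₀ hα₁ hP hPc hP₀ hP₁).2
    ⟨hA, c, hBL ⟨g, LinearPMap.mem_domain_of_mem_graph h, hc⟩, hc⟩

/-! ### The Friedrichs extension and its reduction to the two sides. -/

/-- The restriction of the adjoint to the form domain. -/
def friedrichs {H : Type*} [NormedAddCommGroup H] [InnerProductSpace ℂ H] [CompleteSpace H]
    (A : H →ₗ.[ℂ] H) (hA : IsNonneg A) : H →ₗ.[ℂ] H :=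
  A†.domRestrict
    { carrier := {u | MemFormDomain A u}
      zero_mem' := memFormDomain_of_tendsto (f := fun _ => 0) (v := 0) tendsto_const_nhds (by
        simp only [LinearPMap.map_zero]
        exact tendsto_const_nhds)
      add_mem' := fun hu hv => MemFormDomain.add hA hu hv
      smul_mem' := fun c _ hu => MemFormDomain.smul c hu }

theorem isFriedrichsExtension_friedrichs {H : Type*} [NormedAddCommGroup H]
    [InnerProductSpace ℂ H] [CompleteSpace H] {A : H →ₗ.[ℂ] H} (hA : IsNonneg A) :
    IsFriedrichsExtension A (friedrichs A hA) :=
  ⟨LinearPMap.domRestrict_le, fun _ => ⟨fun h => ⟨h.2, h.1⟩, fun h => ⟨h.2, h.1⟩⟩⟩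

theorem memFormDomain_fibreOp_iff (hα₀ : 0 ≤ α) (hα₁ : α < 1) {g v : FibreSpace}
    (h : (g, v) ∈ (fibreOp α k)†.graph) :
    MemFormDomain (fibreOp α k) g ↔ ∃ c ∈ condF, FibreCoeffs α g c := by
  rw [mem_fibreOp_adjoint_graph] at h
  refine (memFormDomain_directSum fun s => isNonneg_halfOp hα₀ k s).trans ?_
  constructor
  · intro hg
    choose c₀ c₁ hc using fun s => (h s).exists_hasCoeffs hα₀ hα₁
    have hz := fun s => (memFormDomain_iff hα₀ hα₁ (h s) (hc s)).1 (hg s)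
    exact ⟨(c₀, c₁), ⟨hz _, hz _⟩, hc⟩
  · rintro ⟨c, hcF, hc⟩ s
    refine (memFormDomain_iff hα₀ hα₁ (h s) (hc s)).2 ?_
    cases s
    exacts [hcF.1, hcF.2]

theorem isFriedrichsExtension_condF (hα₀ : 0 ≤ α) (hα₁ : α < 1) (hP : ContDiff ℝ ∞ P)
    (hPc : HasCompactSupport P) (hP₀ : P 0 = 1) (hP₁ : deriv P 0 = 0) :
    IsFriedrichsExtension (fibreOp α k) (extensionOp α k P condF) := by
  refine ⟨LinearPMap.domRestrict_le, fun g => ?_⟩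
  simp only [LinearPMap.mem_domain_iff, mem_extensionOp_graph hα₀ hα₁ hP hPc hP₀ hP₁]
  rw [exists_and_right, and_congr_right_iff]
  rintro ⟨v, hv⟩
  exact (memFormDomain_fibreOp_iff hα₀ hα₁ hv).symm

theorem extensionOp_condF_eq_directSum (hα₀ : 0 ≤ α) (hα₁ : α < 1) (hP : ContDiff ℝ ∞ P)
    (hPc : HasCompactSupport P) (hP₀ : P 0 = 1) (hP₁ : deriv P 0 = 0) :
    extensionOp α k P condF =
      directSum fun s => friedrichs (halfOp α k s) (isNonneg_halfOp hα₀ k s) := by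
  refine LinearPMap.eq_of_eq_graph (Submodule.ext ?_)
  rintro ⟨g, v⟩
  rw [mem_extensionOp_graph hα₀ hα₁ hP hPc hP₀ hP₁, mem_directSum_graph]
  simp only [friedrichs, mem_domRestrict_graph]
  rw [forall_and]
  have e : (g, v) ∈ (fibreOp α k)†.graph ↔ ∀ s, (g s, v s) ∈ (halfOp α k s)†.graph :=
    mem_directSum_adjoint_graph (halfOp_dense α k)
  rw [← e]
  refine and_congr_right fun h => ?_
  rw [← memFormDomain_fibreOp_iff hα₀ hα₁ h]
  exact memFormDomain_directSum fun s => isNonneg_halfOp hα₀ k s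

end Fibre

/-! ### Maximal isotropic boundary conditions -/

section Lagrangian

theorem boundaryForm_eq (c d : Coeffs) : boundaryForm c d =
    (c.2 .minus * (starRingEnd ℂ) (d.1 .minus) - c.1 .minus * (starRingEnd ℂ) (d.2 .minus)) +
      (c.2 .plus * (starRingEnd ℂ) (d.1 .plus) - c.1 .plus * (starRingEnd ℂ) (d.2 .plus)) := by
  have h : (Finset.univ : Finset Side) = {Side.minus, Side.plus} := rfl
  rw [boundaryForm, h, Finset.sum_pair (by simp)]

/-- The pair of scalars `(a, b)` indexed by the sides. -/
def sidePair (a b : ℂ) : Side → ℂ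
  | .minus => a
  | .plus => b

@[simp] theorem sidePair_minus (a b : ℂ) : sidePair a b .minus = a := rfl

@[simp] theorem sidePair_plus (a b : ℂ) : sidePair a b .plus = b := rfl

theorem mem_condIR {γ : ℝ} {c : Coeffs} :
    c ∈ condIR γ ↔ c.1 .minus = 0 ∧ c.2 .plus = γ * c.1 .plus := Iff.rfl

theorem mem_condIL {γ : ℝ} {c : Coeffs} :
    c ∈ condIL γ ↔ c.1 .plus = 0 ∧ c.2 .minus = γ * c.1 .minus := Iff.rfl

theorem mem_condII {a : ℂ} {γ : ℝ} {c : Coeffs} :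
    c ∈ condII a γ ↔ c.1 .plus = a * c.1 .minus ∧
      c.2 .minus + (starRingEnd ℂ) a * c.2 .plus = γ * c.1 .minus := Iff.rfl

theorem mem_condIII {γ₁ γ₂ γ₃ γ₄ : ℝ} {c : Coeffs} :
    c ∈ condIII γ₁ γ₂ γ₃ γ₄ ↔
      c.2 .minus = γ₁ * c.1 .minus + (γ₂ + Complex.I * γ₃) * c.1 .plus ∧
      c.2 .plus = (starRingEnd ℂ) (γ₂ + Complex.I * γ₃) * c.1 .minus + γ₄ * c.1 .plus := Iff.rfl

theorem isLagrangian_condF : IsLagrangian condF := by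
  constructor
  · rintro c ⟨h1, h2⟩ d ⟨h3, h4⟩
    simp [boundaryForm_eq, h1, h2, h3, h4]
  · intro c h
    -- Maximality is tested on a basis of the two-dimensional space of solutions of the condition;
    -- the same is done for the other conditions.
    have h1 := h (0, sidePair 1 0) ⟨rfl, rfl⟩
    have h2 := h (0, sidePair 0 1) ⟨rfl, rfl⟩
    exact ⟨by simpa [boundaryForm_eq] using h1, by simpa [boundaryForm_eq] using h2⟩

theorem isLagrangian_condIR (γ : ℝ) : IsLagrangian (condIR γ) := by
  constructor
  · rintro c ⟨h1, h2⟩ d ⟨h3, h4⟩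
    simp only [boundaryForm_eq, h1, h2, h3, h4, map_mul, map_zero, Complex.conj_ofReal]
    ring
  · intro c h
    have h1 := h (0, sidePair 1 0) (by simp [mem_condIR])
    have h2 := h (sidePair 0 1, sidePair 0 γ) (by simp [mem_condIR])
    simp [boundaryForm_eq] at h1 h2
    exact ⟨h1, by linear_combination h2⟩

theorem isLagrangian_condIL (γ : ℝ) : IsLagrangian (condIL γ) := by
  constructor
  · rintro c ⟨h1, h2⟩ d ⟨h3, h4⟩
    simp only [boundaryForm_eq, h1, h2, h3, h4, map_mul, map_zero, Complex.conj_ofReal]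
    ring
  · intro c h
    have h1 := h (0, sidePair 0 1) (by simp [mem_condIL])
    have h2 := h (sidePair 1 0, sidePair γ 0) (by simp [mem_condIL])
    simp [boundaryForm_eq] at h1 h2
    exact ⟨h1, by linear_combination h2⟩

theorem isLagrangian_condII (a : ℂ) (γ : ℝ) : IsLagrangian (condII a γ) := by
  constructor
  · rintro c ⟨h1, h2⟩ d ⟨h3, h4⟩
    have h5 := congrArg (starRingEnd ℂ) h4
    simp only [map_add, map_mul, Complex.conj_conj, Complex.conj_ofReal] at h5
    simp only [boundaryForm_eq, h1, h3, map_mul]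
    linear_combination (starRingEnd ℂ) (d.1 .minus) * h2 - c.1 .minus * h5
  · intro c h
    have h1 := h (0, sidePair (-(starRingEnd ℂ) a) 1) (by simp [mem_condII])
    have h2 := h (sidePair 1 a, sidePair γ 0) (by simp [mem_condII])
    simp [boundaryForm_eq] at h1 h2
    exact ⟨by linear_combination -h1, by linear_combination h2⟩

theorem isLagrangian_condIII (γ₁ γ₂ γ₃ γ₄ : ℝ) : IsLagrangian (condIII γ₁ γ₂ γ₃ γ₄) := by
  constructor
  · rintro c ⟨h1, h2⟩ d ⟨h3, h4⟩
    simp only [boundaryForm_eq, h1, h2, h3, h4, map_mul, map_add, Complex.conj_conj,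
      Complex.conj_ofReal]
    ring
  · intro c h
    have h1 := h (sidePair 1 0, sidePair γ₁ ((starRingEnd ℂ) (γ₂ + Complex.I * γ₃)))
      (by simp [mem_condIII])
    have h2 := h (sidePair 0 1, sidePair (γ₂ + Complex.I * γ₃) γ₄) (by simp [mem_condIII])
    simp only [boundaryForm_eq, sidePair_minus, sidePair_plus, map_one, map_zero, mul_one, mul_zero,
      Complex.conj_conj, Complex.conj_ofReal] at h1 h2
    exact ⟨by linear_combination h1, by linear_combination h2⟩

/-- An isotropic subspace satisfies one of the boundary conditions of the classification. -/
theorem exists_le_of_isotropic {L : Submodule ℂ Coeffs}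
    (hL : ∀ c ∈ L, ∀ d ∈ L, boundaryForm c d = 0) :
    L ≤ condF ∨ (∃ γ, L ≤ condIR γ) ∨ (∃ γ, L ≤ condIL γ) ∨ (∃ a γ, a ≠ 0 ∧ L ≤ condII a γ) ∨
      ∃ γ₁ γ₂ γ₃ γ₄, L ≤ condIII γ₁ γ₂ γ₃ γ₄ := by
  simp only [boundaryForm_eq] at hL
  -- Case distinction on the dimension of the projection of L to (g₀⁻, g₀⁺). A non-zero determinant
  -- means that the projection is onto, and Cramer's rule produces elements `e`, `f` of L above the
  -- standard basis.
  by_cases hdet : ∃ c ∈ L, ∃ d ∈ L, c.1 .minus * d.1 .plus - c.1 .plus * d.1 .minus ≠ 0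
  · obtain ⟨c, hc, d, hd, hne⟩ := hdet
    set D := c.1 .minus * d.1 .plus - c.1 .plus * d.1 .minus
    obtain ⟨e, he, em, ep⟩ : ∃ e ∈ L, e.1 .minus = 1 ∧ e.1 .plus = 0 := by
      refine ⟨(d.1 .plus / D) • c - (c.1 .plus / D) • d,
        L.sub_mem (L.smul_mem _ hc) (L.smul_mem _ hd), ?_, ?_⟩
      · simp only [Prod.fst_sub, Prod.smul_fst, Pi.sub_apply, Pi.smul_apply, smul_eq_mul]
        field_simp
        ring
      · simp only [Prod.fst_sub, Prod.smul_fst, Pi.sub_apply, Pi.smul_apply, smul_eq_mul]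
        ring
    obtain ⟨f, hf, fm, fp⟩ : ∃ f ∈ L, f.1 .minus = 0 ∧ f.1 .plus = 1 := by
      refine ⟨(c.1 .minus / D) • d - (d.1 .minus / D) • c,
        L.sub_mem (L.smul_mem _ hd) (L.smul_mem _ hc), ?_, ?_⟩
      · simp only [Prod.fst_sub, Prod.smul_fst, Pi.sub_apply, Pi.smul_apply, smul_eq_mul]
        ring
      · simp only [Prod.fst_sub, Prod.smul_fst, Pi.sub_apply, Pi.smul_apply, smul_eq_mul]
        field_simp
        ring
    -- Isotropy on `e` and `f` says that the matrix taking g₀ to g₁ is Hermitian: `h1` and `h2` make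
    -- the diagonal real, `h3` makes the off-diagonal entries conjugate.
    have h1 := hL e he e he
    have h2 := hL f hf f hf
    have h3 := hL e he f hf
    simp only [em, ep, fm, fp, map_one, map_zero, mul_one, mul_zero, one_mul, zero_mul, sub_zero,
      zero_sub, add_zero, zero_add] at h1 h2 h3
    obtain ⟨γ₁, hγ₁⟩ := Complex.conj_eq_iff_real.1 (sub_eq_zero.1 h1).symm
    obtain ⟨γ₄, hγ₄⟩ := Complex.conj_eq_iff_real.1 (sub_eq_zero.1 h2).symm
    refine .inr (.inr (.inr (.inr ⟨γ₁, (f.2 .minus).re, (f.2 .minus).im, γ₄, fun x hx => ?_⟩)))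
    have hζ : ((f.2 .minus).re : ℂ) + Complex.I * (f.2 .minus).im = f.2 .minus := by
      rw [mul_comm, Complex.re_add_im]
    have h4 := hL x hx e he
    have h5 := hL x hx f hf
    have h6 : e.2 .plus = (starRingEnd ℂ) (f.2 .minus) := by linear_combination h3
    simp only [em, ep, fm, fp, map_one, map_zero, mul_one, mul_zero, hγ₁, hγ₄, h6,
      Complex.conj_conj, Complex.conj_ofReal] at h4 h5
    rw [mem_condIII, hζ]
    exact ⟨by linear_combination h4, by linear_combination h5⟩
  · push Not at hdet
    by_cases hm : ∃ c ∈ L, c.1 .minus ≠ 0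
    · obtain ⟨c, hc, hne⟩ := hm
      obtain ⟨e, he, em⟩ : ∃ e ∈ L, e.1 .minus = 1 :=
        ⟨(c.1 .minus)⁻¹ • c, L.smul_mem _ hc, by simp [hne]⟩
      -- The projection is the line spanned by (1, a). Isotropy of `e` with itself makes e₁⁻ +
      -- conj(a) e₁⁺ real, which gives γ; pairing any other element with `e` gives the second
      -- equation of the condition. The direction a = 0 is family I_L.
      set a := e.1 .plus with ha
      have h1 := hL e he e he
      simp only [em, ← ha, map_one, mul_one, one_mul] at h1
      obtain ⟨γ, hγ⟩ := Complex.conj_eq_iff_real.1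
        (show (starRingEnd ℂ) (e.2 .minus + (starRingEnd ℂ) a * e.2 .plus) = _ by
          simp only [map_add, map_mul, Complex.conj_conj]
          linear_combination -h1)
      have key : ∀ x ∈ L, x ∈ condII a γ := fun x hx => by
        have h2 := hdet e he x hx
        have h3 := hL x hx e he
        have h4 : (starRingEnd ℂ) (e.2 .minus) + a * (starRingEnd ℂ) (e.2 .plus) = γ := by
          have := congrArg (starRingEnd ℂ) hγ
          simpa only [map_add, map_mul, Complex.conj_conj, Complex.conj_ofReal] using this
        simp only [em, ← ha, map_one, mul_one, one_mul] at h2 h3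
        have h5 : x.1 .plus = a * x.1 .minus := by linear_combination h2
        rw [h5] at h3
        exact mem_condII.2 ⟨h5, by linear_combination h3 + x.1 .minus * h4⟩
      by_cases ha0 : a = 0
      · refine .inr (.inr (.inl ⟨γ, fun x hx => ?_⟩))
        have h2 := mem_condII.1 (key x hx)
        rw [ha0] at h2
        simpa [mem_condIL] using h2
      · exact .inr (.inr (.inr (.inl ⟨a, γ, ha0, key⟩)))
    · push Not at hm
      by_cases hp : ∃ c ∈ L, c.1 .plus ≠ 0
      · obtain ⟨c, hc, hne⟩ := hp
        obtain ⟨e, he, ep⟩ : ∃ e ∈ L, e.1 .plus = 1 :=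
          ⟨(c.1 .plus)⁻¹ • c, L.smul_mem _ hc, by simp [hne]⟩
        have em := hm e he
        have h1 := hL e he e he
        simp only [em, ep, map_one, map_zero, mul_one, mul_zero, one_mul, zero_mul, sub_zero,
          zero_add] at h1
        obtain ⟨γ, hγ⟩ := Complex.conj_eq_iff_real.1 (sub_eq_zero.1 h1).symm
        refine .inr (.inl ⟨γ, fun x hx => ⟨hm x hx, ?_⟩⟩)
        have h3 := hL x hx e he
        simp only [em, ep, hm x hx, hγ, map_one, map_zero, mul_one, mul_zero, zero_mul,
          Complex.conj_ofReal] at h3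
        linear_combination h3
      · push Not at hp
        exact .inl fun x hx => ⟨hm x hx, hp x hx⟩

/-! ### Separation of the families by their leading coefficients. -/

/-- The values of `(g₀⁻, g₀⁺)` in the sub-families. -/
def leadingRange : FamilyLabel → ℂ → ℂ → Prop
  | .friedrichs => fun x y => x = 0 ∧ y = 0
  | .IR => fun x _ => x = 0
  | .IL => fun _ y => y = 0
  | .II a => fun x y => y = a * x
  | .III => fun _ _ => True

theorem exists_cond_of_mem_family {α : ℝ} {k : ℤ} {P : ℝ → ℂ} {t : FamilyLabel}
    {B : FibreSpace →ₗ.[ℂ] FibreSpace} (hB : B ∈ family α k P t) :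
    ∃ L : Submodule ℂ Coeffs, B = extensionOp α k P L ∧ IsLagrangian L ∧
      ∀ x y, leadingRange t x y ↔ ∃ z, (sidePair x y, z) ∈ L := by
  cases t with
  | friedrichs => exact ⟨_, hB, isLagrangian_condF, fun x y => ⟨fun h => ⟨0, h⟩, fun ⟨_, h⟩ => h⟩⟩
  | IR =>
    obtain ⟨γ, hB⟩ := hB
    exact ⟨_, hB, isLagrangian_condIR γ, fun x y =>
      ⟨fun h => ⟨sidePair 0 (γ * y), h, rfl⟩, fun ⟨_, h⟩ => h.1⟩⟩
  | IL =>
    obtain ⟨γ, hB⟩ := hB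
    exact ⟨_, hB, isLagrangian_condIL γ, fun x y =>
      ⟨fun h => ⟨sidePair (γ * x) 0, h, rfl⟩, fun ⟨_, h⟩ => h.1⟩⟩
  | II a =>
    obtain ⟨γ, hB⟩ := hB
    exact ⟨_, hB, isLagrangian_condII a γ, fun x y =>
      ⟨fun h => ⟨sidePair (γ * x) 0, mem_condII.2 ⟨h, by simp⟩⟩, fun ⟨_, h⟩ => h.1⟩⟩
  | III =>
    obtain ⟨γ₁, γ₂, γ₃, γ₄, hB⟩ := hB
    exact ⟨_, hB, isLagrangian_condIII γ₁ γ₂ γ₃ γ₄, fun x y =>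
      ⟨fun _ => ⟨sidePair (γ₁ * x + (γ₂ + Complex.I * γ₃) * y)
        ((starRingEnd ℂ) (γ₂ + Complex.I * γ₃) * x + γ₄ * y), rfl, rfl⟩, fun _ => trivial⟩⟩

/-- A few test points identify the label; the points (1, a) recover the parameter of II_a. The label
II₀ is excluded because its range, like that of I_L, is g₀⁺ = 0. -/
theorem eq_of_leadingRange_iff {t t' : FamilyLabel} (ht : t ≠ .II 0) (ht' : t' ≠ .II 0)
    (h : ∀ x y, leadingRange t x y ↔ leadingRange t' x y) : t = t' := by
  have h1 := h 1 0
  have h2 := h 0 1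
  have h3 := h 1 1
  have h4 := fun a => h 1 a
  clear h
  cases t <;> cases t' <;> simp_all [leadingRange, eq_comm]

end Lagrangian

end

end GrushinFibre

/-! ### Assembly of the theorem. -/

theorem mainTheorem7 (α : ℝ) (hα₀ : 0 ≤ α) (hα₁ : α < 1) (k : ℤ)
    (P : ℝ → ℂ) (hP : ContDiff ℝ ∞ P) (hPc : HasCompactSupport P)
    (hP₀ : P 0 = 1) (hP₁ : deriv P 0 = 0) :
    -- existence and uniqueness of the decomposition
    (∀ g ∈ (GrushinFibre.fibreOp α k)†.domain,
      ∃! p : GrushinFibre.FibreSpace × GrushinFibre.Coeffs,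
        GrushinFibre.IsDecomposition α k P g p.1 p.2) ∧
    -- regularity of `φ`, validity at every point, and meaning of the coefficients
    (∀ g ∈ (GrushinFibre.fibreOp α k)†.domain,
      ∀ (φ : GrushinFibre.FibreSpace) (c : GrushinFibre.Coeffs),
      GrushinFibre.IsDecomposition α k P g φ c →
        (k ≠ 0 → ∀ s, GrushinFibre.MemH20 s (φ s)) ∧
        ∀ s, ∃ G Φ : ℝ → ℂ, GrushinFibre.IsContinuousRep s G (g s) ∧
          GrushinFibre.IsContinuousRep s Φ (φ s) ∧
          (∀ x ∈ GrushinFibre.halfLine s,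
            G x = Φ x + GrushinFibre.singularPart α P (c.1 s) (c.2 s) x) ∧
          GrushinFibre.HasShortRange α s G (c.1 s) (c.2 s)) ∧
    -- every self-adjoint extension acts as the differential expression
    (∀ B : GrushinFibre.FibreSpace →ₗ.[ℂ] GrushinFibre.FibreSpace,
      GrushinFibre.fibreOp α k ≤ B → IsSelfAdjoint B →
        ∀ (g : B.domain) (s : GrushinFibre.Side),
          GrushinFibre.IsWeakDiffExpr α k s ((g : GrushinFibre.FibreSpace) s) ((B g) s)) ∧
    -- the condition `g₀ = 0` gives the Friedrichs extension, which is reduced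
    (GrushinFibre.IsFriedrichsExtension (GrushinFibre.fibreOp α k)
        (GrushinFibre.extensionOp α k P GrushinFibre.condF) ∧
      ∃ F : ∀ s, GrushinFibre.HalfSpace s →ₗ.[ℂ] GrushinFibre.HalfSpace s,
        (∀ s, GrushinFibre.IsFriedrichsExtension (GrushinFibre.halfOp α k s) (F s)) ∧
        GrushinFibre.extensionOp α k P GrushinFibre.condF = GrushinFibre.directSum F) ∧
    -- the members of the families are self-adjoint extensions
    (∀ t, ∀ B ∈ GrushinFibre.family α k P t,
      GrushinFibre.fibreOp α k ≤ B ∧ IsSelfAdjoint B) ∧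
    -- the families exhaust the self-adjoint extensions
    (∀ B : GrushinFibre.FibreSpace →ₗ.[ℂ] GrushinFibre.FibreSpace,
      GrushinFibre.fibreOp α k ≤ B → IsSelfAdjoint B →
        ∃ t, t ≠ GrushinFibre.FamilyLabel.II 0 ∧ B ∈ GrushinFibre.family α k P t) ∧
    -- the families are mutually disjoint
    (∀ t t' : GrushinFibre.FamilyLabel, t ≠ GrushinFibre.FamilyLabel.II 0 →
      t' ≠ GrushinFibre.FamilyLabel.II 0 → t ≠ t' →
        Disjoint (GrushinFibre.family α k P t) (GrushinFibre.family α k P t')) := by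
  -- For the asymptotic coefficients of g the regular part is forced to be g - σ. The companion
  -- `dec` shows that the coefficients of any decomposition are the asymptotic ones, so together
  -- they give uniqueness.
  have adj : ∀ {g}, g ∈ (GrushinFibre.fibreOp α k)†.domain →
      ∃ c σ, GrushinFibre.FibreCoeffs α g c ∧ ∀ φ,
        GrushinFibre.IsDecomposition α k P g φ c ↔ φ = g - σ := fun {g} hg => by
    obtain ⟨c, hc⟩ := GrushinFibre.exists_fibreCoeffs hα₀ hα₁ hg
    obtain ⟨σ, h1, h2, h3⟩ := GrushinFibre.exists_singularFibre hα₀ hα₁ k hP hPc hP₀ hP₁ c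
    exact ⟨c, σ, hc, fun φ => (GrushinFibre.isDecomposition_iff hα₀ hα₁ h1 h2 h3).trans
      ⟨fun h => h.2.2, fun h => ⟨hg, hc, h⟩⟩⟩
  have dec : ∀ {g φ c}, GrushinFibre.IsDecomposition α k P g φ c →
      ∃ σ, (∀ s, GrushinFibre.IsContinuousRep s (GrushinFibre.singularPart α P (c.1 s) (c.2 s))
        (σ s)) ∧ GrushinFibre.FibreCoeffs α g c ∧ φ = g - σ := fun {g φ c} h => by
    obtain ⟨σ, h1, h2, h3⟩ := GrushinFibre.exists_singularFibre hα₀ hα₁ k hP hPc hP₀ hP₁ c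
    exact ⟨σ, h2, ((GrushinFibre.isDecomposition_iff hα₀ hα₁ h1 h2 h3).1 h).2⟩
  refine ⟨fun g hg => ?_, fun g _ φ c h => ⟨fun _ s => ?_, fun s => ?_⟩, fun B hle hB g s => ?_,
    ⟨GrushinFibre.isFriedrichsExtension_condF hα₀ hα₁ hP hPc hP₀ hP₁, _,
      fun s => GrushinFibre.isFriedrichsExtension_friedrichs _,
      GrushinFibre.extensionOp_condF_eq_directSum hα₀ hα₁ hP hPc hP₀ hP₁⟩,
    fun t B hB => ?_, fun B hle hB => ?_, fun t t' ht ht' hne => ?_⟩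
  · obtain ⟨c, σ, hc, hφ⟩ := adj hg
    refine ⟨(g - σ, c), (hφ _).2 rfl, ?_⟩
    rintro ⟨φ, d⟩ h
    obtain ⟨-, -, hd, -⟩ := dec h
    obtain rfl := hd.unique hα₀ hα₁ hc
    exact Prod.ext ((hφ φ).1 h) rfl
  · obtain ⟨⟨v, hv⟩, hc⟩ := (GrushinFibre.mem_fibreOp_closure_domain hα₀ hα₁).1 h.1 |>.imp_left
      GrushinFibre.mem_fibreOp_adjoint_domain.1
    exact GrushinFibre.memH20_of_mem_topologicalClosure hα₀ hα₁
      ((GrushinFibre.mem_topologicalClosure_minimalGraph hα₀ hα₁).2 ⟨hv s, hc s⟩)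
  · obtain ⟨σ, hσ, hc, rfl⟩ := dec h
    obtain ⟨G, hG, hS⟩ := hc s
    refine ⟨G, fun x => G x - GrushinFibre.singularPart α P (c.1 s) (c.2 s) x, hG,
      ⟨hG.1.sub (hσ s).1, (Lp.coeFn_sub (g s) (σ s)).trans (hG.2.sub (hσ s).2)⟩,
      fun x _ => (sub_add_cancel _ _).symm, hS⟩
  · exact GrushinFibre.mem_fibreOp_adjoint_graph.1
      (GrushinFibre.graph_le_adjoint_graph (GrushinFibre.fibreOp_dense α k) hle hB
        (B.mem_graph g)) s
  · obtain ⟨L, rfl, hL, -⟩ := GrushinFibre.exists_cond_of_mem_family hB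
    exact ⟨GrushinFibre.fibreOp_le_extensionOp hα₀ hα₁ hP hPc hP₀ hP₁ L,
      hL.isSelfAdjoint hα₀ hα₁ hP hPc hP₀ hP₁⟩
  -- The coefficient space of B is isotropic, hence contained in one of the conditions. Each
  -- condition is maximal isotropic, so B is contained in a self-adjoint extension and equals it.
  · have key := fun L => GrushinFibre.eq_extensionOp hα₀ hα₁ hP hPc hP₀ hP₁ (L := L) hle hB
    obtain h | ⟨γ, h⟩ | ⟨γ, h⟩ | ⟨a, γ, ha, h⟩ | ⟨γ₁, γ₂, γ₃, γ₄, h⟩ :=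
      GrushinFibre.exists_le_of_isotropic (GrushinFibre.coeffSpace_isotropic hα₀ hα₁ hle hB)
    · exact ⟨.friedrichs, by simp, key _ GrushinFibre.isLagrangian_condF h⟩
    · exact ⟨.IR, by simp, γ, key _ (GrushinFibre.isLagrangian_condIR γ) h⟩
    · exact ⟨.IL, by simp, γ, key _ (GrushinFibre.isLagrangian_condIL γ) h⟩
    · exact ⟨.II a, by simpa using ha, γ, key _ (GrushinFibre.isLagrangian_condII a γ) h⟩
    · exact ⟨.III, by simp, γ₁, γ₂, γ₃, γ₄,
        key _ (GrushinFibre.isLagrangian_condIII γ₁ γ₂ γ₃ γ₄) h⟩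
  · refine Set.disjoint_left.2 fun B hB hB' => hne ?_
    obtain ⟨L, rfl, -, hL⟩ := GrushinFibre.exists_cond_of_mem_family hB
    obtain ⟨L', e, -, hL'⟩ := GrushinFibre.exists_cond_of_mem_family hB'
    obtain rfl : L = L' := le_antisymm
      (GrushinFibre.le_of_extensionOp_eq hα₀ hα₁ hP hPc hP₀ hP₁ e)
      (GrushinFibre.le_of_extensionOp_eq hα₀ hα₁ hP hPc hP₀ hP₁ e.symm)
    exact GrushinFibre.eq_of_leadingRange_iff ht ht' fun x y => (hL x y).trans (hL' x y).symm
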